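/- Let $M$ be an $n$-dimensional smooth manifold without boundary and let $\dot q=V_u(q)$, $u\in U$, be a control system on $M$, where $(V_u)_{u\in U}$ is a family of complete smooth vector fields; $P^t_u$ denotes the flow of $V_u$. For $x\in M$ put $V(x)=\{V_u(x):u\in U\}\subset T_xM$ and let $L(x)$ be the linear span of $V(x)$. Let $q\in M$ and assume that $\dim L(x)$ is constant for $x$ near $q$. Assume further: (i) $V(q)$ is ample: for some neighbourhood $B$ of $q$ the set $\bigcup_{x\in B}V(x)$ is open in $\bigcup_{x\in B}L(x)\subset TM$, and the convex hull of $V(q)$ equals $L(q)$; (ii) the Lie algebra rank condition holds at $q$: the Lie algebra of vector fields generated by finitely many of the $V_u$, evaluated at $q$, is $T_qM$. Then the system is involved at $q$, which means the following. For every trajectory $\gamma:[a,b]\to M$ (a continuous curve with $\dot\gamma=V_{u(t)}(\gamma)$ for some control function $u:\mathbb R\to U$, understood as the integral equation for all $f\circ\gamma$, $f\in C^\infty(M)$) and every $t_0\in[a,b)$ with $\gamma(t_0)=q$ there are finitely many generators $V_{u_1},\dots,V_{u_l}$, $u_i\in U$, such that $\gamma$ is general relative to them: there is a finite sequence $i_1,\dots,i_N$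 in $\{1,\dots,l\}$ such that, with $G(t_1,\dots,t_N)\in M$ denoting the point obtained from $q$ by applying $P^{t_1}_{u_{i_1}}$ first, then $P^{t_2}_{u_{i_2}}$, and so on up to $P^{t_N}_{u_{i_N}}$, (a) the product $G$ is general at $q$: there is a finite family of iterated brackets $[V_{u_{j_1}},[V_{u_{j_2}},[\dots,V_{u_{j_k}}]]]$ of the generators (including the generators themselves) whose values at $q$ span $T_qM$, and each word $w_1\cdots w_k$ for which $V_{u_{w_1}}\circ\dots\circ V_{u_{w_k}}$ arises when the commutators in one of these brackets are expanded is a subsequence of $i_1,\dots,i_N$ (so that this composition is a mixed partial derivative of $G$ at $t=0$ in distinct variables); (b) for all sufficiently large $m$ and every smooth chart $\varphi$ around $q$ there are $\varepsilon>0$ with $t_0+\varepsilon\le b$ and $t=(t_1,\dots,t_N)$ with all $t_i>0$ such that $\gamma(t_0+\varepsilon)=G(t)$, the differential $dG(t):\mathbb R^N\to T_{G(t)}M$ is surjective, and $t\notin\Omega$. Here $\Omega\subset\mathbb R^N$ is the zero set, given by a polynomial equation, of all points at which the differential of the order $m$ Taylor polynomial of $\varphi\circ G$ at $0$ is not surjective.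 -/

import Mathlib

open scoped Manifold ContDiff Topology Nat

noncomputable section

/-- A control system `q' = V_u(q)` on an `n`-dimensional manifold `M` without boundary: a family of
smooth vector fields, indexed by the controls `u : U`, each of which generates a one-parameter
group of diffeomorphisms of `M`, that is, each of which is complete. -/
structure ControlSystem (n : ℕ) (M : Type*) [TopologicalSpace M]
    [ChartedSpace (EuclideanSpace ℝ (Fin n)) M] [IsManifold (𝓡 n) ∞ M] (U : Type*) where
  /-- the vector field `V_u` -/
  field : U → (x : M) → TangentSpace (𝓡 n) x
  smooth : ∀ u, ContMDiff (𝓡 n) (𝓡 n).tangent ∞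
    (fun x => (⟨x, field u x⟩ : TangentBundle (𝓡 n) M))
  complete : ∀ u (x : M), ∃ γ : ℝ → M, γ 0 = x ∧ IsMIntegralCurve γ (field u)

namespace ControlSystem

section Brackets

variable {n : ℕ} {M : Type*} [TopologicalSpace M] [ChartedSpace (EuclideanSpace ℝ (Fin n)) M]

/-- Membership in the Lie algebra of vector fields generated by a set `F` of vector fields. -/
inductive InLieAlgebra (F : Set ((x : M) → TangentSpace (𝓡 n) x)) :
    ((x : M) → TangentSpace (𝓡 n) x) → Prop
  | of {X} : X ∈ F → InLieAlgebra F X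
  | zero : InLieAlgebra F 0
  | add {X Y} : InLieAlgebra F X → InLieAlgebra F Y → InLieAlgebra F (X + Y)
  | smul (a : ℝ) {X} : InLieAlgebra F X → InLieAlgebra F (a • X)
  | bracket {X Y} : InLieAlgebra F X → InLieAlgebra F Y →
      InLieAlgebra F (VectorField.mlieBracket (𝓡 n) X Y)

/-- The iterated bracket `[W_{i₁}, [W_{i₂}, [..., W_{i_k}]]]` of vector fields `W_i`, where
`[i₁, ..., i_k]` is a nonempty list of indices; for `k = 1` it is `W_{i₁}` itself. -/
def nestedBracket {ι : Type*} (W : ι → (x : M) → TangentSpace (𝓡 n) x) :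
    List ι → (x : M) → TangentSpace (𝓡 n) x
  | [] => 0
  | [i] => W i
  | i :: j :: β => VectorField.mlieBracket (𝓡 n) (W i) (nestedBracket W (j :: β))

end Brackets

/-- The words `w₁ ... w_k` for which the composition of derivations `W_{w₁} ∘ ... ∘ W_{w_k}` occurs
(with a sign) when the commutators in `[W_{i₁}, [W_{i₂}, [..., W_{i_k}]]]` are expanded. -/
def bracketMonomials {ι : Type*} : List ι → List (List ι)
  | [] => []
  | [i] => [[i]]
  | i :: j :: β => (bracketMonomials (j :: β)).flatMap fun w => [i :: w, w ++ [i]]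

/-- The Taylor polynomial of order `m` at `0` of a map of several real variables. -/
def taylorPoly {N n : ℕ} (g : (Fin N → ℝ) → EuclideanSpace ℝ (Fin n)) (m : ℕ) (t : Fin N → ℝ) :
    EuclideanSpace ℝ (Fin n) :=
  ∑ k ∈ Finset.range (m + 1), ((k ! : ℝ)⁻¹) • iteratedFDeriv ℝ k g 0 (fun _ => t)

variable {n : ℕ} {M : Type*} [TopologicalSpace M] [ChartedSpace (EuclideanSpace ℝ (Fin n)) M]
  [IsManifold (𝓡 n) ∞ M] {U : Type*}

/-- The set `V(x)` of all control vectors at `x`. -/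
def controlVectors (S : ControlSystem n M U) (x : M) : Set (TangentSpace (𝓡 n) x) :=
  Set.range fun u => S.field u x

/-- The linear subspace `L(x)` of the tangent space generated by the control vectors. -/
def controlSpan (S : ControlSystem n M U) (x : M) : Submodule ℝ (TangentSpace (𝓡 n) x) :=
  Submodule.span ℝ (S.controlVectors x)

/-- The set of control vectors is open at `q`: for some neighbourhood `B` of `q`, the union of the
`V(x)`, `x ∈ B`, is relatively open in the union `L_B` of the `L(x)`, `x ∈ B`, inside the tangent
bundle. -/
def IsOpenAt (S : ControlSystem n M U) (q : M) : Prop :=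
  ∃ B : Set M, IsOpen B ∧ q ∈ B ∧ ∃ O : Set (TangentBundle (𝓡 n) M), IsOpen O ∧
    {p : TangentBundle (𝓡 n) M | p.1 ∈ B ∧ p.2 ∈ S.controlVectors p.1} =
      O ∩ {p : TangentBundle (𝓡 n) M | p.1 ∈ B ∧ p.2 ∈ S.controlSpan p.1}

/-- `V(q)` is ample: it is open at `q` and its convex hull is `L(q)`. -/
def IsAmple (S : ControlSystem n M U) (q : M) : Prop :=
  S.IsOpenAt q ∧
    convexHull ℝ (S.controlVectors q) = (S.controlSpan q : Set (TangentSpace (𝓡 n) q))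

/-- The Lie algebra rank condition at `q`: the Lie algebra generated by finitely many of the fields
`V_u`, evaluated at `q`, is the whole tangent space. -/
def LARC (S : ControlSystem n M U) (q : M) : Prop :=
  ∃ s : Set U, s.Finite ∧ ∀ w : TangentSpace (𝓡 n) q, ∃ X, InLieAlgebra (S.field '' s) X ∧ X q = w

/-- The flow `P^t_u` of the field `V_u`. -/
def flow (S : ControlSystem n M U) (u : U) (t : ℝ) (x : M) : M :=
  Classical.choose (S.complete u x) t

/-- The chronological product `q ∘ P^{t₁}_{u₁} ∘ ... ∘ P^{t_N}_{u_N}` (the point `q` is moved by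
`P^{t₁}_{u₁}` first), as a function of the point and of the times. -/
def chronological (S : ControlSystem n M U) : {N : ℕ} → (Fin N → U) → M → (Fin N → ℝ) → M
  | 0, _, q, _ => q
  | _ + 1, u, q, t => S.chronological (Fin.tail u) (S.flow (u 0) (t 0) q) (Fin.tail t)

/-- A curve `γ : [a, b] → M` is a trajectory: it is continuous and, for some control function `u`,
it satisfies `γ' = V_{u(t)}(γ)` in the Carathéodory sense, i.e. for every smooth
`f : M → ℝ` the function `f ∘ γ` is the integral of `df(V_{u(t)}(γ(t)))`. -/
def IsTrajectory (S : ControlSystem n M U) (γ : ℝ → M) (a b : ℝ) : Prop :=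
  ContinuousOn γ (Set.Icc a b) ∧ ∃ u : ℝ → U, ∀ f : M → ℝ, ContMDiff (𝓡 n) 𝓘(ℝ, ℝ) ∞ f →
    IntervalIntegrable
      (fun τ => (mfderiv (𝓡 n) 𝓘(ℝ, ℝ) f (γ τ) (S.field (u τ) (γ τ)) : ℝ)) MeasureTheory.volume a b ∧
    ∀ t ∈ Set.Icc a b, f (γ t) - f (γ a) =
      ∫ τ in a..t, (mfderiv (𝓡 n) 𝓘(ℝ, ℝ) f (γ τ) (S.field (u τ) (γ τ)) : ℝ)

/-- The chronological product with factors `V_{v (c 1)}, ..., V_{v (c N)}` is general at `q` relative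
to the set of generators `V_{v 1}, ..., V_{v l}`: some iterated brackets of the generators span the
tangent space at `q`, and every monomial in the expansions of these brackets is realized by a mixed
partial derivative at `t = 0`, with respect to different variables, of the product. (The derivative
with respect to `t_{i₁}, ..., t_{i_k}`, `i₁ < ... < i_k`, is the composition of the corresponding
derivations in this order.) -/
def IsGeneralProduct (S : ControlSystem n M U) (q : M) {l N : ℕ} (v : Fin l → U)
    (c : Fin N → Fin l) : Prop :=
  ∃ B : Finset (List (Fin l)),
    Submodule.span ℝ {w : TangentSpace (𝓡 n) q |
      ∃ β ∈ B, w = nestedBracket (fun i => S.field (v i)) β q} = ⊤ ∧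
    ∀ β ∈ B, ∀ w ∈ bracketMonomials β, w.Sublist (List.ofFn c)

/-- The zero set `Ω ⊂ ℝ^N` of the chronological product at `q`, in the coordinates `e` and to order
`m`: the points at which the differential of the order `m` Taylor polynomial of the product at
`t = 0` is not surjective. This is the set where a polynomial, the sum of the squares of the maximal
minors, vanishes; it is closed and, unless it is everything, has empty interior. -/
def zeroSet (S : ControlSystem n M U) (q : M) {N : ℕ} (u : Fin N → U)
    (e : OpenPartialHomeomorph M (EuclideanSpace ℝ (Fin n))) (m : ℕ) : Set (Fin N → ℝ) :=
  {t | ¬ Function.Surjective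
    (fderiv ℝ (taylorPoly (fun s => e (S.chronological u q s)) m) t)}

/-- The trajectory `γ` on `[t₀, b]`, starting at `γ t₀`, is general relative to the set of generators
`V_{v 1}, ..., V_{v l}`: for some chronological product general at `q = γ t₀` and all sufficiently
large orders `m` of the asymptotic expansion, in any coordinates at `q`, the trajectory contains an
interval going from `q` to a point that equals the product at some `t` with all `t i` positive which
lies outside the zero set `Ω`, the differential of the product being surjective at `t`. -/
def IsGeneralTrajectory (S : ControlSystem n M U) (γ : ℝ → M) (t₀ b : ℝ) {l : ℕ}
    (v : Fin l → U) : Prop :=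
  ∃ (N : ℕ) (c : Fin N → Fin l), S.IsGeneralProduct (γ t₀) v c ∧
    ∃ m₀ : ℕ, ∀ m ≥ m₀, ∀ e ∈ IsManifold.maximalAtlas (𝓡 n) ∞ M, γ t₀ ∈ e.source →
      ∃ ε > 0, t₀ + ε ≤ b ∧ ∃ t : Fin N → ℝ, (∀ i, 0 < t i) ∧
        t ∉ S.zeroSet (γ t₀) (v ∘ c) e m ∧
        Function.Surjective
          (mfderiv 𝓘(ℝ, Fin N → ℝ) (𝓡 n) (S.chronological (v ∘ c) (γ t₀)) t) ∧
        γ (t₀ + ε) = S.chronological (v ∘ c) (γ t₀) t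

/-- The system is involved at `q`: every trajectory going through `q` (and continuing beyond `q`) is,
from `q` on, general relative to some finite set of generators. -/
def IsInvolved (S : ControlSystem n M U) (q : M) : Prop :=
  ∀ (γ : ℝ → M) (a b t₀ : ℝ), S.IsTrajectory γ a b → a ≤ t₀ → t₀ < b → γ t₀ = q →
    ∃ (l : ℕ) (v : Fin l → U), S.IsGeneralTrajectory γ t₀ b v

end ControlSystem

end

/-! Ampleness makes zero a positive combination of control vectors: minus the sum of a basis of
`L(q)` taken from `V(q)` lies in the convex hull of `V(q)`. Because the rank is constant, this
relation extends to a neighbourhood: there are finitely many fields `X i` among the `V_u`, including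
those of the rank condition, and smooth positive functions `a i` with `∑ a i • X i = 0` near `q`
(`exists_positive_relation`). The flow of `Y i = a i • X i` is the flow of `X i` after a time change
that keeps positive times positive (`exists_isLocalTime`), and the brackets of the `Y i` still span
at `q` (`span_bracketSpan_eq_top`).

Since the `Y i` sum to zero, positive times suffice to imitate negative ones: every bracket of
length `j` is the coefficient of `s ^ j` in a product of exponentials `exp (c s Y i)`, `c > 0`,
whose lower coefficients vanish (`bracketSpan_subset_posLeads`). Such products are concatenated for
brackets, taken with both signs, whose values span the tangent space, and the parameters are
replaced by suitable powers. This gives times `T σ`, positive for positive `σ`, at which the product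
of flows moves `q` by `∑ σ_b ^ J v_b + O(‖σ‖ ^ (J + 1))`, where the `v_b` span and have sum zero.
The letters required by the bracket monomials are inserted with times of order `σ ^ (J + 1)`, which
do not disturb the leading term.

The power sum vanishes at `σ = s (1, ..., 1)`, where its derivative is surjective of size `s ^ (J -
1)`. For small `s` a genuine zero lies nearby, and the surjectivity survives errors of order `s ^ J`
(`frequently_powSum_eq`). So there are arbitrarily small positive times at which the product returns
to `q` and is a submersion, and the same holds for the differential of its Taylor polynomial of
order `m ≥ J`, which differs by `O(s ^ m)` (`frequently_return`).

Near such a return the product is an open map, so it covers a neighbourhood of `q` by times with the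
same properties. By continuity the trajectory is still in this neighbourhood a little after `t₀`
(`exists_reached_point`). -/

noncomputable section

open PowerSeries Finset.HasAntidiagonal

/-! ### Leading terms of noncommutative power series. -/

namespace PowerSeries

variable {R : Type*} [Ring R]

/-- The power series `p` is divisible by `X ^ j`, expressed through its coefficients. -/
def VanishesTo (j : ℕ) (p : R⟦X⟧) : Prop := ∀ k < j, coeff k p = 0

/-- The power series `p` has the form `1 + X ^ j Z + O(X ^ (j + 1))`. -/
def HasLead (j : ℕ) (Z : R) (p : R⟦X⟧) : Prop := VanishesTo j (p - 1) ∧ coeff j (p - 1) = Z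

theorem VanishesTo.mono {i j : ℕ} {p : R⟦X⟧} (h : VanishesTo j p) (hij : i ≤ j) :
    VanishesTo i p := fun k hk => h k (hk.trans_le hij)

theorem vanishesTo_zero (p : R⟦X⟧) : VanishesTo 0 p := fun k hk => absurd hk (by omega)

theorem VanishesTo.add {j : ℕ} {p q : R⟦X⟧} (hp : VanishesTo j p) (hq : VanishesTo j q) :
    VanishesTo j (p + q) := fun k hk => by rw [map_add, hp k hk, hq k hk, add_zero]

theorem VanishesTo.sub {j : ℕ} {p q : R⟦X⟧} (hp : VanishesTo j p) (hq : VanishesTo j q) :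
    VanishesTo j (p - q) := fun k hk => by rw [map_sub, hp k hk, hq k hk, sub_zero]

theorem VanishesTo.succ {j : ℕ} {p : R⟦X⟧} (hp : VanishesTo j p) (h : coeff j p = 0) :
    VanishesTo (j + 1) p := fun k hk => by
  rcases Nat.lt_succ_iff_lt_or_eq.1 hk with h' | rfl
  exacts [hp k h', h]

theorem VanishesTo.mul {i j : ℕ} {p q : R⟦X⟧} (hp : VanishesTo i p) (hq : VanishesTo j q) :
    VanishesTo (i + j) (p * q) := fun k hk => by
  rw [coeff_mul]
  refine Finset.sum_eq_zero fun x hx => ?_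
  rw [mem_antidiagonal] at hx
  by_cases h : x.1 < i
  · rw [hp _ h, zero_mul]
  · rw [hq _ (by omega), mul_zero]

theorem VanishesTo.coeff_mul_add {i j : ℕ} {p q : R⟦X⟧} (hp : VanishesTo i p)
    (hq : VanishesTo j q) : coeff (i + j) (p * q) = coeff i p * coeff j q := by
  rw [coeff_mul, Finset.sum_eq_single (i, j)]
  · intro x hx hne
    rw [mem_antidiagonal] at hx
    by_cases h : x.1 < i
    · rw [hp _ h, zero_mul]
    · rw [hq _ ?_, mul_zero]
      by_contra h'
      exact hne (Prod.ext (by omega) (by omega))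
  · intro h
    simp at h

theorem VanishesTo.mul_left {j : ℕ} {p : R⟦X⟧} (hp : VanishesTo j p) (q : R⟦X⟧) :
    VanishesTo j (q * p) := by simpa using (vanishesTo_zero q).mul hp

theorem VanishesTo.mul_right {j : ℕ} {p : R⟦X⟧} (hp : VanishesTo j p) (q : R⟦X⟧) :
    VanishesTo j (p * q) := by simpa using hp.mul (vanishesTo_zero q)

theorem VanishesTo.coeff_mul_left {j : ℕ} {p : R⟦X⟧} (hp : VanishesTo j p) (q : R⟦X⟧) :
    coeff j (q * p) = coeff 0 q * coeff j p := by
  simpa using (vanishesTo_zero q).coeff_mul_add hp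

theorem VanishesTo.coeff_mul_right {j : ℕ} {p : R⟦X⟧} (hp : VanishesTo j p) (q : R⟦X⟧) :
    coeff j (p * q) = coeff j p * coeff 0 q := by
  simpa using hp.coeff_mul_add (vanishesTo_zero q)

theorem HasLead.coeff_zero {j : ℕ} (hj : 0 < j) {Z : R} {p : R⟦X⟧} (h : HasLead j Z p) :
    coeff 0 p = 1 := by
  have := h.1 0 hj
  rw [map_sub, coeff_zero_one, sub_eq_zero] at this
  exact this

theorem HasLead.coeff_of_lt {j k : ℕ} {Z : R} {p : R⟦X⟧} (h : HasLead j Z p) (hk : 0 < k)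
    (hkj : k < j) : coeff k p = 0 := by
  have := h.1 k hkj
  rwa [map_sub, coeff_one, if_neg hk.ne', sub_zero] at this

theorem HasLead.coeff_self {j : ℕ} (hj : 0 < j) {Z : R} {p : R⟦X⟧} (h : HasLead j Z p) :
    coeff j p = Z := by
  have := h.2
  rwa [map_sub, coeff_one, if_neg hj.ne', sub_zero] at this

theorem hasLead_one (j : ℕ) : HasLead j 0 (1 : R⟦X⟧) := by
  simp [HasLead, VanishesTo]

theorem HasLead.mul {j : ℕ} (hj : 0 < j) {Z W : R} {p q : R⟦X⟧} (hp : HasLead j Z p)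
    (hq : HasLead j W q) : HasLead j (Z + W) (p * q) := by
  have e : p * q - 1 = (p - 1) + (q - 1) + (p - 1) * (q - 1) := by noncomm_ring
  have h2 := hp.1.mul hq.1
  rw [HasLead, e]
  refine ⟨(hp.1.add hq.1).add (h2.mono (by omega)), ?_⟩
  rw [map_add, map_add, hp.2, hq.2, h2 j (by omega), add_zero]

theorem HasLead.pow {j : ℕ} (hj : 0 < j) {Z : R} {p : R⟦X⟧} (hp : HasLead j Z p) (n : ℕ) :
    HasLead j (n • Z) (p ^ n) := by
  induction n with
  | zero => simpa using hasLead_one j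
  | succ n ih => rw [pow_succ, succ_nsmul]; exact ih.mul hj hp

theorem HasLead.succ {j : ℕ} {p : R⟦X⟧} (h : HasLead j 0 p) :
    HasLead (j + 1) (coeff (j + 1) (p - 1)) p := ⟨h.1.succ h.2, rfl⟩

/-- Multiplying by `x` on the left and by `x'` on the right, where `x x'` has leading term
`X ^ j a`, adds `a` to the leading term. -/
theorem HasLead.conj {j : ℕ} {Z a : R} {p x x' : R⟦X⟧} (hp : HasLead j Z p)
    (hx : coeff 0 x = 1) (hx' : coeff 0 x' = 1) (h : HasLead j a (x * x')) :
    HasLead j (Z + a) (x * p * x') := by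
  have e : x * p * x' - 1 = x * (p - 1) * x' + (x * x' - 1) := by noncomm_ring
  have h1 := hp.1.mul_left x
  rw [HasLead, e]
  refine ⟨(h1.mul_right x').add h.1, ?_⟩
  rw [map_add, h1.coeff_mul_right, hp.1.coeff_mul_left, hx, hx', one_mul, mul_one, hp.2, h.2]

/-- Peeling off the outer factors is a conjugation, which adds `a` each time. The defect of `x' ^ n`
as an inverse of `x ^ n` thus grows only linearly in `n`, whereas the bracket in a commutator of
`n`-th powers grows like `n ^ 2`. -/
theorem HasLead.pow_mul_pow {j : ℕ} {a : R} {x x' : R⟦X⟧}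
    (hx : coeff 0 x = 1) (hx' : coeff 0 x' = 1) (h : HasLead j a (x * x')) (n : ℕ) :
    HasLead j (n • a) (x ^ n * x' ^ n) := by
  induction n with
  | zero => simpa using hasLead_one j
  | succ n ih =>
    rw [pow_succ', pow_succ, succ_nsmul]
    have := ih.conj hx hx' h
    simpa only [mul_assoc] using this

/-- The leading term of the commutator of `x` and `y`, where `x'` and `y'` are approximate
inverses. -/
theorem HasLead.commutator {i j : ℕ} (hj : 0 < j) {V W a b : R} {x x' y y' : R⟦X⟧}
    (hx : HasLead i V x) (hy : HasLead j W y) (hx' : coeff 0 x' = 1) (hy' : coeff 0 y' = 1)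
    (ha : HasLead (i + j) a (x * x')) (hb : HasLead (i + j) b (y * y')) :
    HasLead (i + j) (⁅V, W⁆ + (a + b)) (x * y * x' * y') := by
  -- The commutator of `x - 1` and `y - 1` is that of `x` and `y`; the last two terms collect the
  -- failure of `x'` and `y'` to be inverses.
  have e : x * y * x' * y' - 1 = ((x - 1) * (y - 1) - (y - 1) * (x - 1)) * (x' * y') +
      (y * (x * x' - 1) * y' + (y * y' - 1)) := by noncomm_ring
  have h1 := hx.1.mul hy.1
  have h2 := hy.1.mul hx.1
  have e1 := hx.1.coeff_mul_add hy.1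
  have e2 := hy.1.coeff_mul_add hx.1
  rw [add_comm j i] at h2 e2
  have h3 := h1.sub h2
  have h4 := ha.1.mul_left y
  have h5 : coeff 0 (x' * y') = 1 := by
    simp only [coeff_zero_eq_constantCoeff, map_mul] at *
    rw [hx', hy', one_mul]
  rw [HasLead, e]
  refine ⟨(h3.mul_right _).add ((h4.mul_right _).add hb.1), ?_⟩
  rw [map_add, map_add, h3.coeff_mul_right, h4.coeff_mul_right, ha.1.coeff_mul_left, map_sub, e1, e2,
    hx.2, hy.2, ha.2, hb.2, h5, hy', hy.coeff_zero hj, one_mul, mul_one, mul_one, Ring.lie_def]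

end PowerSeries

/-- A convex cone in a finite-dimensional space is everything if a symmetric spanning set lies in
its closure. -/
theorem eq_univ_of_cone_of_approx {V : Type*} [AddCommGroup V] [Module ℝ V]
    [FiniteDimensional ℝ V] {C G : Set V} (h0 : (0 : V) ∈ C)
    (hadd : ∀ x ∈ C, ∀ y ∈ C, x + y ∈ C) (hsmul : ∀ c : ℝ, 0 < c → ∀ x ∈ C, c • x ∈ C)
    (hG : Submodule.span ℝ G = ⊤) (hneg : ∀ z ∈ G, -z ∈ G)
    (hlim : ∀ z ∈ G, ∃ d : V, ∀ n : ℕ, 0 < n → z + (n : ℝ)⁻¹ • d ∈ C) : C = Set.univ := by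
  -- `V` carries no topology, so closures are taken in coordinates.
  let e := (Module.finBasis ℝ V).equivFun
  set D : Set (Fin (Module.finrank ℝ V) → ℝ) := e.symm ⁻¹' C with hD
  have D0 : (0 : Fin (Module.finrank ℝ V) → ℝ) ∈ D := by simpa [hD] using h0
  have Dadd : ∀ x ∈ D, ∀ y ∈ D, x + y ∈ D := fun x hx y hy => by
    simpa [hD] using hadd _ hx _ hy
  have Dsmul : ∀ c : ℝ, 0 < c → ∀ x ∈ D, c • x ∈ D := fun c hc x hx => by
    simpa [hD] using hsmul c hc _ hx
  have cadd : ∀ x ∈ closure D, ∀ y ∈ closure D, x + y ∈ closure D := fun x hx y hy =>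
    map_mem_closure₂ continuous_add hx hy Dadd
  have csmul : ∀ c : ℝ, 0 < c → ∀ x ∈ closure D, c • x ∈ closure D := fun c hc x hx =>
    map_mem_closure (continuous_const_smul c) hx (Dsmul c hc)
  have cG : ∀ z ∈ G, e z ∈ closure D := fun z hz => by
    obtain ⟨d, hd⟩ := hlim z hz
    have h1 : Filter.Tendsto (fun n : ℕ => e z + (n : ℝ)⁻¹ • e d) Filter.atTop
        (𝓝 (e z + (0 : ℝ) • e d)) :=
      tendsto_const_nhds.add ((tendsto_inv_atTop_nhds_zero_nat (𝕜 := ℝ)).smul_const _)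
    rw [zero_smul, add_zero] at h1
    refine mem_closure_of_tendsto h1 ?_
    filter_upwards [Filter.eventually_gt_atTop 0] with n hn
    simpa [hD] using hd n hn
  have ctop : ∀ z, e z ∈ closure D ∧ -e z ∈ closure D := fun z => by
    have hz : z ∈ Submodule.span ℝ G := hG ▸ Submodule.mem_top
    induction hz using Submodule.span_induction with
    | mem z hz => exact ⟨cG z hz, by simpa using cG _ (hneg z hz)⟩
    | zero => simpa using subset_closure D0
    | add x y _ _ hx hy =>
      rw [map_add, neg_add]
      exact ⟨cadd _ hx.1 _ hy.1, cadd _ hx.2 _ hy.2⟩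
    | smul c x _ hx =>
      rw [map_smul]
      rcases lt_trichotomy c 0 with hc | rfl | hc
      · have h1 := csmul (-c) (by linarith) _ hx.1
        have h2 := csmul (-c) (by linarith) _ hx.2
        simp only [neg_smul, smul_neg, neg_neg] at h1 h2 ⊢
        exact ⟨h2, h1⟩
      · simpa using subset_closure D0
      · refine ⟨csmul c hc _ hx.1, ?_⟩
        rw [← smul_neg]
        exact csmul c hc _ hx.2
  have cuniv : closure D = Set.univ := Set.eq_univ_of_forall fun x => by
    simpa using (ctop (e.symm x)).1
  have hconv : Convex ℝ D := by
    intro x hx y hy a b ha hb _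
    have aux : ∀ c : ℝ, 0 ≤ c → ∀ z ∈ D, c • z ∈ D := fun c hc z hz => by
      rcases hc.eq_or_lt with rfl | hc
      · simpa using D0
      · exact Dsmul c hc z hz
    exact Dadd _ (aux a ha x hx) _ (aux b hb y hy)
  have hspan : affineSpan ℝ D = ⊤ := by
    have h1 : IsClosed (affineSpan ℝ D : Set (Fin (Module.finrank ℝ V) → ℝ)) :=
      AffineSubspace.closed_of_finiteDimensional _
    have h2 := closure_minimal (subset_affineSpan ℝ D) h1
    rw [cuniv, Set.univ_subset_iff] at h2
    exact SetLike.coe_injective (by simpa using h2)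
  -- A convex set with nonempty interior has the same interior as its closure, so a dense one is
  -- everything.
  have hint := hconv.interior_closure_eq_interior_of_nonempty_interior
    (hconv.interior_nonempty_iff_affineSpan_eq_top.2 hspan)
  rw [cuniv, interior_univ] at hint
  refine Set.eq_univ_of_forall fun z => ?_
  have : e z ∈ D := interior_subset (hint ▸ Set.mem_univ _)
  simpa [hD] using this

/-! ### Brackets as leading terms of products of exponentials with positive times. -/

section Words

/-- Iterated application of `⁅y, ·⁆`. -/
def adIter {R : Type*} [Ring R] (y : R) (k : ℕ) (W : R) : R := (fun Z => ⁅y, Z⁆)^[k] W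

theorem adIter_succ {R : Type*} [Ring R] (y : R) (k : ℕ) (W : R) : adIter y (k + 1) W = ⁅y, adIter y k W⁆ :=
  Function.iterate_succ_apply' _ _ _

variable {R : Type*} [Ring R] [Algebra ℝ R] {ι : Type*} (Y : ι → R)

/-- The formal exponential `exp (c s y)`, a power series in `s`. -/
def expSeries (c : ℝ) (y : R) : R⟦X⟧ := .mk fun k => (c ^ k / k !) • y ^ k

/-- The product of the formal exponentials `exp (c s Y_i)` over the letters `(i, c)` of a word. -/
def wordSeries (w : List (ι × ℝ)) : R⟦X⟧ := (w.map fun p => expSeries p.2 (Y p.1)).prod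

/-- The span of the right-nested brackets of length `k` of the elements `Y i`. -/
def bracketSpan : ℕ → Submodule ℝ R
  | 0 => ⊥
  | 1 => Submodule.span ℝ (Set.range Y)
  | k + 2 => Submodule.span ℝ {Z | ∃ i, ∃ W ∈ bracketSpan (k + 1), Z = ⁅Y i, W⁆}

theorem lie_mem_bracketSpan {k : ℕ} (i : ι) {W : R} (hW : W ∈ bracketSpan Y k) :
    ⁅Y i, W⁆ ∈ bracketSpan Y (k + 1) := by
  cases k with
  | zero =>
    rw [bracketSpan, Submodule.mem_bot] at hW
    simp [hW, Ring.lie_def]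
  | succ k => exact Submodule.subset_span ⟨i, W, hW, rfl⟩

theorem adIter_mem_bracketSpan {k : ℕ} (i : ι) {W : R} (hW : W ∈ bracketSpan Y k) (a : ℕ) :
    adIter (Y i) a W ∈ bracketSpan Y (a + k) := by
  induction a with
  | zero => simpa [adIter] using hW
  | succ a ih =>
    rw [adIter_succ, show a + 1 + k = a + k + 1 by omega]
    exact lie_mem_bracketSpan Y i ih

/-- Left multiplication by `y` is `ad y` plus right multiplication by `y`. These commute, so the
binomial theorem applies. -/
theorem pow_mul_eq_sum_adIter (y W : R) (n : ℕ) :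
    ((n ! : ℝ)⁻¹ • y ^ n) * W = ∑ x ∈ antidiagonal n,
      ((x.1 ! : ℝ)⁻¹ • adIter y x.1 W) * ((x.2 ! : ℝ)⁻¹ • y ^ x.2) := by
  let ad : Module.End ℝ R := LinearMap.mulLeft ℝ y - LinearMap.mulRight ℝ y
  have had : ∀ k, (ad ^ k) W = adIter y k W := fun k => by
    induction k with
    | zero => simp [adIter]
    | succ k ih => rw [pow_succ', Module.End.mul_apply, ih, adIter_succ]; simp [ad, Ring.lie_def]
  have hc : Commute ad (LinearMap.mulRight ℝ y) := by
    refine Commute.sub_left ?_ (Commute.refl _)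
    exact LinearMap.commute_mulLeft_right y y
  have h := congrArg (fun f : Module.End ℝ R => f W) (hc.add_pow' n)
  simp only [ad, sub_add_cancel, LinearMap.pow_mulLeft, LinearMap.mulLeft_apply,
    LinearMap.sum_apply] at h
  rw [smul_mul_assoc, h, Finset.smul_sum]
  refine Finset.sum_congr rfl fun x hx => ?_
  rw [mem_antidiagonal] at hx
  have e : ((n.choose x.1 : ℕ) : ℝ) = n ! / (x.1 ! * x.2 !) := by
    rw [← hx, Nat.cast_add_choose]
  have e2 : ((ad ^ x.1) * (LinearMap.mulRight ℝ y) ^ x.2) W = adIter y x.1 W * y ^ x.2 := by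
    have : Commute (ad ^ x.1) ((LinearMap.mulRight ℝ y) ^ x.2) := (hc.pow_left _).pow_right _
    rw [this.eq, Module.End.mul_apply, had, LinearMap.pow_mulRight, LinearMap.mulRight_apply]
  change (n ! : ℝ)⁻¹ • ((n.choose x.1) • ((ad ^ x.1) * (LinearMap.mulRight ℝ y) ^ x.2)) W = _
  rw [LinearMap.smul_apply, e2, ← Nat.cast_smul_eq_nsmul ℝ, e, smul_smul, smul_mul_smul_comm]
  congr 1
  have : (n ! : ℝ) ≠ 0 := by positivity
  field_simp

theorem coeff_zero_expSeries (c : ℝ) (y : R) : coeff 0 (expSeries c y) = 1 := by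
  simp [expSeries, -coeff_zero_eq_constantCoeff]

theorem hasLead_expSeries (c : ℝ) (y : R) : HasLead 1 (c • y) (expSeries c y) := by
  refine ⟨fun k hk => ?_, ?_⟩
  · obtain rfl : k = 0 := by omega
    rw [map_sub, coeff_zero_expSeries, coeff_zero_one, sub_self]
  · simp [expSeries, coeff_one]

theorem wordSeries_append (w w' : List (ι × ℝ)) :
    wordSeries Y (w ++ w') = wordSeries Y w * wordSeries Y w' := by
  simp [wordSeries]

theorem wordSeries_cons (p : ι × ℝ) (w : List (ι × ℝ)) :
    wordSeries Y (p :: w) = expSeries p.2 (Y p.1) * wordSeries Y w := by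
  simp [wordSeries]

theorem hasLead_wordSeries (w : List (ι × ℝ)) :
    HasLead 1 (w.map fun p => p.2 • Y p.1).sum (wordSeries Y w) := by
  induction w with
  | nil => simpa [wordSeries] using hasLead_one 1
  | cons p w ih =>
    rw [wordSeries_cons, List.map_cons, List.sum_cons]
    exact (hasLead_expSeries _ _).mul one_pos ih

theorem coeff_zero_wordSeries (w : List (ι × ℝ)) : coeff 0 (wordSeries Y w) = 1 :=
  (hasLead_wordSeries Y w).coeff_zero one_pos

/-- The Euler operator `s d/ds` on power series. -/
def eulerOp (p : R⟦X⟧) : R⟦X⟧ := .mk fun k => (k : ℝ) • coeff k p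

theorem eulerOp_mul (p q : R⟦X⟧) : eulerOp (p * q) = eulerOp p * q + p * eulerOp q := by
  ext n
  rw [map_add, coeff_mul, coeff_mul, eulerOp, coeff_mk, coeff_mul, Finset.smul_sum,
    ← Finset.sum_add_distrib]
  refine Finset.sum_congr rfl fun x hx => ?_
  rw [mem_antidiagonal] at hx
  simp only [eulerOp, coeff_mk, smul_mul_assoc, mul_smul_comm]
  rw [← add_smul, ← hx, Nat.cast_add]

theorem eulerOp_expSeries (c : ℝ) (y : R) :
    eulerOp (expSeries c y) = X * C (c • y) * expSeries c y := by
  ext n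
  rw [mul_assoc]
  cases n with
  | zero => simp [eulerOp, -coeff_zero_eq_constantCoeff, coeff_zero_X_mul]
  | succ n =>
    rw [coeff_succ_X_mul, coeff_C_mul, eulerOp, coeff_mk, expSeries, coeff_mk, coeff_mk,
      smul_mul_smul_comm, smul_smul, ← pow_succ' y]
    congr 1
    rw [Nat.factorial_succ]
    have : (n ! : ℝ) ≠ 0 := by positivity
    push_cast
    field_simp
    ring

/-- Conjugation of the power series `q` by `exp (c s y)`. -/
def adSeries (c : ℝ) (y : R) (q : R⟦X⟧) : R⟦X⟧ :=
  .mk fun n => ∑ x ∈ antidiagonal n, (c ^ x.1 / x.1 !) • adIter y x.1 (coeff x.2 q)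

/-- This is `exp(y) q exp(-y) = exp(ad y) q`, written without the inverse; each coefficient is an
instance of `pow_mul_eq_sum_adIter`. -/
theorem expSeries_mul_eq_adSeries_mul (c : ℝ) (y : R) (q : R⟦X⟧) :
    expSeries c y * q = adSeries c y q * expSeries c y := by
  ext n
  have key : ∀ (m : ℕ) (W : R), coeff m (expSeries c y) * W = ∑ x ∈ antidiagonal m,
      ((c ^ x.1 / x.1 !) • adIter y x.1 W) * ((c ^ x.2 / x.2 !) • y ^ x.2) := fun m W => by
    have := congrArg (fun z => c ^ m • z) (pow_mul_eq_sum_adIter y W m)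
    simp only [Finset.smul_sum] at this
    rw [expSeries, coeff_mk, div_eq_mul_inv, ← smul_smul, smul_mul_assoc, this]
    refine Finset.sum_congr rfl fun x hx => ?_
    rw [mem_antidiagonal] at hx
    rw [← hx, smul_mul_smul_comm, smul_mul_smul_comm, smul_smul]
    congr 1
    rw [pow_add]
    field_simp
  rw [coeff_mul, coeff_mul]
  simp only [key, adSeries, coeff_mk, Finset.sum_mul]
  simp only [expSeries, coeff_mk]
  rw [Finset.sum_sigma', Finset.sum_sigma']
  -- The triples (power of `ad`, degree in `q`, power of `y`) are grouped in two ways; the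
  -- regrouping is given by the same formula in both directions.
  refine Finset.sum_nbij' (fun x => ⟨(x.2.1 + x.1.2, x.2.2), (x.2.1, x.1.2)⟩)
    (fun x => ⟨(x.2.1 + x.1.2, x.2.2), (x.2.1, x.1.2)⟩) ?_ ?_ ?_ ?_ ?_
  · rintro ⟨⟨a, b⟩, c, d⟩ h
    simp only [Finset.mem_sigma, mem_antidiagonal, and_true] at h ⊢
    omega
  · rintro ⟨⟨a, b⟩, c, d⟩ h
    simp only [Finset.mem_sigma, mem_antidiagonal, and_true] at h ⊢
    omega
  · rintro ⟨⟨a, b⟩, c, d⟩ h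
    simp only [Finset.mem_sigma, mem_antidiagonal] at h
    obtain ⟨h1, rfl⟩ := h
    rfl
  · rintro ⟨⟨a, b⟩, c, d⟩ h
    simp only [Finset.mem_sigma, mem_antidiagonal] at h
    obtain ⟨h1, rfl⟩ := h
    rfl
  · rintro ⟨⟨a, b⟩, c, d⟩ h
    rfl

/-- Products of exponentials have a logarithmic derivative with coefficients in the graded pieces
`bracketSpan Y k`. -/
theorem exists_eulerOp_wordSeries (w : List (ι × ℝ)) :
    ∃ q : R⟦X⟧, (∀ k, coeff k q ∈ bracketSpan Y k) ∧
      eulerOp (wordSeries Y w) = q * wordSeries Y w := by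
  induction w with
  | nil =>
    refine ⟨0, fun k => by simp, ?_⟩
    ext n
    simp only [wordSeries, List.map_nil, List.prod_nil, eulerOp, coeff_mk, coeff_one, zero_mul,
      map_zero]
    split_ifs with h <;> simp [h]
  | cons p w ih =>
    obtain ⟨q, h1, h2⟩ := ih
    -- By the Leibniz rule the logarithmic derivative of `exp(c s y) w` is `c s y` plus the
    -- conjugate of that of `w`. Conjugation respects the grading because each `ad` raises both the
    -- degree and the bracket length by one.
    refine ⟨X * C (p.2 • Y p.1) + adSeries p.2 (Y p.1) q, fun k => ?_, ?_⟩
    · rw [map_add]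
      refine Submodule.add_mem _ ?_ ?_
      · match k with
        | 0 => simp [bracketSpan]
        | 1 =>
          rw [show (1 : ℕ) = 0 + 1 from rfl, coeff_succ_X_mul, coeff_C, if_pos rfl]
          exact Submodule.smul_mem _ _ (Submodule.subset_span ⟨_, rfl⟩)
        | k + 2 =>
          rw [coeff_succ_X_mul, coeff_C, if_neg (by omega)]
          exact Submodule.zero_mem _
      · rw [adSeries, coeff_mk]
        refine Submodule.sum_mem _ fun x hx => Submodule.smul_mem _ _ ?_
        rw [mem_antidiagonal] at hx
        exact hx ▸ adIter_mem_bracketSpan Y p.1 (h1 x.2) x.1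
    · rw [wordSeries_cons, eulerOp_mul, h2, eulerOp_expSeries, ← mul_assoc,
        expSeries_mul_eq_adSeries_mul, add_mul, mul_assoc, mul_assoc, mul_assoc]

/-- The leading term of a product of exponentials is a combination of brackets. -/
theorem mem_bracketSpan_of_hasLead {j : ℕ} (hj : 0 < j) {Z : R} {w : List (ι × ℝ)}
    (h : HasLead j Z (wordSeries Y w)) : Z ∈ bracketSpan Y j := by
  obtain ⟨q, h1, h2⟩ := exists_eulerOp_wordSeries Y w
  -- If the coefficients strictly between `0` and `k` vanish, comparing degree `k` in the
  -- logarithmic derivative leaves only `q_k` times the constant term `1`.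
  have hk : ∀ k, (∀ i, 0 < i → i < k → coeff i (wordSeries Y w) = 0) → coeff 0 q = 0 →
      (k : ℝ) • coeff k (wordSeries Y w) = coeff k q := fun k hi h0 => by
    have := congrArg (coeff k) h2
    rw [eulerOp, coeff_mk, coeff_mul, Finset.sum_eq_single (k, 0)] at this
    · rw [this, coeff_zero_wordSeries, mul_one]
    · rintro ⟨a, b⟩ hx hne
      rw [mem_antidiagonal] at hx
      rcases Nat.eq_zero_or_pos b with rfl | hb
      · exact absurd (by simpa using hx) hne
      · rcases Nat.eq_zero_or_pos a with rfl | ha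
        · simp only [h0, zero_mul]
        · simp only [hi b hb (by simp at hx; omega), mul_zero]
    · simp
  have h0 : coeff 0 q = 0 := by simpa [bracketSpan] using h1 0
  have e := hk j (fun i hi hij => h.coeff_of_lt hi hij) h0
  rw [h.coeff_self hj] at e
  have hj' : (j : ℝ) ≠ 0 := by positivity
  rw [show Z = (j : ℝ)⁻¹ • ((j : ℝ) • Z) by rw [smul_smul, inv_mul_cancel₀ hj', one_smul], e]
  exact Submodule.smul_mem _ _ (h1 j)

/-- Each piece is a finite supremum of images of the preceding one under the maps `ad (Y i)`. Finite
dimension is what lets the cone argument be run inside a single graded piece. -/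
instance finiteDimensional_bracketSpan [Finite ι] (k : ℕ) :
    FiniteDimensional ℝ (bracketSpan Y k) := by
  induction k with
  | zero => rw [bracketSpan]; infer_instance
  | succ k ih =>
    cases k with
    | zero => rw [bracketSpan]; exact FiniteDimensional.span_of_finite ℝ (Set.finite_range Y)
    | succ k =>
      have : bracketSpan Y (k + 2) = ⨆ i, (bracketSpan Y (k + 1)).map
          (LinearMap.mulLeft ℝ (Y i) - LinearMap.mulRight ℝ (Y i)) := by
        rw [bracketSpan]
        apply le_antisymm
        · rw [Submodule.span_le]
          rintro _ ⟨i, W, hW, rfl⟩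
          exact Submodule.mem_iSup_of_mem i ⟨W, hW, by simp [Ring.lie_def]⟩
        · refine iSup_le fun i => ?_
          rintro _ ⟨W, hW, rfl⟩
          exact Submodule.subset_span ⟨i, W, hW, by simp [Ring.lie_def]⟩
      rw [this]
      infer_instance

theorem coeff_wordSeries_scale (μ : ℝ) (w : List (ι × ℝ)) (k : ℕ) :
    coeff k (wordSeries Y (w.map fun p => (p.1, μ * p.2))) = μ ^ k • coeff k (wordSeries Y w) := by
  induction w generalizing k with
  | nil =>
    simp only [wordSeries, List.map_nil, List.prod_nil, coeff_one]
    split_ifs with h <;> simp [h]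
  | cons p w ih =>
    rw [List.map_cons, wordSeries_cons, wordSeries_cons, coeff_mul, coeff_mul, Finset.smul_sum]
    refine Finset.sum_congr rfl fun x hx => ?_
    rw [mem_antidiagonal] at hx
    rw [ih, expSeries, expSeries, coeff_mk, coeff_mk, ← hx, smul_mul_smul_comm, smul_mul_assoc,
      smul_smul]
    congr 1
    ring

theorem wordSeries_replicate (w : List (ι × ℝ)) (n : ℕ) :
    wordSeries Y (List.replicate n w).flatten = wordSeries Y w ^ n := by
  induction n with
  | zero => simp [wordSeries]
  | succ n ih => rw [List.replicate_succ, List.flatten_cons, wordSeries_append, ih, pow_succ']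

/-- The coefficients `Z` of `s ^ j` in the products `1 + s ^ j Z + O(s ^ (j + 1))` of exponentials
with positive times. -/
def posLeads (j : ℕ) : Set R :=
  {Z | ∃ w : List (ι × ℝ), (∀ p ∈ w, 0 < p.2) ∧ HasLead j Z (wordSeries Y w)}

theorem zero_mem_posLeads (j : ℕ) : (0 : R) ∈ posLeads Y j :=
  ⟨[], by simp, by simpa [wordSeries] using hasLead_one j⟩

theorem add_mem_posLeads {j : ℕ} (hj : 0 < j) {Z W : R} (hZ : Z ∈ posLeads Y j)
    (hW : W ∈ posLeads Y j) : Z + W ∈ posLeads Y j := by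
  obtain ⟨w, hw, h⟩ := hZ
  obtain ⟨w', hw', h'⟩ := hW
  refine ⟨w ++ w', fun p hp => ?_, ?_⟩
  · rcases List.mem_append.1 hp with hp | hp
    exacts [hw p hp, hw' p hp]
  · rw [wordSeries_append]
    exact h.mul hj h'

theorem smul_mem_posLeads {j : ℕ} (hj : 0 < j) {c : ℝ} (hc : 0 < c) {Z : R}
    (hZ : Z ∈ posLeads Y j) : c • Z ∈ posLeads Y j := by
  obtain ⟨w, hw, h⟩ := hZ
  -- Multiplying all times by `μ` multiplies the coefficient of `s ^ j` by `μ ^ j`, and keeps the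
  -- vanishing ones zero.
  set μ : ℝ := c ^ ((j : ℝ)⁻¹) with hμ
  have hμ0 : 0 < μ := Real.rpow_pos_of_pos hc _
  have hμj : μ ^ j = c := Real.rpow_inv_natCast_pow hc.le hj.ne'
  refine ⟨w.map fun p => (p.1, μ * p.2), fun p hp => ?_, fun k hk => ?_, ?_⟩
  · obtain ⟨p', hp', rfl⟩ := List.mem_map.1 hp
    exact mul_pos hμ0 (hw p' hp')
  · rw [map_sub, coeff_wordSeries_scale]
    rcases Nat.eq_zero_or_pos k with rfl | hk0
    · rw [coeff_zero_wordSeries, coeff_zero_one, pow_zero, one_smul, sub_self]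
    · rw [h.coeff_of_lt hk0 hk, coeff_one, if_neg hk0.ne', smul_zero, sub_zero]
  · rw [map_sub, coeff_wordSeries_scale, h.coeff_self hj, hμj, coeff_one, if_neg hj.ne', sub_zero]

/-- If the generators sum to zero, then every bracket is the leading term of a product of
exponentials with positive times. -/
theorem bracketSpan_subset_posLeads [Fintype ι] (hY : ∑ i, Y i = 0) (j : ℕ) (hj : 0 < j) :
    (bracketSpan Y j : Set R) ⊆ posLeads Y j := by
  induction j using Nat.strong_induction_on with
  | _ j IH =>
  match j, hj with
  | 1, _ =>
    intro Z hZ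
    obtain ⟨c, rfl⟩ := (Submodule.mem_span_range_iff_exists_fun ℝ).1 hZ
    -- As the `Y i` sum to zero, adding the constant `M` to all coefficients does not change the
    -- combination; `M` is large enough to make them positive.
    let M : ℝ := 1 + ∑ i, |c i|
    refine ⟨Finset.univ.toList.map fun i => (i, c i + M), fun p hp => ?_, ?_⟩
    · obtain ⟨i, -, rfl⟩ := List.mem_map.1 hp
      have h1 : |c i| ≤ ∑ i, |c i| :=
        Finset.single_le_sum (f := fun i => |c i|) (fun _ _ => abs_nonneg _) (Finset.mem_univ i)
      have h2 := neg_abs_le (c i)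
      simp only [M]
      linarith
    · have h := hasLead_wordSeries Y (Finset.univ.toList.map fun i => (i, c i + M))
      have e : ((Finset.univ.toList.map fun i => (i, c i + M)).map fun p => p.2 • Y p.1).sum =
          ∑ i, c i • Y i := by
        rw [List.map_map]
        change (List.map (fun i => (c i + M) • Y i) _).sum = _
        rw [Finset.sum_map_toList]
        simp only [add_smul, Finset.sum_add_distrib]
        rw [← Finset.smul_sum, hY, smul_zero, add_zero]
      rwa [e] at h
  | j + 2, _ =>
    -- An inverse up to order `j + 2` with positive times. The error is removed one degree at a
    -- time: it is a combination of brackets of length at most `j + 1`, and its negative is realized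
    -- by the induction hypothesis.
    have inv : ∀ w : List (ι × ℝ), (∀ p ∈ w, 0 < p.2) → ∃ (w' : List (ι × ℝ)) (a : R),
        (∀ p ∈ w', 0 < p.2) ∧ HasLead (j + 2) a (wordSeries Y w * wordSeries Y w') := by
      intro w hw
      suffices ∀ i, i < j + 2 → ∃ (w' : List (ι × ℝ)) (a : R),
          (∀ p ∈ w', 0 < p.2) ∧ HasLead (i + 1) a (wordSeries Y w * wordSeries Y w') from
        this (j + 1) (by omega)
      intro i hi
      induction i with
      | zero =>
        refine ⟨[], (w.map fun p => p.2 • Y p.1).sum, by simp, ?_⟩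
        rw [← wordSeries_append, List.append_nil]
        exact hasLead_wordSeries Y _
      | succ i ih =>
        obtain ⟨w', a, hw', h⟩ := ih (by omega)
        have ha : -a ∈ bracketSpan Y (i + 1) := by
          rw [← wordSeries_append] at h
          exact Submodule.neg_mem _ (mem_bracketSpan_of_hasLead Y (by omega) h)
        obtain ⟨w'', hw'', h''⟩ := IH (i + 1) (by omega) (by omega) ha
        have h3 := h.mul (by omega) h''
        rw [add_neg_cancel, mul_assoc, ← wordSeries_append] at h3
        refine ⟨w' ++ w'', _, fun p hp => ?_, h3.succ⟩
        rcases List.mem_append.1 hp with hp | hp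
        exacts [hw' p hp, hw'' p hp]
    -- The commutator of `n`-th powers has leading term `n ^ 2 ⁅Y i, W⁆ + n (a + b)`, where `a` and
    -- `b` come from the approximate inverses. Rescaling by `n ^ (-2)` leaves an error `(a + b) /
    -- n`, so the bracket is a limit of elements of the cone.
    have key : ∀ (i : ι), ∀ W ∈ bracketSpan Y (j + 1), ∃ d ∈ bracketSpan Y (j + 2),
        ∀ n : ℕ, 0 < n → ⁅Y i, W⁆ + (n : ℝ)⁻¹ • d ∈ posLeads Y (j + 2) := by
      intro i W hW
      obtain ⟨y, hy, hyl⟩ := IH (j + 1) (by omega) (by omega) hW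
      have hxl : HasLead 1 (Y i) (wordSeries Y [(i, 1)]) := by
        simpa using hasLead_wordSeries Y [(i, 1)]
      obtain ⟨x', a, hx', ha⟩ := inv [(i, 1)] (by simp)
      obtain ⟨y', b, hy', hb⟩ := inv y hy
      have had : a ∈ bracketSpan Y (j + 2) := by
        rw [← wordSeries_append] at ha
        exact mem_bracketSpan_of_hasLead Y (by omega) ha
      have hbd : b ∈ bracketSpan Y (j + 2) := by
        rw [← wordSeries_append] at hb
        exact mem_bracketSpan_of_hasLead Y (by omega) hb
      refine ⟨a + b, Submodule.add_mem _ had hbd, fun n hn => ?_⟩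
      have h0 := coeff_zero_wordSeries Y
      have ha' := ha.pow_mul_pow (h0 _) (h0 _) n
      have hb' := hb.pow_mul_pow (h0 _) (h0 _) n
      simp only [← wordSeries_replicate] at ha' hb'
      have hxn := hxl.pow one_pos n
      have hyn := hyl.pow (by omega) n
      simp only [← wordSeries_replicate] at hxn hyn
      rw [show j + 2 = 1 + (j + 1) by omega] at ha' hb'
      have hc := HasLead.commutator (by omega) hxn hyn (h0 _) (h0 _) ha' hb'
      simp only [← wordSeries_append] at hc
      rw [show 1 + (j + 1) = j + 2 by omega] at hc
      have hn' : (n : ℝ) ≠ 0 := by positivity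
      have e : ⁅Y i, W⁆ + (n : ℝ)⁻¹ • (a + b) =
          ((n : ℝ)⁻¹ ^ 2) • (⁅n • Y i, n • W⁆ + (n • a + n • b)) := by
        simp only [← Nat.cast_smul_eq_nsmul ℝ, Ring.lie_def, smul_mul_smul_comm, ← smul_sub,
          ← smul_add]
        rw [smul_add ((n : ℝ)⁻¹ ^ 2), smul_smul, smul_smul,
          show (n : ℝ)⁻¹ ^ 2 * (n * n) = 1 by field_simp, one_smul,
          show (n : ℝ)⁻¹ ^ 2 * n = (n : ℝ)⁻¹ by field_simp]
      rw [e]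
      refine smul_mem_posLeads Y (by omega) (by positivity) ⟨_, fun p hp => ?_, hc⟩
      have rep : ∀ v : List (ι × ℝ), (∀ p ∈ v, 0 < p.2) →
          p ∈ (List.replicate n v).flatten → 0 < p.2 := fun v hv hp => by
        rw [List.mem_flatten] at hp
        obtain ⟨l, hl, hp⟩ := hp
        exact hv p (List.eq_of_mem_replicate hl ▸ hp)
      simp only [List.mem_append] at hp
      rcases hp with ((hp | hp) | hp) | hp
      exacts [rep _ (by simp) hp, rep _ hy hp, rep _ hx' hp, rep _ hy' hp]
    -- The attainable leading terms form a convex cone whose closure contains the generating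
    -- brackets. These are symmetric, as the sign can be moved into `W`, so the cone is the whole
    -- piece.
    let C : Set (bracketSpan Y (j + 2)) := {Z | (Z : R) ∈ posLeads Y (j + 2)}
    let G : Set (bracketSpan Y (j + 2)) :=
      {Z | ∃ i, ∃ W ∈ bracketSpan Y (j + 1), (Z : R) = ⁅Y i, W⁆}
    have hC : C = Set.univ := by
      refine eq_univ_of_cone_of_approx (G := G) (zero_mem_posLeads Y _)
        (fun x hx y hy => add_mem_posLeads Y (by omega) hx hy)
        (fun c hc x hx => smul_mem_posLeads Y (by omega) hc hx) ?_ ?_ ?_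
      · have : G = ((↑) : bracketSpan Y (j + 2) → R) ⁻¹'
            {Z | ∃ i, ∃ W ∈ bracketSpan Y (j + 1), Z = ⁅Y i, W⁆} := rfl
        rw [this]
        exact Submodule.span_span_coe_preimage
      · rintro z ⟨i, W, hW, h⟩
        refine ⟨i, -W, Submodule.neg_mem _ hW, ?_⟩
        rw [Submodule.coe_neg, h, Ring.lie_def, Ring.lie_def]
        noncomm_ring
      · rintro z ⟨i, W, hW, h⟩
        obtain ⟨d, hd, hd'⟩ := key i W hW
        refine ⟨⟨d, hd⟩, fun n hn => ?_⟩
        change ((z + (n : ℝ)⁻¹ • (⟨d, hd⟩ : bracketSpan Y (j + 2)) : bracketSpan Y (j + 2)) : R) ∈ posLeads Y (j + 2)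
        rw [Submodule.coe_add, h, Submodule.coe_smul]
        exact hd' n hn
    intro Z hZ
    have : (⟨Z, hZ⟩ : bracketSpan Y (j + 2)) ∈ C := hC ▸ Set.mem_univ _
    exact this

end Words

end

noncomputable section

/-! ### Smoothness of superposition operators on spaces of continuous maps. -/

section Nemytskii

variable {K : Type} [TopologicalSpace K] [CompactSpace K]
  {F G : Type} [NormedAddCommGroup F] [NormedSpace ℝ F] [NormedAddCommGroup G] [NormedSpace ℝ G]

/-- The superposition operator `u ↦ f ∘ u` on continuous maps. -/
def superposition (K : Type) [TopologicalSpace K] (f : C(F, G)) (u : C(K, F)) : C(K, G) := f.comp u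

/-- Pointwise application of a continuous family of operators to a continuous map. -/
def pointwiseApply (K F G : Type) [TopologicalSpace K] [CompactSpace K]
    [NormedAddCommGroup F] [NormedSpace ℝ F] [NormedAddCommGroup G] [NormedSpace ℝ G] :
    C(K, F →L[ℝ] G) →L[ℝ] C(K, F) →L[ℝ] C(K, G) :=
  LinearMap.mkContinuous₂
    (LinearMap.mk₂ ℝ (fun (A : C(K, F →L[ℝ] G)) (h : C(K, F)) => (⟨fun k => A k (h k), by fun_prop⟩ : C(K, G)))
      (fun A B h => by ext; simp) (fun c A h => by ext; simp)
      (fun A h h' => by ext; simp) (fun c A h => by ext; simp)) 1 fun A h => by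
    rw [one_mul]
    refine (ContinuousMap.norm_le _ (by positivity)).2 fun k => ?_
    exact (A k).le_of_opNorm_le_of_le (A.norm_coe_le_norm k) (h.norm_coe_le_norm k)

/-- The mean value inequality on the segment from `u k` to `u k + h k` gives an estimate uniform in
`k`, since `u ↦ f' ∘ u` is continuous for the sup norm. -/
theorem hasFDerivAt_superposition {f : C(F, G)} (hf : Differentiable ℝ f) {f' : C(F, F →L[ℝ] G)}
    (hf' : ∀ x, f' x = fderiv ℝ f x) (u : C(K, F)) :
    HasFDerivAt (superposition K f) (pointwiseApply K F G (superposition K f' u)) u := by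
  rw [hasFDerivAt_iff_isLittleO_nhds_zero, Asymptotics.isLittleO_iff]
  intro ε hε
  have hc : ContinuousAt (superposition K f') u := (ContinuousMap.continuous_postcomp f').continuousAt
  obtain ⟨δ, hδ, H⟩ := Metric.continuousAt_iff.1 hc ε hε
  filter_upwards [Metric.ball_mem_nhds (0 : C(K, F)) hδ] with h hh
  rw [mem_ball_zero_iff] at hh
  refine (ContinuousMap.norm_le _ (by positivity)).2 fun k => ?_
  have key : ‖f (u k + h k) - f (u k) - f' (u k) (u k + h k - u k)‖ ≤ ε * ‖u k + h k - u k‖ := by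
    refine Convex.norm_image_sub_le_of_norm_fderiv_le' (s := segment ℝ (u k) (u k + h k))
      (fun x _ => hf x) ?_ (convex_segment _ _) (left_mem_segment ℝ _ _) (right_mem_segment ℝ _ _)
    intro x hx
    rw [segment_eq_image'] at hx
    obtain ⟨θ, hθ, rfl⟩ := hx
    have h1 : dist (u + θ • h) u < δ := by
      rw [dist_eq_norm, add_sub_cancel_left, norm_smul, Real.norm_of_nonneg hθ.1]
      exact (mul_le_of_le_one_left (norm_nonneg _) hθ.2).trans_lt hh
    have h2 := H h1
    rw [dist_eq_norm] at h2
    have h3 := (ContinuousMap.norm_coe_le_norm _ k).trans h2.le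
    simpa [superposition, hf'] using h3
  refine le_trans (le_of_eq ?_) (key.trans ?_)
  · rw [add_sub_cancel_left]; rfl
  · rw [add_sub_cancel_left]
    exact mul_le_mul_of_nonneg_left (h.norm_coe_le_norm k) hε.le

/-- The derivative is again a superposition operator, that of `fderiv ℝ f`, followed by a bounded
linear map. The induction therefore has to range over all target spaces. -/
theorem contDiff_superposition {n : ℕ} {f : C(F, G)} (hf : ContDiff ℝ n f) :
    ContDiff ℝ n (superposition K f) := by
  induction n generalizing G with
  | zero =>
    exact contDiff_zero.2 (ContinuousMap.continuous_postcomp f)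
  | succ n ih =>
    have hd : Differentiable ℝ f := hf.differentiable (by simp)
    have hf1 : ContDiff ℝ n (fderiv ℝ f) := hf.fderiv_right (by norm_cast)
    let f' : C(F, F →L[ℝ] G) := ⟨fderiv ℝ f, hf1.continuous⟩
    have := contDiff_succ_iff_hasFDerivAt (𝕜 := ℝ) (f := superposition K f) (n := n)
    push_cast
    refine this.2 ⟨fun u => pointwiseApply K F G (superposition K f' u), ?_, fun u =>
      hasFDerivAt_superposition hd (fun _ => rfl) u⟩
    exact (pointwiseApply K F G).contDiff.comp (ih (f := f') hf1)

end Nemytskii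

/-! ### Smooth dependence of local flows on time and initial point. -/

section Flow

open Set

variable {F : Type} [NormedAddCommGroup F] [NormedSpace ℝ F]

/-- The primitive vanishing at `0` of a continuous map on `[0, 1]`, as a bounded operator. -/
def primitiveOp (F : Type) [NormedAddCommGroup F] [NormedSpace ℝ F] :
    C(Icc (0 : ℝ) 1, F) →L[ℝ] C(Icc (0 : ℝ) 1, F) :=
  LinearMap.mkContinuous
    { toFun := fun u => ⟨fun τ => ∫ r in (0 : ℝ)..τ, u (projIcc 0 1 zero_le_one r), by
        have : Continuous fun r : ℝ => u (projIcc 0 1 zero_le_one r) :=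
          u.continuous.comp continuous_projIcc
        exact (intervalIntegral.continuous_primitive
          (fun a b => this.intervalIntegrable a b) 0).comp continuous_subtype_val⟩
      map_add' := fun u v => by
        ext τ
        have : ∀ w : C(Icc (0 : ℝ) 1, F), Continuous fun r : ℝ => w (projIcc 0 1 zero_le_one r) :=
          fun w => w.continuous.comp continuous_projIcc
        exact intervalIntegral.integral_add ((this u).intervalIntegrable _ _)
          ((this v).intervalIntegrable _ _)
      map_smul' := fun c u => by
        ext τ
        exact intervalIntegral.integral_smul _ _ } 1 fun u => by
    rw [one_mul]
    refine (ContinuousMap.norm_le _ (by positivity)).2 fun τ => ?_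
    have := intervalIntegral.norm_integral_le_of_norm_le_const (a := 0) (b := (τ : ℝ)) (C := ‖u‖)
      (f := fun r => u (projIcc 0 1 zero_le_one r)) (fun r _ => u.norm_coe_le_norm _)
    refine this.trans (mul_le_of_le_one_right (norm_nonneg _) ?_)
    rw [sub_zero, abs_of_nonneg τ.2.1]
    exact τ.2.2

/-- The constant curves, as a bounded operator. -/
def constOp (F : Type) [NormedAddCommGroup F] [NormedSpace ℝ F] :
    F →L[ℝ] C(Icc (0 : ℝ) 1, F) :=
  LinearMap.mkContinuous
    { toFun := fun x => ContinuousMap.const _ x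
      map_add' := fun x y => rfl
      map_smul' := fun c x => rfl } 1 fun x => by
    rw [one_mul]
    exact (ContinuousMap.norm_le _ (by positivity)).2 fun τ => le_rfl

/-- The defect of the curve `w` as a solution of the rescaled equation `w' = s f(w)`, `w(0) = x`. -/
def odeDefect (f : C(F, F)) (z : (ℝ × F) × C(Icc (0 : ℝ) 1, F)) : C(Icc (0 : ℝ) 1, F) :=
  z.2 - constOp F z.1.2 - z.1.1 • primitiveOp F (superposition _ f z.2)

theorem odeDefect_apply (f : C(F, F)) (z : (ℝ × F) × C(Icc (0 : ℝ) 1, F)) (τ : Icc (0 : ℝ) 1) :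
    odeDefect f z τ =
      z.2 τ - (z.1.2 + z.1.1 • ∫ r in (0 : ℝ)..τ, f (z.2 (projIcc 0 1 zero_le_one r))) := by
  rw [odeDefect, sub_sub]; rfl

theorem contDiff_superposition_infty {f : C(F, F)} (hf : ContDiff ℝ ∞ f) :
    ContDiff ℝ ∞ (superposition (Icc (0 : ℝ) 1) f) :=
  contDiff_infty.2 fun n => contDiff_superposition (hf.of_le (by exact_mod_cast le_top))

theorem contDiff_odeDefect {f : C(F, F)} (hf : ContDiff ℝ ∞ f) : ContDiff ℝ ∞ (odeDefect f) := by
  have h := contDiff_superposition_infty hf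
  unfold odeDefect
  fun_prop

/-- At time scale `s = 0` the integral term drops out of the derivative in `w`, so this partial
derivative is the identity. This is the hypothesis of the implicit function theorem. -/
theorem exists_hasFDerivAt_odeDefect {f : C(F, F)} (hf : ContDiff ℝ ∞ f) (x₀ : F) :
    ∃ l : ℝ × F →L[ℝ] C(Icc (0 : ℝ) 1, F),
      HasFDerivAt (odeDefect f) (ContinuousLinearMap.snd ℝ (ℝ × F) C(Icc (0 : ℝ) 1, F) +
        l.comp (ContinuousLinearMap.fst ℝ (ℝ × F) C(Icc (0 : ℝ) 1, F))) ((0, x₀), constOp F x₀) := by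
  have h : Differentiable ℝ (superposition (Icc (0 : ℝ) 1) f) :=
    (contDiff_superposition_infty hf).differentiable (by simp)
  set z₀ : (ℝ × F) × C(Icc (0 : ℝ) 1, F) := ((0, x₀), constOp F x₀)
  let v := primitiveOp F (superposition _ f z₀.2)
  have h1 : HasFDerivAt (fun z : (ℝ × F) × C(Icc (0 : ℝ) 1, F) =>
      primitiveOp F (superposition _ f z.2)) _ z₀ :=
    (primitiveOp F).hasFDerivAt.comp z₀ ((h _).hasFDerivAt.comp z₀ hasFDerivAt_snd)
  let pr := ContinuousLinearMap.fst ℝ (ℝ × F) C(Icc (0 : ℝ) 1, F)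
  have h2 : HasFDerivAt (fun z : (ℝ × F) × C(Icc (0 : ℝ) 1, F) => z.1.1) _ z₀ :=
    ((ContinuousLinearMap.fst ℝ ℝ F).comp pr).hasFDerivAt
  have h3 : HasFDerivAt (fun z : (ℝ × F) × C(Icc (0 : ℝ) 1, F) => constOp F z.1.2) _ z₀ :=
    ((constOp F).comp ((ContinuousLinearMap.snd ℝ ℝ F).comp pr)).hasFDerivAt
  refine ⟨-(constOp F).comp (ContinuousLinearMap.snd ℝ ℝ F) -
    (ContinuousLinearMap.fst ℝ ℝ F).smulRight v, ?_⟩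
  have h4 := (hasFDerivAt_snd.sub h3).sub (h2.smul h1)
  refine h4.congr_fderiv ?_
  ext z τ
  · simp [z₀, v, pr]
  · simp [z₀, v, pr]
  · simp [z₀, v, pr]

theorem hasDerivAt_of_eq_add_integral {f : F → F} [CompleteSpace F] (hf : Continuous f)
    {α : ℝ → F} {ε : ℝ} (hα : ContinuousOn α (Ioo (-ε) ε)) {x : F}
    (h : ∀ s ∈ Ioo (-ε) ε, α s = x + ∫ r in (0 : ℝ)..s, f (α r)) {s : ℝ} (hs : s ∈ Ioo (-ε) ε) :
    HasDerivAt α (f (α s)) s := by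
  have hc : ContinuousOn (fun r => f (α r)) (Ioo (-ε) ε) := hf.comp_continuousOn hα
  have hε : 0 < ε := by have := hs.1.trans hs.2; linarith
  have hsub : uIcc 0 s ⊆ Ioo (-ε) ε :=
    (convex_Ioo (-ε) ε).ordConnected.uIcc_subset ⟨by linarith, hε⟩ hs
  have h1 := intervalIntegral.integral_hasDerivAt_right (f := fun r => f (α r)) (a := 0) (b := s)
    ((hc.mono hsub).intervalIntegrable)
    (hc.stronglyMeasurableAtFilter isOpen_Ioo s hs) (hc.continuousAt (isOpen_Ioo.mem_nhds hs))
  refine (h1.const_add x).congr_of_eventuallyEq ?_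
  filter_upwards [isOpen_Ioo.mem_nhds hs] with r hr using h r hr

/-- Smooth dependence of the local flow of a smooth vector field on time and initial point. -/
theorem exists_contDiffAt_flow [CompleteSpace F] {f : F → F} (hf : ContDiff ℝ ∞ f) (x₀ : F) :
    ∃ Φ : ℝ × F → F, (∀ᶠ p in 𝓝 ((0 : ℝ), x₀), ContDiffAt ℝ ∞ Φ p) ∧
      ∀ᶠ p in 𝓝 ((0 : ℝ), x₀), Φ (0, p.2) = p.2 ∧
        HasDerivAt (fun s => Φ (s, p.2)) (f (Φ p)) p.1 := by
  let f' : C(F, F) := ⟨f, hf.continuous⟩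
  have hf' : ContDiff ℝ ∞ f' := hf
  set p₀ : ℝ × F := (0, x₀) with hp₀
  set w₀ : C(Icc (0 : ℝ) 1, F) := constOp F x₀ with hw₀
  -- The implicit function theorem in the form of a local inverse of `(p, w) ↦ (p, defect)`; the
  -- solution with parameters `p` is read off from the preimage of `(p, 0)`.
  let H : (ℝ × F) × C(Icc (0 : ℝ) 1, F) → (ℝ × F) × C(Icc (0 : ℝ) 1, F) :=
    fun z => (z.1, odeDefect f' z)
  have hH : ContDiff ℝ ∞ H := contDiff_fst.prodMk (contDiff_odeDefect hf')
  obtain ⟨l, hl⟩ := exists_hasFDerivAt_odeDefect hf' x₀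
  let e : ((ℝ × F) × C(Icc (0 : ℝ) 1, F)) ≃L[ℝ] ((ℝ × F) × C(Icc (0 : ℝ) 1, F)) :=
    (ContinuousLinearEquiv.refl ℝ _).skewProd (ContinuousLinearEquiv.refl ℝ _) l
  have he : HasFDerivAt H (e : _ →L[ℝ] _) (p₀, w₀) := by
    refine (hasFDerivAt_fst.prodMk hl).congr_fderiv ?_
    ext z <;> simp [e]
  have h00 : odeDefect f' (p₀, w₀) = 0 := by simp [odeDefect, hp₀, hw₀]
  let h := hH.contDiffAt.toOpenPartialHomeomorph H he (by simp)
  have hcoe : (h : _ → _) = H := rfl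
  have hsrc : (p₀, w₀) ∈ h.source :=
    hH.contDiffAt.mem_toOpenPartialHomeomorph_source he (by simp)
  have htgt : (p₀, (0 : C(Icc (0 : ℝ) 1, F))) ∈ h.target := by
    have := h.map_source hsrc
    rwa [hcoe, show H (p₀, w₀) = (p₀, 0) from Prod.ext rfl h00] at this
  have hsymm0 : h.symm (p₀, 0) = (p₀, w₀) := by
    rw [← h.left_inv hsrc, hcoe, show H (p₀, w₀) = (p₀, 0) from Prod.ext rfl h00]
  let u : ℝ × F → C(Icc (0 : ℝ) 1, F) := fun p => (h.symm (p, 0)).2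
  have hι : Continuous fun p : ℝ × F => (p, (0 : C(Icc (0 : ℝ) 1, F))) := by fun_prop
  have hcs : ContinuousAt h.symm (p₀, 0) := h.continuousAt_symm htgt
  have hcs' : ContinuousAt (fun p : ℝ × F => h.symm (p, 0)) p₀ :=
    ContinuousAt.comp (f := fun p : ℝ × F => (p, (0 : C(Icc (0 : ℝ) 1, F)))) hcs hι.continuousAt
  have hu0 : u p₀ = w₀ := by simp [u, hsymm0]
  have ev1 : ∀ᶠ p in 𝓝 p₀, (p, (0 : C(Icc (0 : ℝ) 1, F))) ∈ h.target :=
    hι.continuousAt.eventually (h.open_target.mem_nhds htgt)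
  have hsol : ∀ p, (p, (0 : C(Icc (0 : ℝ) 1, F))) ∈ h.target →
      h.symm (p, 0) = (p, u p) ∧ odeDefect f' (p, u p) = 0 := fun p hp => by
    have h1 := h.right_inv hp
    rw [hcoe] at h1
    have h2 : (h.symm (p, 0)).1 = p := congrArg Prod.fst h1
    have h3 : h.symm (p, 0) = (p, u p) := Prod.ext h2 rfl
    refine ⟨h3, ?_⟩
    rw [h3] at h1
    exact congrArg Prod.snd h1
  have huniq : ∀ p w, (p, w) ∈ h.source → odeDefect f' (p, w) = 0 → u p = w := fun p w hpw h0 => by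
    have := h.left_inv hpw
    rw [hcoe, show H (p, w) = (p, 0) from Prod.ext rfl h0] at this
    simp [u, this]
  -- Invertible operators form an open set, so the inverse is smooth at all points near `p₀` and not
  -- only at `p₀`.
  have ev2 : ∀ᶠ p in 𝓝 p₀, ContDiffAt ℝ ∞ u p := by
    have h1 : ∀ᶠ z in 𝓝 (p₀, w₀), fderiv ℝ H z ∈
        range ((↑) : (((ℝ × F) × C(Icc (0 : ℝ) 1, F)) ≃L[ℝ] ((ℝ × F) × C(Icc (0 : ℝ) 1, F))) →
          (((ℝ × F) × C(Icc (0 : ℝ) 1, F)) →L[ℝ] ((ℝ × F) × C(Icc (0 : ℝ) 1, F)))) := by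
      have hc : ContinuousAt (fderiv ℝ H) (p₀, w₀) :=
        (hH.continuous_fderiv (by simp)).continuousAt
      refine hc.eventually ?_
      rw [he.fderiv]
      exact e.nhds
    have h2 : ∀ᶠ p in 𝓝 p₀, fderiv ℝ H (h.symm (p, 0)) ∈ range ((↑) : (((ℝ × F) ×
        C(Icc (0 : ℝ) 1, F)) ≃L[ℝ] ((ℝ × F) × C(Icc (0 : ℝ) 1, F))) →
          (((ℝ × F) × C(Icc (0 : ℝ) 1, F)) →L[ℝ] ((ℝ × F) × C(Icc (0 : ℝ) 1, F)))) :=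
      hcs'.tendsto.eventually (by
        change ∀ᶠ z in 𝓝 (h.symm (p₀, 0)), _
        rw [hsymm0]; exact h1)
    filter_upwards [ev1, h2] with p hp ⟨e', he'⟩
    have h3 : ContDiffAt ℝ ∞ h.symm (p, 0) := by
      refine h.contDiffAt_symm hp (f₀' := e') ?_ hH.contDiffAt
      rw [he', hcoe]
      exact (hH.differentiable (by simp) _).hasFDerivAt
    exact ContDiffAt.snd (ContDiffAt.comp p h3 (by fun_prop))
  obtain ⟨δ, hδ, hball⟩ := Metric.isOpen_iff.1 h.open_source _ hsrc
  have hcu : ContinuousAt u p₀ := continuousAt_snd.comp hcs'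
  have ev3 : ∀ᶠ p in 𝓝 p₀, dist (u p) w₀ < δ := by
    have := hcu.eventually (Metric.ball_mem_nhds (u p₀) hδ)
    rwa [hu0] at this
  obtain ⟨ε, hε, hev⟩ := Metric.eventually_nhds_iff_ball.1 ((ev1.and ev2).and ev3)
  have hεδ : Metric.ball p₀ (min ε δ) ⊆ Metric.ball p₀ ε :=
    Metric.ball_subset_ball (min_le_left _ _)
  have one_mem : (1 : ℝ) ∈ Icc (0 : ℝ) 1 := by simp
  let ev : C(Icc (0 : ℝ) 1, F) →L[ℝ] F := ContinuousMap.evalCLM ℝ ⟨1, one_mem⟩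
  -- The solution of `w' = s f(w)` at time `1` is the flow of `f` at time `s`.
  let Φ : ℝ × F → F := fun p => u p ⟨1, one_mem⟩
  have hΦ : ∀ p ∈ Metric.ball p₀ ε, ContDiffAt ℝ ∞ Φ p := fun p hp =>
    ev.contDiff.contDiffAt.comp p (hev p hp).1.2
  have hint : ∀ p ∈ Metric.ball p₀ ε, ∀ τ : Icc (0 : ℝ) 1,
      u p τ = p.2 + p.1 • ∫ r in (0 : ℝ)..τ, f (u p (projIcc 0 1 zero_le_one r)) := fun p hp τ => by
    have h1 := congrArg (fun w : C(Icc (0 : ℝ) 1, F) => w τ) (hsol p (hev p hp).1.1).2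
    simp only [odeDefect_apply, ContinuousMap.zero_apply] at h1
    exact sub_eq_zero.1 h1
  -- The curve `r ↦ u (s, x) (τ r)` solves the equation with `τ s` in place of `s`. It lies within
  -- `δ` of the constant curve, where the solution is unique, so its endpoint is the flow at time `τ
  -- s`.
  have hscale : ∀ p ∈ Metric.ball p₀ (min ε δ), ∀ τ : Icc (0 : ℝ) 1,
      Φ (τ * p.1, p.2) = u p τ := fun p hp τ => by
    have hpε := hεδ hp
    let m : C(Icc (0 : ℝ) 1, Icc (0 : ℝ) 1) :=
      ⟨fun r => ⟨τ * r, mul_nonneg τ.2.1 r.2.1, mul_le_one₀ τ.2.2 r.2.1 r.2.2⟩, by fun_prop⟩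
    have h1 : dist ((u p).comp m) w₀ < δ := by
      refine lt_of_le_of_lt ?_ (hev p hpε).2
      refine (ContinuousMap.dist_le dist_nonneg).2 fun r => ?_
      exact (ContinuousMap.dist_apply_le_dist (f := u p) (g := w₀) (m r))
    have h2 : dist ((τ : ℝ) * p.1, p.2) p₀ < δ := by
      refine lt_of_le_of_lt ?_ (lt_of_lt_of_le hp (min_le_right _ _))
      rw [Prod.dist_eq, Prod.dist_eq]
      refine max_le_max ?_ le_rfl
      simp only [hp₀, dist_zero_right, norm_mul, Real.norm_eq_abs, abs_of_nonneg τ.2.1]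
      exact mul_le_of_le_one_left (abs_nonneg _) τ.2.2
    have h3 : u ((τ : ℝ) * p.1, p.2) = (u p).comp m := by
      refine huniq _ _ (hball ?_) ?_
      · rw [Metric.mem_ball, Prod.dist_eq]
        exact max_lt h2 h1
      · ext r
        rw [odeDefect_apply, ContinuousMap.zero_apply, sub_eq_zero, ContinuousMap.comp_apply, hint p hpε]
        congr 1
        rw [mul_comm, ← smul_smul]
        congr 1
        have h4 := intervalIntegral.smul_integral_comp_mul_left (a := 0) (b := (r : ℝ))
          (fun ρ => f (u p (projIcc 0 1 zero_le_one ρ))) (τ : ℝ)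
        rw [mul_zero] at h4
        rw [show ((m r : Icc (0 : ℝ) 1) : ℝ) = τ * r from rfl, ← h4]
        congr 1
        refine intervalIntegral.integral_congr fun ρ hρ => ?_
        rw [uIcc_of_le r.2.1] at hρ
        have hρ1 : ρ ∈ Icc (0 : ℝ) 1 := ⟨hρ.1, hρ.2.trans r.2.2⟩
        have hρ2 : (τ : ℝ) * ρ ∈ Icc (0 : ℝ) 1 := (m ⟨ρ, hρ1⟩).2
        change f (u p _) = f (u p (m _))
        rw [projIcc_of_mem _ hρ2, projIcc_of_mem _ hρ1]
        rfl
    change u ((τ : ℝ) * p.1, p.2) ⟨1, one_mem⟩ = _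
    rw [h3, ContinuousMap.comp_apply]
    congr 1
    exact Subtype.ext (mul_one _)
  have hΦint : ∀ p ∈ Metric.ball p₀ (min ε δ),
      Φ p = p.2 + ∫ r in (0 : ℝ)..p.1, f (Φ (r, p.2)) := fun p hp => by
    have h1 := hint p (hεδ hp) ⟨1, one_mem⟩
    change Φ p = _ at h1
    rw [h1]
    congr 1
    have h4 := intervalIntegral.smul_integral_comp_mul_right (a := 0) (b := 1)
      (fun ρ => f (Φ (ρ, p.2))) p.1
    rw [zero_mul, one_mul] at h4
    rw [← h4]
    congr 1
    refine intervalIntegral.integral_congr fun ρ hρ => ?_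
    rw [uIcc_of_le zero_le_one] at hρ
    rw [projIcc_of_mem _ hρ, hscale p hp ⟨ρ, hρ⟩]
  have hmin : 0 < min ε δ := lt_min hε hδ
  refine ⟨Φ, ?_, ?_⟩
  · filter_upwards [Metric.ball_mem_nhds p₀ hε] with p hp using hΦ p hp
  · filter_upwards [Metric.ball_mem_nhds p₀ hmin] with p hp
    rw [Metric.mem_ball, Prod.dist_eq, max_lt_iff] at hp
    have hmem : ∀ s ∈ Ioo (-(min ε δ)) (min ε δ), (s, p.2) ∈ Metric.ball p₀ (min ε δ) :=
      fun s hs => by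
        rw [Metric.mem_ball, Prod.dist_eq]
        refine max_lt ?_ hp.2
        rw [hp₀, dist_zero_right]
        exact abs_lt.2 hs
    have hp1 : p.1 ∈ Ioo (-(min ε δ)) (min ε δ) := by
      have := hp.1
      rw [hp₀, dist_zero_right] at this
      exact abs_lt.1 this
    refine ⟨?_, ?_⟩
    · have := hΦint (0, p.2) (hmem 0 ⟨by linarith, hmin⟩)
      simpa using this
    · refine hasDerivAt_of_eq_add_integral (α := fun s => Φ (s, p.2)) (x := p.2) hf.continuous
        (fun s hs => ?_) (fun s hs => hΦint _ (hmem s hs)) hp1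
      exact ContinuousAt.continuousWithinAt
        (ContinuousAt.comp (f := fun s : ℝ => (s, p.2)) (hΦ _ (hεδ (hmem s hs))).continuousAt
          (by fun_prop))

end Flow

end

noncomputable section

open Asymptotics Filter Metric

/-! ### Taylor expansions and orders of vanishing of derivatives. -/

section Taylor

variable {V W : Type*} [NormedAddCommGroup V] [NormedSpace ℝ V] [NormedAddCommGroup W]
  [NormedSpace ℝ W]

/-- The top term is itself `O(r ^ k)`, so induction kills the lower coefficients; dividing what
remains by `r ^ k` kills the last. -/
theorem eq_zero_of_sum_pow_smul_isBigO {k : ℕ} {c : ℕ → W}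
    (h : (fun r : ℝ => ∑ i ∈ Finset.range k, r ^ i • c i) =O[𝓝[≠] 0] fun r => r ^ k) :
    ∀ i < k, c i = 0 := by
  induction k with
  | zero => intro i hi; omega
  | succ k ih =>
    have hle : (fun r : ℝ => r ^ (k + 1)) =O[𝓝[≠] 0] fun r => r ^ k :=
      (isBigO_refl _ _).congr' (by rfl) (by rfl) |>.trans
        ((Asymptotics.IsLittleO.isBigO (isLittleO_pow_pow (Nat.lt_succ_self k))).mono
          nhdsWithin_le_nhds)
    have hk : (fun r : ℝ => r ^ k • c k) =O[𝓝[≠] 0] fun r => r ^ k := by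
      simpa using (isBigO_refl (fun r : ℝ => r ^ k) (𝓝[≠] 0)).smul
        (isBigO_const_const (c k) (one_ne_zero (α := ℝ)) (𝓝[≠] 0))
    have h0 : ∀ i < k, c i = 0 := ih <| by
      have := (h.trans hle).sub hk
      simpa [Finset.sum_range_succ] using this
    have h1 : (fun r : ℝ => r ^ k • c k) =O[𝓝[≠] 0] fun r => r ^ (k + 1) := by
      refine h.congr_left fun r => ?_
      rw [Finset.sum_range_succ, Finset.sum_eq_zero, zero_add]
      intro i hi
      rw [h0 i (Finset.mem_range.1 hi), smul_zero]
    have h2 : (fun _ : ℝ => c k) =O[𝓝[≠] 0] fun r => r := by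
      refine (((isBigO_refl (fun r : ℝ => (r ^ k)⁻¹) (𝓝[≠] 0)).smul h1)).congr' ?_ ?_
      · filter_upwards [self_mem_nhdsWithin] with r hr
        have : (r : ℝ) ^ k ≠ 0 := pow_ne_zero _ hr
        simp [smul_smul, this]
      · filter_upwards [self_mem_nhdsWithin] with r hr
        have : (r : ℝ) ^ k ≠ 0 := pow_ne_zero _ hr
        rw [smul_eq_mul, pow_succ]
        field_simp
    have h3 : Tendsto (fun _ : ℝ => c k) (𝓝[≠] 0) (𝓝 0) :=
      h2.trans_tendsto (tendsto_id.mono_left nhdsWithin_le_nhds)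
    intro i hi
    rcases Nat.lt_succ_iff_lt_or_eq.1 hi with h' | rfl
    · exact h0 i h'
    · exact tendsto_nhds_unique tendsto_const_nhds h3

/-- The homogeneous Taylor polynomials of `f` at `0`. -/
def taylorTerm (f : V → W) (i : ℕ) (x : V) : W := ((i ! : ℝ)⁻¹) • iteratedFDeriv ℝ i f 0 fun _ => x

theorem taylorTerm_smul (f : V → W) (i : ℕ) (r : ℝ) (x : V) :
    taylorTerm f i (r • x) = r ^ i • taylorTerm f i x := by
  have := (iteratedFDeriv ℝ i f 0).map_smul_univ (fun _ => r) (fun _ => x)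
  simp only [Finset.prod_const, Finset.card_univ, Fintype.card_fin] at this
  rw [taylorTerm, this, smul_comm, taylorTerm]

theorem contDiff_taylorTerm (f : V → W) (i : ℕ) : ContDiff ℝ ∞ (taylorTerm f i) := by
  refine ContDiff.const_smul _ ?_
  exact (ContinuousMultilinearMap.contDiff _).comp (contDiff_pi.2 fun _ => contDiff_id)

theorem hasFDerivAt_taylorTerm (f : V → W) (i : ℕ) (x : V) :
    HasFDerivAt (taylorTerm f i) (((i ! : ℝ)⁻¹) • ∑ j : Fin i,
      ((iteratedFDeriv ℝ i f 0).toContinuousLinearMap (fun _ => x) j)) x := by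
  refine HasFDerivAt.const_smul ?_ _
  have h1 := (iteratedFDeriv ℝ i f 0).hasFDerivAt (fun _ : Fin i => x)
  have h2 : HasFDerivAt (fun y : V => fun _ : Fin i => y)
      (ContinuousLinearMap.pi fun _ => ContinuousLinearMap.id ℝ V) x :=
    hasFDerivAt_pi.2 fun _ => hasFDerivAt_id x
  refine (HasFDerivAt.comp (f := fun y : V => fun _ : Fin i => y) x h1 h2).congr_fderiv ?_
  ext v
  simp [ContinuousMultilinearMap.linearDeriv_apply]

theorem fderiv_taylorTerm_isBigO (f : V → W) (i : ℕ) :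
    fderiv ℝ (taylorTerm f (i + 1)) =O[𝓝 0] fun x => ‖x‖ ^ i := by
  have h : fderiv ℝ (taylorTerm f (i + 1)) = fun x => (((i + 1) ! : ℝ)⁻¹) • ∑ j : Fin (i + 1),
      ((iteratedFDeriv ℝ (i + 1) f 0).toContinuousLinearMap (fun _ => x) j) :=
    funext fun x => (hasFDerivAt_taylorTerm f (i + 1) x).fderiv
  rw [h]
  suffices hs : (fun x : V => ∑ j : Fin (i + 1),
      ((iteratedFDeriv ℝ (i + 1) f 0).toContinuousLinearMap (fun _ => x) j)) =O[𝓝 0]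
      fun x => ‖x‖ ^ i from
    hs.const_smul_left (((i + 1) ! : ℝ)⁻¹)
  refine IsBigO.fun_sum fun j _ => ?_
  refine IsBigO.of_bound ‖iteratedFDeriv ℝ (i + 1) f 0‖ (.of_forall fun x => ?_)
  refine ContinuousLinearMap.opNorm_le_bound _ (by positivity) fun v => ?_
  refine ((iteratedFDeriv ℝ (i + 1) f 0).le_opNorm _).trans ?_
  rw [mul_assoc, ← Finset.mul_prod_erase Finset.univ _ (Finset.mem_univ j)]
  refine mul_le_mul_of_nonneg_left ?_ (norm_nonneg _)
  rw [Function.update_self, mul_comm]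
  refine mul_le_mul_of_nonneg_right (le_of_eq ?_) (norm_nonneg _)
  rw [Finset.prod_congr rfl (g := fun _ => ‖x‖) fun l hl => by
    rw [Function.update_of_ne (Finset.ne_of_mem_erase hl)]]
  simp

theorem sub_sum_taylorTerm_isBigO [CompleteSpace W] {f : V → W} (hf : ContDiffAt ℝ ∞ f 0) (k : ℕ) :
    (fun x => f x - ∑ i ∈ Finset.range k, taylorTerm f i x) =O[𝓝 0] fun x => ‖x‖ ^ k := by
  cases k with
  | zero => simpa using hf.continuousAt.isBigO_one ℝ
  | succ n =>
    have hn : ContDiffAt ℝ ((n + 1 : ℕ) : ℕ∞ω) f 0 := hf.of_le (by exact_mod_cast le_top)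
    have h1 := hn.eventually (by simp)
    have h2 : ∀ᶠ x in 𝓝 (0 : V), ‖iteratedFDeriv ℝ (n + 1) f x‖
        < ‖iteratedFDeriv ℝ (n + 1) f 0‖ + 1 :=
      (hn.continuousAt_iteratedFDeriv le_rfl).norm.eventually_lt_const (lt_add_one _)
    obtain ⟨δ, hδ, h⟩ := Metric.eventually_nhds_iff_ball.1 (h1.and h2)
    set B := ‖iteratedFDeriv ℝ (n + 1) f 0‖ + 1
    refine IsBigO.of_bound (((n ! : ℝ)⁻¹) * B) ?_
    filter_upwards [Metric.ball_mem_nhds (0 : V) hδ] with y hy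
    have hmem : ∀ t ∈ Set.Icc (0 : ℝ) 1, (0 : V) + t • y ∈ ball (0 : V) δ := fun t ht => by
      rw [zero_add, mem_ball_zero_iff, norm_smul, Real.norm_of_nonneg ht.1]
      exact (mul_le_of_le_one_left (norm_nonneg _) ht.2).trans_lt (mem_ball_zero_iff.1 hy)
    have h3 := map_add_eq_sum_add_integral_iteratedFDeriv (f := f) (x := 0) (y := y) (n := n)
      fun t ht => by exact_mod_cast (h _ (hmem t ht)).1
    rw [zero_add] at h3
    rw [h3]
    simp only [taylorTerm]
    rw [add_sub_cancel_left, norm_smul, mul_assoc, Real.norm_of_nonneg (by positivity)]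
    refine mul_le_mul_of_nonneg_left ?_ (by positivity)
    have h4 := intervalIntegral.norm_integral_le_of_norm_le_const (a := 0) (b := 1)
      (f := fun t : ℝ => (1 - t) ^ n • iteratedFDeriv ℝ (n + 1) f (0 + t • y) fun _ => y)
      (C := B * ‖y‖ ^ (n + 1)) fun t ht => by
        rw [Set.uIoc_of_le zero_le_one] at ht
        have ht' : t ∈ Set.Icc (0 : ℝ) 1 := ⟨ht.1.le, ht.2⟩
        rw [norm_smul]
        have h5 : ‖(1 - t) ^ n‖ ≤ 1 := by
          rw [norm_pow, Real.norm_of_nonneg (by linarith [ht.2])]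
          exact pow_le_one₀ (by linarith [ht.2]) (by linarith [ht.1])
        refine (mul_le_mul_of_nonneg_right h5 (norm_nonneg _)).trans ?_
        rw [one_mul]
        refine ((iteratedFDeriv ℝ (n + 1) f _).le_opNorm _).trans ?_
        rw [Finset.prod_const, Finset.card_univ, Fintype.card_fin]
        exact mul_le_mul_of_nonneg_right (h _ (hmem t ht')).2.le (by positivity)
    simpa using h4

/-- Interpolation: a twice differentiable function which is `O(‖x‖ ^ (2 * k))` has a derivative
which is `O(‖x‖ ^ k)`. -/
theorem fderiv_isBigO_of_isBigO_two_mul {f : V → W} (hf : ContDiffAt ℝ ∞ f 0) {k : ℕ}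
    (h : f =O[𝓝 0] fun x => ‖x‖ ^ (2 * k)) : fderiv ℝ f =O[𝓝 0] fun x => ‖x‖ ^ k := by
  have hf2 : ContDiffAt ℝ ((2 : ℕ) : ℕ∞ω) f 0 := hf.of_le (WithTop.coe_le_coe.2 le_top)
  have hf1 : ContDiffAt ℝ 1 (fderiv ℝ f) 0 := hf2.fderiv_right (by norm_num)
  rcases Nat.eq_zero_or_pos k with rfl | hk
  · simpa using hf1.continuousAt.isBigO_one ℝ
  have h0 : fderiv ℝ f 0 = 0 :=
    (IsBigO.hasFDerivAt (n := 2 * k) (by simpa using h) (by omega)).fderiv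
  obtain ⟨K, t, ht, hK⟩ := hf1.exists_lipschitzOnWith
  obtain ⟨C, hC⟩ := h.bound
  have hd : ∀ᶠ x in 𝓝 (0 : V), DifferentiableAt ℝ f x :=
    (hf2.eventually (by simp)).mono fun x hx => hx.differentiableAt (by norm_num)
  obtain ⟨δ, hδ, hall⟩ := Metric.eventually_nhds_iff_ball.1 ((hC.and hd).and ht)
  refine IsBigO.of_bound (K + |C| * (4 ^ k + 1)) ?_
  filter_upwards [Metric.ball_mem_nhds (0 : V) (half_pos (lt_min hδ one_pos))] with x hx
  rw [mem_ball_zero_iff] at hx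
  rcases eq_or_ne x 0 with rfl | hx0
  · rw [h0, norm_zero]; positivity
  have hxpos : 0 < ‖x‖ := norm_pos_iff.2 hx0
  have hx1 : ‖x‖ ≤ 1 := by linarith [min_le_right δ 1]
  have hxδ : 2 * ‖x‖ < δ := by linarith [min_le_left δ 1]
  -- Values of `f` at `x` and `x + r v` are `O(r ^ 2)`, and `fderiv ℝ f` varies by at most `K r`
  -- between them. So `r ‖f'(x) v‖` is `O(r ^ 2)`, which balances the two errors.
  set r := ‖x‖ ^ k with hr
  have hrpos : 0 < r := by positivity
  have hrle : r ≤ ‖x‖ := by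
    calc r ≤ ‖x‖ ^ 1 := pow_le_pow_of_le_one hxpos.le hx1 hk
      _ = ‖x‖ := pow_one _
  rw [Real.norm_of_nonneg hrpos.le]
  refine ContinuousLinearMap.opNorm_le_of_unit_norm (by positivity) fun v hv => ?_
  have hmem : ∀ y ∈ closedBall x r, ‖y‖ ≤ 2 * ‖x‖ := fun y hy => by
    have h1 : ‖y - x‖ ≤ r := by simpa [dist_eq_norm] using hy
    have h2 : ‖y‖ ≤ ‖y - x‖ + ‖x‖ := by simpa using norm_add_le (y - x) x
    linarith
  have hball : ∀ y ∈ closedBall x r, y ∈ ball (0 : V) δ := fun y hy => by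
    rw [mem_ball_zero_iff]; exact (hmem y hy).trans_lt hxδ
  have hxm : x ∈ closedBall x r := mem_closedBall_self hrpos.le
  have hym : x + r • v ∈ closedBall x r := by
    simp [dist_eq_norm, norm_smul, hv, abs_of_pos hrpos]
  have h1 := (convex_closedBall x r).norm_image_sub_le_of_norm_hasFDerivWithin_le'
    (f := f) (f' := fderiv ℝ f) (C := K * r)
    (fun y hy => (hall y (hball y hy)).1.2.hasFDerivAt.hasFDerivWithinAt)
    (fun y hy => by
      have h2 := hK.dist_le_mul y (hall y (hball y hy)).2 x (hall x (hball x hxm)).2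
      rw [dist_eq_norm] at h2
      show ‖fderiv ℝ f y - fderiv ℝ f x‖ ≤ K * r
      exact h2.trans (mul_le_mul_of_nonneg_left (mem_closedBall.1 hy) K.2)) hxm hym
  rw [add_sub_cancel_left, norm_smul, hv, Real.norm_of_nonneg hrpos.le, mul_one, map_smul] at h1
  have hbd : ∀ y ∈ closedBall x r, ‖f y‖ ≤ |C| * ((2 * ‖x‖) ^ (2 * k)) := fun y hy => by
    have h2 := (hall y (hball y hy)).1.1
    rw [norm_pow, norm_norm] at h2
    exact h2.trans (mul_le_mul (le_abs_self C) (pow_le_pow_left₀ (norm_nonneg _) (hmem y hy) _)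
      (by positivity) (abs_nonneg _))
  have h3 := hbd _ hym
  have h4 : ‖f x‖ ≤ |C| * (‖x‖ ^ (2 * k)) := by
    have h2 := (hall x (hball x hxm)).1.1
    rw [norm_pow, norm_norm] at h2
    exact h2.trans (mul_le_mul_of_nonneg_right (le_abs_self C) (by positivity))
  have h5 : (2 * ‖x‖) ^ (2 * k) = 4 ^ k * (r * r) := by
    rw [mul_pow, pow_mul, hr, ← pow_add, ← two_mul]; norm_num
  have h6 : ‖x‖ ^ (2 * k) = r * r := by rw [hr, ← pow_add, ← two_mul]
  rw [h5] at h3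
  rw [h6] at h4
  have h7 : ‖r • fderiv ℝ f x v‖ ≤ K * r * r + ‖f (x + r • v)‖ + ‖f x‖ := by
    have : r • fderiv ℝ f x v = f (x + r • v) - f x - (f (x + r • v) - f x - r • fderiv ℝ f x v) := by
      abel
    rw [this]
    refine (norm_sub_le _ _).trans ?_
    linarith [norm_sub_le (f (x + r • v)) (f x)]
  rw [norm_smul, Real.norm_of_nonneg hrpos.le] at h7
  have h8 : r * ‖fderiv ℝ f x v‖ ≤ r * ((K + |C| * (4 ^ k + 1)) * r) := by
    refine h7.trans ?_
    nlinarith [h3, h4]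
  exact le_of_mul_le_mul_left h8 hrpos

/-- Subtracting the Taylor polynomial of degree below `2 * k` leaves a function to which the
interpolation lemma applies. The Taylor terms of degree at most `k` vanish by hypothesis, and those
of higher degree have derivatives of the required order. -/
theorem fderiv_isBigO [CompleteSpace W] {f : V → W} (hf : ContDiffAt ℝ ∞ f 0) {k : ℕ}
    (h : f =O[𝓝 0] fun x => ‖x‖ ^ (k + 1)) : fderiv ℝ f =O[𝓝 0] fun x => ‖x‖ ^ k := by
  have hsmall : ∀ {a b : ℕ}, b ≤ a → (fun x : V => ‖x‖ ^ a) =O[𝓝 0] fun x => ‖x‖ ^ b := by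
    intro a b hab
    refine IsBigO.of_bound 1 ?_
    filter_upwards [Metric.ball_mem_nhds (0 : V) one_pos] with x hx
    rw [one_mul, Real.norm_of_nonneg (by positivity), Real.norm_of_nonneg (by positivity)]
    exact pow_le_pow_of_le_one (norm_nonneg _) (mem_ball_zero_iff.1 hx).le hab
  rcases Nat.eq_zero_or_pos k with rfl | hk
  · have hf1 : ContDiffAt ℝ 1 f 0 := hf.of_le (by exact_mod_cast le_top)
    simpa using (hf1.fderiv_right (m := 0) (by norm_num)).continuousAt.isBigO_one ℝ
  have hT := sub_sum_taylorTerm_isBigO hf (2 * k)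
  have hTs : ContDiff ℝ ∞ (fun x => ∑ i ∈ Finset.range (2 * k), taylorTerm f i x) :=
    ContDiff.sum fun i _ => contDiff_taylorTerm f i
  have h1 := fderiv_isBigO_of_isBigO_two_mul (hf.sub hTs.contDiffAt) hT
  have hvan : ∀ i < k + 1, ∀ x, taylorTerm f i x = 0 := by
    intro i hi x
    have h2 := h.sub (sub_sum_taylorTerm_isBigO hf (k + 1))
    simp only [sub_sub_cancel] at h2
    have h3 : Tendsto (fun r : ℝ => r • x) (𝓝[≠] 0) (𝓝 0) := by
      have : ContinuousAt (fun r : ℝ => r • x) 0 := by fun_prop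
      simpa [ContinuousAt] using this.tendsto.mono_left (nhdsWithin_le_nhds (s := {0}ᶜ))
    have h4 := h2.comp_tendsto h3
    refine eq_zero_of_sum_pow_smul_isBigO (k := k + 1) (c := fun i => taylorTerm f i x) ?_ i hi
    refine (h4.congr_left fun r => by simp [taylorTerm_smul]).trans ?_
    refine IsBigO.of_bound (‖x‖ ^ (k + 1)) (.of_forall fun r => le_of_eq ?_)
    simp [norm_smul, mul_pow, mul_comm]
  have h5 : ∀ i ∈ Finset.range (2 * k),
      fderiv ℝ (taylorTerm f i) =O[𝓝 0] fun x => ‖x‖ ^ k := by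
    intro i _
    rcases lt_or_ge i (k + 1) with hi | hi
    · have : taylorTerm f i = fun _ => 0 := funext (hvan i hi)
      rw [this]
      simp only [fderiv_fun_const]
      exact isBigO_zero _ _
    · obtain ⟨j, rfl⟩ : ∃ j, i = j + 1 := ⟨i - 1, by omega⟩
      exact (fderiv_taylorTerm_isBigO f j).trans (hsmall (by omega))
  have h6 := h1.add (IsBigO.sum h5)
  refine h6.congr' ?_ (by rfl)
  have hd : ∀ᶠ x in 𝓝 (0 : V), DifferentiableAt ℝ f x :=
    ((hf.of_le (m := ((1 : ℕ) : ℕ∞ω)) (by exact_mod_cast le_top)).eventually (by simp)).mono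
      fun x hx => hx.differentiableAt (by norm_num)
  filter_upwards [hd] with x hx
  rw [fderiv_fun_sub hx (hTs.differentiable (by simp) x), fderiv_fun_sum fun i _ =>
    (contDiff_taylorTerm f i).differentiable (by simp) x]
  simp

theorem fderiv_sub_sum_taylorTerm_isBigO [CompleteSpace W] {f : V → W} (hf : ContDiffAt ℝ ∞ f 0)
    (k : ℕ) : (fun x => fderiv ℝ f x -
      fderiv ℝ (fun x => ∑ i ∈ Finset.range (k + 1), taylorTerm f i x) x) =O[𝓝 0]
      fun x => ‖x‖ ^ k := by
  have hTs : ContDiff ℝ ∞ (fun x => ∑ i ∈ Finset.range (k + 1), taylorTerm f i x) :=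
    ContDiff.sum fun i _ => contDiff_taylorTerm f i
  refine (fderiv_isBigO (hf.sub hTs.contDiffAt) (sub_sum_taylorTerm_isBigO hf (k + 1))).congr' ?_
    (by rfl)
  have hd : ∀ᶠ x in 𝓝 (0 : V), DifferentiableAt ℝ f x :=
    ((hf.of_le (m := ((1 : ℕ) : ℕ∞ω)) (by exact_mod_cast le_top)).eventually (by simp)).mono
      fun x hx => hx.differentiableAt (by norm_num)
  filter_upwards [hd] with x hx
  rw [← fderiv_fun_sub hx (hTs.differentiable (by simp) x)]

end Taylor

/-! ### Zeros of perturbed power sums and returns to the base point. -/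

section Solve

variable {E : Type*} [NormedAddCommGroup E] [NormedSpace ℝ E]
  {β : Type*} [Fintype β]

/-- If `B` is a right inverse of `A`, then `L ∘ B` is close to the identity, hence invertible, for
`L` close to `A`. -/
theorem eventually_surjective [FiniteDimensional ℝ E] {V : Type*} [NormedAddCommGroup V] [NormedSpace ℝ V]
    {A : V →L[ℝ] E} (hA : Function.Surjective A) :
    ∀ᶠ L : V →L[ℝ] E in 𝓝 A, Function.Surjective L := by
  have := FiniteDimensional.complete ℝ E
  obtain ⟨B, hB⟩ := (A : V →ₗ[ℝ] E).exists_rightInverse_of_surjective (LinearMap.range_eq_top.2 hA)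
  have h1 : A.comp (LinearMap.toContinuousLinearMap B) = 1 := by
    ext x; exact congrArg (fun l => l x) hB
  have hc : ContinuousAt (fun L : V →L[ℝ] E => L.comp (LinearMap.toContinuousLinearMap B)) A := by
    fun_prop
  have h2 : ∀ᶠ L in 𝓝 A, IsUnit (L.comp (LinearMap.toContinuousLinearMap B)) :=
    hc.eventually (Units.isOpen.mem_nhds (by
      change IsUnit (A.comp (LinearMap.toContinuousLinearMap B))
      rw [h1]; exact isUnit_one))
  filter_upwards [h2] with L hL x
  obtain ⟨u, hu⟩ := hL
  refine ⟨LinearMap.toContinuousLinearMap B ((↑u⁻¹ : E →L[ℝ] E) x), ?_⟩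
  have h3 : (u : E →L[ℝ] E) * (↑u⁻¹ : E →L[ℝ] E) = 1 := u.mul_inv
  rw [hu] at h3
  exact congrArg (fun l : E →L[ℝ] E => l x) h3

/-- The map `σ ↦ ∑ σ_b ^ J v_b`. -/
def powSum (J : ℕ) (v : β → E) (σ : β → ℝ) : E := ∑ b, σ b ^ J • v b

/-- The derivative of `powSum`. -/
def powSumDeriv (J : ℕ) (v : β → E) (σ : β → ℝ) : (β → ℝ) →L[ℝ] E :=
  ∑ b, (J * σ b ^ (J - 1)) • (ContinuousLinearMap.proj b : (β → ℝ) →L[ℝ] ℝ).smulRight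
    (v b)

theorem hasFDerivAt_powSum (J : ℕ) (v : β → E) (σ : β → ℝ) :
    HasFDerivAt (powSum J v) (powSumDeriv J v σ) σ := by
  refine HasFDerivAt.fun_sum fun b _ => ?_
  have h1 : HasFDerivAt (fun σ : β → ℝ => σ b)
    (ContinuousLinearMap.proj b : (β → ℝ) →L[ℝ] ℝ) σ := hasFDerivAt_apply b σ
  refine ((h1.pow J).smul_const (v b)).congr_fderiv ?_
  ext w
  simp [smul_smul]

theorem contDiff_powSum (J : ℕ) (v : β → E) : ContDiff ℝ ∞ (powSum J v) :=
  ContDiff.sum fun b _ => ((contDiff_apply ℝ ℝ b).pow J).smul contDiff_const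

theorem powSum_smul (J : ℕ) (v : β → E) (s : ℝ) (σ : β → ℝ) :
    powSum J v (s • σ) = s ^ J • powSum J v σ := by
  simp [powSum, Finset.smul_sum, mul_pow, smul_smul]

theorem powSumDeriv_smul (J : ℕ) (v : β → E) (s : ℝ) (σ : β → ℝ) :
    powSumDeriv J v (s • σ) = s ^ (J - 1) • powSumDeriv J v σ := by
  simp only [powSumDeriv, Finset.smul_sum, smul_smul, Pi.smul_apply, smul_eq_mul, mul_pow]
  refine Finset.sum_congr rfl fun b _ => ?_
  congr 1
  ring

theorem powSumDeriv_one_surjective {J : ℕ} (hJ : 0 < J) {v : β → E}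
    (hv : Submodule.span ℝ (Set.range v) = ⊤) : Function.Surjective (powSumDeriv J v 1) := by
  intro x
  obtain ⟨c, rfl⟩ := (Submodule.mem_span_range_iff_exists_fun ℝ).1 (hv ▸ Submodule.mem_top (x := x))
  refine ⟨fun b => (J : ℝ)⁻¹ * c b, ?_⟩
  have : (J : ℝ) ≠ 0 := by positivity
  simp [powSumDeriv, ← smul_assoc, this]

/-- Put `σ = s y` with `y` near `(1, ..., 1)` and divide by `s ^ J`: the equation becomes `powSum J
v y + O(s) = 0`. At `y = 1` the power sum is zero because the `v b` sum to zero, and its derivative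
is onto because they span, so a quantitative open mapping argument finds a root for small `s`; it is
positive since `y` is near `1`. The family `Q` is a second perturbation of the derivative, later
supplied by a Taylor polynomial. -/
theorem frequently_powSum_eq [FiniteDimensional ℝ E] {J : ℕ} (hJ : 0 < J) {v : β → E} (hv0 : ∑ b, v b = 0)
    (hv : Submodule.span ℝ (Set.range v) = ⊤) {R : (β → ℝ) → E} {R' : (β → ℝ) → (β → ℝ) →L[ℝ] E}
    (hR : ∀ᶠ σ in 𝓝 0, HasFDerivAt R (R' σ) σ) (hRO : R =O[𝓝 0] fun σ => ‖σ‖ ^ (J + 1))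
    (hR'O : R' =O[𝓝 0] fun σ => ‖σ‖ ^ J) {Q : (β → ℝ) → (β → ℝ) →L[ℝ] E}
    (hQ : Q =O[𝓝 0] fun σ => ‖σ‖ ^ J) :
    ∃ᶠ σ in 𝓝 (0 : β → ℝ), (∀ b, 0 < σ b) ∧ R σ + powSum J v σ = 0 ∧
      Function.Surjective (R' σ + powSumDeriv J v σ) ∧
      Function.Surjective (Q σ + powSumDeriv J v σ) := by
  have := FiniteDimensional.complete ℝ E
  set A := powSumDeriv J v 1 with hAdef
  have hA := powSumDeriv_one_surjective hJ hv
  have hstrict : HasStrictFDerivAt (powSum J v) A 1 :=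
    (contDiff_powSum J v).contDiffAt.hasStrictFDerivAt' (hasFDerivAt_powSum J v 1) (by simp)
  set B := A.nonlinearRightInverseOfSurjective (LinearMap.range_eq_top.2 hA) with hB
  have hBpos : 0 < B.nnnorm := A.nonlinearRightInverseOfSurjective_nnnorm_pos _
  have hcpos : 0 < B.nnnorm⁻¹ / 4 := by positivity
  -- The power sum and the rescaled remainder each deviate from `A` by a Lipschitz constant `c`. The
  -- difference `‖B‖⁻¹ - 2 c = ‖B‖⁻¹ / 2` then controls the radius of the ball covered by the image.
  set c : NNReal := B.nnnorm⁻¹ / 4 with hc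
  obtain ⟨S, hS, happ⟩ := hstrict.approximates_deriv_on_nhds (Or.inr hcpos)
  obtain ⟨ε, hε, hsurj⟩ := Metric.eventually_nhds_iff_ball.1 (eventually_surjective hA)
  have hcont : ContinuousAt (powSumDeriv J v) 1 := by
    have : powSumDeriv J v = fderiv ℝ (powSum J v) :=
      funext fun σ => (hasFDerivAt_powSum J v σ).fderiv.symm
    rw [this]
    exact ((contDiff_powSum J v).continuous_fderiv (by simp)).continuousAt
  have hnear : ∀ᶠ y in 𝓝 (1 : β → ℝ), dist (powSumDeriv J v y) A < ε / 2 :=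
    hcont.eventually (Metric.ball_mem_nhds _ (half_pos hε))
  obtain ⟨ρ', hρ', hball⟩ := Metric.eventually_nhds_iff_ball.1 (hnear.and hS)
  -- With `ρ ≤ 1 / 2`, all coordinates in the ball around `(1, ..., 1)` are positive and at most
  -- `2`.
  set ρ := min (ρ' / 2) (1 / 2) with hρ
  have hρpos : 0 < ρ := by positivity
  have hsub : ∀ y ∈ closedBall (1 : β → ℝ) ρ, dist (powSumDeriv J v y) A < ε / 2 ∧ y ∈ S :=
    fun y hy => hball y (mem_ball.2 ((mem_closedBall.1 hy).trans_lt (by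
      have : ρ ≤ ρ' / 2 := min_le_left _ _
      linarith)))
  obtain ⟨C₁, hC₁pos, hC₁⟩ := hRO.exists_pos
  obtain ⟨C₂, hC₂pos, hC₂⟩ := hR'O.exists_pos
  obtain ⟨C₃, hC₃pos, hC₃⟩ := hQ.exists_pos
  have hall := ((hR.and hC₁.bound).and (hC₂.bound.and hC₃.bound))
  refine Filter.frequently_iff.2 fun {O} hO => ?_
  obtain ⟨δ, hδ, hδall⟩ := Metric.eventually_nhds_iff_ball.1 (hall.and hO)
  -- choice of the scale `s`
  have hsmall : ∃ s : ℝ, 0 < s ∧ 2 * s < δ ∧ C₁ * 2 ^ (J + 1) * s ≤ (B.nnnorm⁻¹ / 2 : NNReal) * ρ ∧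
      C₂ * 2 ^ J * s ≤ c ∧ C₂ * 2 ^ J * s < ε / 2 ∧ C₃ * 2 ^ J * s < ε / 2 := by
    have h : ∀ (K b : ℝ), 0 < b → ∀ᶠ s : ℝ in 𝓝[>] 0, K * s < b := fun K b hb => by
      have h1 : Tendsto (fun s : ℝ => K * s) (𝓝[>] 0) (𝓝 (K * 0)) :=
        ((continuous_const.mul continuous_id).tendsto 0).mono_left nhdsWithin_le_nhds
      rw [mul_zero] at h1
      exact h1.eventually_lt_const hb
    obtain ⟨s, ⟨⟨h1, h2⟩, ⟨h3, h4⟩, h5⟩, h6⟩ :=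
      ((((h 2 δ hδ).and (h (C₁ * 2 ^ (J + 1)) ((B.nnnorm⁻¹ / 2 : NNReal) * ρ) (by positivity))).and
      (((h (C₂ * 2 ^ J) c (by exact_mod_cast hcpos)).and (h (C₂ * 2 ^ J) (ε / 2) (half_pos hε))).and
        (h (C₃ * 2 ^ J) (ε / 2) (half_pos hε)))).and self_mem_nhdsWithin).exists
    exact ⟨s, h6, h1, h2.le, h3.le, h4, h5⟩
  obtain ⟨s, hs, hsδ, hs1, hs2, hs3, hs4⟩ := hsmall
  have hnorm : ∀ y ∈ closedBall (1 : β → ℝ) ρ, ‖s • y‖ ≤ 2 * s := fun y hy => by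
    rw [norm_smul, Real.norm_of_nonneg hs.le, mul_comm]
    refine mul_le_mul_of_nonneg_right ?_ hs.le
    refine (pi_norm_le_iff_of_nonneg zero_le_two).2 fun b => ?_
    have h1 : dist (y b) 1 ≤ ρ := (dist_le_pi_dist y 1 b).trans (mem_closedBall.1 hy)
    have h2 : ρ ≤ 1 / 2 := min_le_right _ _
    rw [Real.dist_eq] at h1
    rw [Real.norm_eq_abs, abs_le]
    have := abs_le.1 h1
    constructor <;> linarith [this.1, this.2]
  have hmem : ∀ y ∈ closedBall (1 : β → ℝ) ρ, s • y ∈ ball (0 : β → ℝ) δ := fun y hy =>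
    mem_ball_zero_iff.2 ((hnorm y hy).trans_lt hsδ)
  have hsJ : 0 < s ^ J := by positivity
  have hJ1 : s ^ J = s ^ (J - 1) * s := by rw [← pow_succ, Nat.sub_add_cancel hJ]
  have hscale : ∀ {K x : ℝ}, ∀ y ∈ closedBall (1 : β → ℝ) ρ, 0 < K → x ≤ K * ‖‖s • y‖ ^ J‖ →
      (s ^ (J - 1))⁻¹ * x ≤ K * 2 ^ J * s := fun {K x} y hy hK hx => by
    rw [norm_pow, norm_norm] at hx
    have h1 : ‖s • y‖ ^ J ≤ (2 * s) ^ J := pow_le_pow_left₀ (norm_nonneg _) (hnorm y hy) _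
    have h2 : x ≤ K * 2 ^ J * s * s ^ (J - 1) := by
      calc x ≤ K * (2 * s) ^ J := hx.trans (mul_le_mul_of_nonneg_left h1 hK.le)
        _ = _ := by rw [mul_pow, hJ1]; ring
    rw [inv_mul_le_iff₀ (by positivity)]
    linarith
  set H : (β → ℝ) → E := fun y => (s ^ J)⁻¹ • R (s • y) + powSum J v y with hH
  have hRlip : ∀ x ∈ closedBall (1 : β → ℝ) ρ, ∀ y ∈ closedBall (1 : β → ℝ) ρ,
      ‖(s ^ J)⁻¹ • R (s • y) - (s ^ J)⁻¹ • R (s • x)‖ ≤ c * ‖y - x‖ := fun x hx y hy => by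
    refine (convex_closedBall (1 : β → ℝ) ρ).norm_image_sub_le_of_norm_hasFDerivWithin_le
      (f := fun y => (s ^ J)⁻¹ • R (s • y)) (f' := fun y => (s ^ (J - 1))⁻¹ • R' (s • y))
      (fun z hz => HasFDerivAt.hasFDerivWithinAt ?_) (fun z hz => ?_) hx hy
    · have h1 : HasFDerivAt (fun z : β → ℝ => s • z) (s • ContinuousLinearMap.id ℝ (β → ℝ)) z :=
        (hasFDerivAt_id z).const_smul s
      refine (((hδall _ (hmem z hz)).1.1.1.comp z h1).const_smul ((s ^ J)⁻¹)).congr_fderiv ?_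
      ext w
      simp only [smul_apply, ContinuousLinearMap.comp_apply,
        ContinuousLinearMap.id_apply, map_smul, smul_smul]
      congr 1
      rw [hJ1]
      field_simp
    · rw [norm_smul, norm_inv, Real.norm_of_nonneg (by positivity : 0 ≤ s ^ (J - 1))]
      exact (hscale z hz hC₂pos (hδall _ (hmem z hz)).1.2.1).trans hs2
  have hHapp : ApproximatesLinearOn H A (closedBall 1 ρ) (c + c) := fun x hx y hy => by
    have h1 := happ x (hsub x hx).2 y (hsub y hy).2
    have h2 := hRlip y hy x hx
    have h3 : H x - H y - A (x - y) = ((s ^ J)⁻¹ • R (s • x) - (s ^ J)⁻¹ • R (s • y)) +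
        (powSum J v x - powSum J v y - A (x - y)) := by
      simp only [hH]; abel
    rw [h3]
    refine (norm_add_le _ _).trans ?_
    push_cast
    linarith
  have h1mem : (1 : β → ℝ) ∈ closedBall (1 : β → ℝ) ρ := mem_closedBall_self hρpos.le
  have hH1 : ‖H 1‖ ≤ C₁ * 2 ^ (J + 1) * s := by
    have h1 : powSum J v 1 = 0 := by simpa [powSum] using hv0
    have h2 := (hδall _ (hmem 1 h1mem)).1.1.2
    rw [norm_pow, norm_norm] at h2
    have h3 : ‖s • (1 : β → ℝ)‖ ^ (J + 1) ≤ (2 * s) ^ (J + 1) :=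
      pow_le_pow_left₀ (norm_nonneg _) (hnorm 1 h1mem) _
    simp only [hH, h1, add_zero]
    rw [norm_smul, norm_inv, Real.norm_of_nonneg hsJ.le, inv_mul_le_iff₀ hsJ]
    calc _ ≤ C₁ * (2 * s) ^ (J + 1) := h2.trans (mul_le_mul_of_nonneg_left h3 hC₁pos.le)
      _ = _ := by rw [mul_pow]; ring
  obtain ⟨y, hy, hy0⟩ : (0 : E) ∈ H '' closedBall 1 ρ := by
    refine hHapp.surjOn_closedBall_of_nonlinearRightInverse B hρpos.le subset_rfl ?_
    rw [mem_closedBall, dist_zero_left]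
    refine (hH1.trans hs1).trans (le_of_eq ?_)
    rw [hc]
    push_cast
    ring
  have hsy := hδall _ (hmem y hy)
  -- Division by `s ^ (J - 1)`, the homogeneity of the derivative of the power sum, brings the
  -- operator within `ε` of `A`; this serves both `R'` and `Q`.
  have hQsurj : ∀ L : (β → ℝ) →L[ℝ] E, (s ^ (J - 1))⁻¹ * ‖L‖ < ε / 2 →
      Function.Surjective (L + powSumDeriv J v (s • y)) := fun L hL => by
    have h1 : (s ^ (J - 1))⁻¹ • L + powSumDeriv J v y ∈ ball A ε := by
      rw [mem_ball, dist_eq_norm]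
      have h2 := (hsub y hy).1
      rw [dist_eq_norm] at h2
      have h3 : ‖(s ^ (J - 1))⁻¹ • L‖ < ε / 2 := by
        rwa [norm_smul, norm_inv, Real.norm_of_nonneg (by positivity : 0 ≤ s ^ (J - 1))]
      rw [add_sub_assoc]
      exact (norm_add_le _ _).trans_lt (by linarith)
    have h2 := hsurj _ h1
    intro x
    obtain ⟨w, hw⟩ := h2 ((s ^ (J - 1))⁻¹ • x)
    refine ⟨w, ?_⟩
    have hne : s ^ (J - 1) ≠ 0 := by positivity
    have h3 : (s ^ (J - 1)) • (((s ^ (J - 1))⁻¹ • L + powSumDeriv J v y) w) = x := by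
      rw [hw, smul_inv_smul₀ hne]
    rw [powSumDeriv_smul, ← h3]
    simp [smul_smul, hne]
  refine ⟨s • y, hsy.2, fun b => ?_, ?_, hQsurj _ ?_, hQsurj _ ?_⟩
  · have h1 : dist (y b) 1 ≤ ρ := (dist_le_pi_dist y 1 b).trans (mem_closedBall.1 hy)
    have h2 : ρ ≤ 1 / 2 := min_le_right _ _
    rw [Real.dist_eq] at h1
    have := (abs_le.1 h1).1
    exact mul_pos hs (by linarith)
  · rw [powSum_smul]
    have h1 : s ^ J • H y = 0 := by rw [hy0, smul_zero]
    rwa [hH, smul_add, smul_inv_smul₀ hsJ.ne'] at h1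
  · exact (hscale y hy hC₂pos hsy.1.2.1).trans_lt hs3
  · exact (hscale y hy hC₃pos hsy.1.2.2).trans_lt hs4

theorem isBigO_comp_continuousLinearMap {α X Y Z : Type*} [NormedAddCommGroup X] [NormedSpace ℝ X]
    [NormedAddCommGroup Y] [NormedSpace ℝ Y] [NormedAddCommGroup Z] [NormedSpace ℝ Z]
    (A : α → Y →L[ℝ] Z) (B : α → X →L[ℝ] Y) (l : Filter α) :
    (fun a => (A a).comp (B a)) =O[l] fun a => ‖A a‖ * ‖B a‖ :=
  IsBigO.of_bound 1 (.of_forall fun a => by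
    rw [one_mul, norm_mul, norm_norm, norm_norm]; exact ContinuousLinearMap.opNorm_comp_le _ _)

theorem eventually_hasFDerivAt {X Y : Type*} [NormedAddCommGroup X] [NormedSpace ℝ X]
    [NormedAddCommGroup Y] [NormedSpace ℝ Y] {f : X → Y} {x : X} (hf : ContDiffAt ℝ ∞ f x) :
    ∀ᶠ y in 𝓝 x, HasFDerivAt f (fderiv ℝ f y) y :=
  ((hf.of_le (m := ((1 : ℕ) : ℕ∞ω)) (by exact_mod_cast le_top)).eventually (by simp)).mono
    fun _ hy => (hy.differentiableAt (by norm_num)).hasFDerivAt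

/-- The differential of `g ∘ T` is that of the power sum plus that of the remainder, and its
surjectivity forces surjectivity of the differential of `g` at `T σ`. At a return the derivative of
the coordinate change `ψ` is exactly `L`, so `L⁻¹ ∘ dP ∘ dT`, with `P` the Taylor polynomial of `ψ ∘
g`, is also a perturbation of the derivative of the power sum, of order `‖σ‖ ^ m` with `m ≥ J`
besides the remainder. One choice of `σ` serves both. -/
theorem frequently_return [FiniteDimensional ℝ E] {N : ℕ} {g : (Fin N → ℝ) → E}
    (hg : ContDiffAt ℝ ∞ g 0) {T : (β → ℝ) → Fin N → ℝ} (hT : ContDiffAt ℝ ∞ T 0) (hT0 : T 0 = 0)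
    (hpos : ∀ᶠ σ in 𝓝 0, (∀ b, 0 < σ b) → ∀ i, 0 < T σ i) {J : ℕ} (hJ : 0 < J) {v : β → E}
    (hv0 : ∑ b, v b = 0) (hv : Submodule.span ℝ (Set.range v) = ⊤)
    (hO : (fun σ => g (T σ) - g 0 - powSum J v σ) =O[𝓝 0] fun σ => ‖σ‖ ^ (J + 1))
    {ψ : E → E} {L : E ≃L[ℝ] E} (hψ : ContDiffAt ℝ ∞ ψ (g 0))
    (hL : HasFDerivAt ψ (L : E →L[ℝ] E) (g 0)) {m : ℕ} (hm : J ≤ m) :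
    ∃ᶠ t in 𝓝 0, (∀ i, 0 < t i) ∧ g t = g 0 ∧ Function.Surjective (fderiv ℝ g t) ∧
      Function.Surjective (fderiv ℝ
        (fun x => ∑ i ∈ Finset.range (m + 1), taylorTerm (fun y => ψ (g y)) i x) t) := by
  have := FiniteDimensional.complete ℝ E
  have hTt : Tendsto T (𝓝 0) (𝓝 0) := by simpa [hT0] using hT.continuousAt.tendsto
  have hgT : ContDiffAt ℝ ∞ (fun σ => g (T σ)) 0 := ContDiffAt.comp 0 (by rwa [hT0]) hT
  have hψg : ContDiffAt ℝ ∞ (fun y => ψ (g y)) 0 := ContDiffAt.comp 0 hψ hg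
  set R : (β → ℝ) → E := fun σ => g (T σ) - g 0 - powSum J v σ with hRdef
  have hR : ContDiffAt ℝ ∞ R 0 :=
    (hgT.sub contDiffAt_const).sub (contDiff_powSum J v).contDiffAt
  have hR'O := fderiv_isBigO hR hO
  have hTay := fderiv_sub_sum_taylorTerm_isBigO hψg m
  set P : (Fin N → ℝ) → E :=
    fun x => ∑ i ∈ Finset.range (m + 1), taylorTerm (fun y => ψ (g y)) i x with hP
  have hTO : T =O[𝓝 0] fun σ => ‖σ‖ := by
    have h1 := (hT.differentiableAt (by simp)).isBigO_sub
    simpa [hT0] using h1.norm_right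
  have hT'O : fderiv ℝ T =O[𝓝 0] fun _ => (1 : ℝ) :=
    ((hT.of_le (m := 1) (by exact_mod_cast le_top)).fderiv_right
      (m := 0) (by norm_num)).continuousAt.isBigO_one ℝ
  have hpow : (fun σ : β → ℝ => ‖σ‖ ^ m) =O[𝓝 0] fun σ => ‖σ‖ ^ J := by
    refine IsBigO.of_bound 1 ?_
    filter_upwards [Metric.ball_mem_nhds (0 : β → ℝ) one_pos] with x hx
    rw [one_mul, Real.norm_of_nonneg (by positivity), Real.norm_of_nonneg (by positivity)]
    exact pow_le_pow_of_le_one (norm_nonneg _) (mem_ball_zero_iff.1 hx).le hm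
  have hK : (fun σ => fderiv ℝ P (T σ) - fderiv ℝ (fun y => ψ (g y)) (T σ)) =O[𝓝 0]
      fun σ => ‖σ‖ ^ J :=
    (((hTay.comp_tendsto hTt).trans (hTO.norm_left.pow m)).trans hpow).neg_left.congr_left
      fun σ => by simp [P]
  set Q : (β → ℝ) → (β → ℝ) →L[ℝ] E := fun σ => (L.symm : E →L[ℝ] E).comp
    ((fderiv ℝ P (T σ) - fderiv ℝ (fun y => ψ (g y)) (T σ)).comp (fderiv ℝ T σ)) + fderiv ℝ R σ
    with hQdef
  have hQ : Q =O[𝓝 0] fun σ => ‖σ‖ ^ J := by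
    refine IsBigO.add ?_ hR'O
    have h1 : (fun σ => (fderiv ℝ P (T σ) - fderiv ℝ (fun y => ψ (g y)) (T σ)).comp
        (fderiv ℝ T σ)) =O[𝓝 0] fun σ => ‖σ‖ ^ J :=
      (isBigO_comp_continuousLinearMap _ _ _).trans (by
        simpa using hK.norm_left.mul hT'O.norm_left)
    refine (isBigO_comp_continuousLinearMap (fun _ => (L.symm : E →L[ℝ] E)) _ _).trans ?_
    exact (h1.norm_left.const_mul_left _)
  have key := frequently_powSum_eq hJ hv0 hv (eventually_hasFDerivAt hR) hO hR'O hQ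
  have hev := ((eventually_hasFDerivAt hT).and (hTt.eventually (eventually_hasFDerivAt hg))).and hpos
  refine hTt.frequently ((key.and_eventually hev).mono ?_)
  rintro σ ⟨⟨hσ, h0, hs1, hs2⟩, ⟨h1, h2⟩, h3⟩
  have hret : g (T σ) = g 0 := by
    have : g (T σ) - g 0 = 0 := by rw [← h0, hRdef]; exact (sub_add_cancel _ _).symm
    exact sub_eq_zero.1 this
  have h4 : fderiv ℝ R σ + powSumDeriv J v σ = (fderiv ℝ g (T σ)).comp (fderiv ℝ T σ) := by
    have h5 : HasFDerivAt R ((fderiv ℝ g (T σ)).comp (fderiv ℝ T σ) - powSumDeriv J v σ) σ :=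
      ((h2.comp σ h1).sub_const _).sub (hasFDerivAt_powSum J v σ)
    rw [h5.fderiv]; abel
  have h6 : fderiv ℝ (fun y => ψ (g y)) (T σ) = (L : E →L[ℝ] E).comp (fderiv ℝ g (T σ)) := by
    rw [← hret] at hL
    exact (hL.comp (T σ) h2).fderiv
  have h7 : Q σ + powSumDeriv J v σ =
      (L.symm : E →L[ℝ] E).comp ((fderiv ℝ P (T σ)).comp (fderiv ℝ T σ)) := by
    rw [hQdef, add_assoc, h4, h6]
    ext w
    simp
  rw [h4] at hs1
  rw [h7] at hs2
  refine ⟨h3 hσ, hret, fun x => ?_, fun x => ?_⟩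
  · obtain ⟨w, hw⟩ := hs1 x
    exact ⟨_, hw⟩
  · obtain ⟨w, hw⟩ := hs2 (L.symm x)
    exact ⟨_, L.symm.injective hw⟩

end Solve

end

noncomputable section

open Asymptotics Filter Metric

/-! ### Cutoffs, local flows and time changes. -/

section Cutoff

theorem exists_contDiff_eventuallyEq {V W : Type*} [NormedAddCommGroup V] [NormedSpace ℝ V]
    [HasContDiffBump V] [NormedAddCommGroup W] [NormedSpace ℝ W] [FiniteDimensional ℝ V] {f : V → W}
    {x₀ : V} (hf : ∀ᶠ x in 𝓝 x₀, ContDiffAt ℝ ∞ f x) : ∃ g : V → W, ContDiff ℝ ∞ g ∧ g =ᶠ[𝓝 x₀] f := by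
  obtain ⟨δ, hδ, h⟩ := Metric.eventually_nhds_iff_ball.1 hf
  let χ : ContDiffBump x₀ := ⟨δ / 3, δ / 2, by positivity, by linarith⟩
  refine ⟨fun x => χ x • f x, contDiff_iff_contDiffAt.2 fun x => ?_, ?_⟩
  · by_cases hx : x ∈ ball x₀ δ
    · exact χ.contDiffAt.smul (h x hx)
    · have hx' : x ∈ (closedBall x₀ (δ / 2))ᶜ := fun h' => hx <| mem_ball.2 <|
        (mem_closedBall.1 h').trans_lt (by linarith)
      refine (contDiffAt_const (c := (0 : W))).congr_of_eventuallyEq ?_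
      filter_upwards [isClosed_closedBall.isOpen_compl.mem_nhds hx'] with y hy
      rw [χ.zero_of_le_dist (le_of_lt (by simpa using hy)), zero_smul]
  · filter_upwards [χ.eventuallyEq_one] with x hx
    rw [hx]; simp

end Cutoff

variable {E : Type} [NormedAddCommGroup E] [NormedSpace ℝ E]

/-- `Φ` is a smooth local flow of the vector field `X` near time `0` and the point `q`. -/
structure IsLocalFlow (X : E → E) (q : E) (Φ : ℝ × E → E) : Prop where
  smooth : ∀ᶠ p in 𝓝 (0, q), ContDiffAt ℝ ∞ Φ p
  init : ∀ᶠ x in 𝓝 q, Φ (0, x) = x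
  deriv : ∀ᶠ p in 𝓝 (0, q), HasDerivAt (fun s => Φ (s, p.2)) (X (Φ p)) p.1

/-- `θ` is a smooth local time reparametrization near time `0` and the point `q`. -/
structure IsLocalTime (q : E) (θ : ℝ × E → ℝ) : Prop where
  smooth : ∀ᶠ p in 𝓝 (0, q), ContDiffAt ℝ ∞ θ p
  init : ∀ᶠ x in 𝓝 q, θ (0, x) = 0
  pos : ∀ᶠ p in 𝓝 (0, q), 0 < p.1 → 0 < θ p

theorem IsLocalFlow.apply_zero {X : E → E} {q : E} {Φ : ℝ × E → E} (h : IsLocalFlow X q Φ) :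
    Φ (0, q) = q := h.init.self_of_nhds

theorem IsLocalFlow.tendsto {X : E → E} {q : E} {Φ : ℝ × E → E} (h : IsLocalFlow X q Φ) :
    Tendsto Φ (𝓝 (0, q)) (𝓝 q) := by
  have := h.smooth.self_of_nhds.continuousAt.tendsto
  rwa [h.apply_zero] at this

theorem eventually_prod_box {P : ℝ × E → Prop} {q : E} (h : ∀ᶠ p in 𝓝 ((0 : ℝ), q), P p) :
    ∃ δ > 0, ∀ s x, |s| < δ → dist x q < δ → P (s, x) := by
  obtain ⟨δ, hδ, h⟩ := Metric.eventually_nhds_iff_ball.1 h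
  exact ⟨δ, hδ, fun s x hs hx => h _ (by
    rw [mem_ball, Prod.dist_eq, max_lt_iff, dist_zero_right]; exact ⟨hs, hx⟩)⟩

theorem eventually_of_prod_box {P : ℝ × E → Prop} {q : E} {δ : ℝ} (hδ : 0 < δ)
    (h : ∀ s x, |s| < δ → dist x q < δ → P (s, x)) : ∀ᶠ p in 𝓝 ((0 : ℝ), q), P p :=
  Metric.eventually_nhds_iff_ball.2 ⟨δ, hδ, fun p hp => by
    rw [mem_ball, Prod.dist_eq, max_lt_iff, dist_zero_right] at hp
    exact h p.1 p.2 hp.1 hp.2⟩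

/-- The time change solves `θ' = a(Φ(θ, x))`, `θ(0) = 0`; then `Φ(θ(s, x), x)` has velocity `a X`.
Since `a` is positive near `q`, `θ` increases with time. -/
theorem exists_isLocalTime [FiniteDimensional ℝ E] {X : E → E} {q : E} {Φ : ℝ × E → E}
    (hΦ : IsLocalFlow X q Φ) {a : E → ℝ} (ha : ContDiff ℝ ∞ a) (haq : 0 < a q) :
    ∃ θ : ℝ × E → ℝ, IsLocalTime q θ ∧
      IsLocalFlow (fun x => a x • X x) q (fun p => Φ (θ p, p.2)) := by
  have := FiniteDimensional.complete ℝ E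
  have hswap : Tendsto (fun z : E × ℝ => (z.2, z.1)) (𝓝 (q, 0)) (𝓝 (0, q)) :=
    (continuous_snd.prodMk continuous_fst).tendsto' _ _ rfl
  have hsm : ∀ᶠ z : E × ℝ in 𝓝 (q, 0), ContDiffAt ℝ ∞ (fun z : E × ℝ => a (Φ (z.2, z.1))) z :=
    (hswap.eventually hΦ.smooth).mono fun z hz =>
      ha.contDiffAt.comp z (ContDiffAt.comp (f := fun z : E × ℝ => (z.2, z.1)) z hz
        (contDiffAt_snd.prodMk contDiffAt_fst))
  obtain ⟨A, hA, hAeq⟩ := exists_contDiff_eventuallyEq hsm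
  -- The initial point is carried along as a constant coordinate, so that smooth dependence on it
  -- comes from the flow theorem on `E × ℝ`.
  obtain ⟨Ψ, hΨ, hΨd⟩ := exists_contDiffAt_flow (F := E × ℝ) (f := fun z => (0, A z))
    (contDiff_const.prodMk hA) (q, 0)
  have hΨ0 : Ψ (0, (q, 0)) = (q, 0) := hΨd.self_of_nhds.1
  have hemb : Continuous fun p : ℝ × E => ((p.1, (p.2, 0)) : ℝ × E × ℝ) := by fun_prop
  have hemb' : Tendsto (fun p : ℝ × E => ((p.1, (p.2, 0)) : ℝ × E × ℝ)) (𝓝 (0, q))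
    (𝓝 (0, (q, 0))) := hemb.tendsto' _ _ rfl
  have hΨt : Tendsto (fun p : ℝ × E => Ψ (p.1, (p.2, 0))) (𝓝 (0, q)) (𝓝 (q, 0)) := by
    have := hΨ.self_of_nhds.continuousAt.tendsto
    rw [hΨ0] at this
    exact this.comp hemb'
  set θ : ℝ × E → ℝ := fun p => (Ψ (p.1, (p.2, 0))).2 with hθ
  have hθs : ∀ᶠ p in 𝓝 (0, q), ContDiffAt ℝ ∞ θ p :=
    (hemb'.eventually hΨ).mono fun p hp => contDiffAt_snd.comp p
      (ContDiffAt.comp (f := fun p : ℝ × E => ((p.1, (p.2, 0)) : ℝ × E × ℝ)) p hp (by fun_prop))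
  have hθ0 : ∀ᶠ x in 𝓝 q, θ (0, x) = 0 := by
    have h1 : Tendsto (fun x : E => ((0 : ℝ), x)) (𝓝 q) (𝓝 (0, q)) :=
      (by fun_prop : Continuous fun x : E => ((0 : ℝ), x)).tendsto' _ _ rfl
    filter_upwards [h1.eventually (hemb'.eventually hΨd)] with x hx
    simp only [hθ]
    rw [hx.1]
  have hθq : θ (0, q) = 0 := hθ0.self_of_nhds
  have hθt : Tendsto θ (𝓝 (0, q)) (𝓝 0) := by
    have := hθs.self_of_nhds.continuousAt.tendsto
    rwa [hθq] at this
  have hfst : ∀ᶠ p in 𝓝 ((0 : ℝ), q), (Ψ (p.1, (p.2, 0))).1 = p.2 := by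
    obtain ⟨δ, hδ, h⟩ := eventually_prod_box (hemb'.eventually hΨd)
    refine eventually_of_prod_box hδ fun s x hs hx => ?_
    have hd : ∀ r ∈ ball (0 : ℝ) δ, HasDerivAt (fun r => (Ψ (r, (x, 0))).1) 0 r := fun r hr => by
      have h1 := (h r x (by simpa using hr) hx).2
      exact (hasFDerivAt_fst.comp_hasDerivAt r h1)
    have h2 := (convex_ball (0 : ℝ) δ).is_const_of_fderivWithin_eq_zero (𝕜 := ℝ)
      (f := fun r => (Ψ (r, (x, 0))).1)
      (fun r hr => (hd r hr).differentiableAt.differentiableWithinAt)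
      (fun r hr => by
        rw [fderivWithin_of_isOpen isOpen_ball hr]
        ext; simp [(hd r hr).deriv])
      (show s ∈ ball (0 : ℝ) δ by simpa using hs) (mem_ball_self hδ)
    have h3 := (h 0 x (by simpa using hδ) hx).1
    simp only at h2 h3 ⊢
    rw [h2, h3]
  have hθd : ∀ᶠ p in 𝓝 ((0 : ℝ), q), HasDerivAt (fun s => θ (s, p.2)) (a (Φ (θ p, p.2))) p.1 := by
    filter_upwards [hemb'.eventually hΨd, hΨt.eventually hAeq, hfst] with p hp h1 h2
    have h3 := hasFDerivAt_snd.comp_hasDerivAt p.1 hp.2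
    simp only [h2] at h1
    rw [h1] at h3
    exact h3
  have hg : Tendsto (fun p : ℝ × E => (θ p, p.2)) (𝓝 (0, q)) (𝓝 (0, q)) :=
    hθt.prodMk_nhds (continuous_snd.tendsto' _ _ rfl)
  refine ⟨θ, ⟨hθs, hθ0, ?_⟩, ?_, ?_, ?_⟩
  · have h1 : ∀ᶠ p in 𝓝 ((0 : ℝ), q), 0 < a (Φ (θ p, p.2)) :=
      ((ha.continuous.tendsto q).comp (hΦ.tendsto.comp hg)).eventually_const_lt haq
    have h2 : ∀ᶠ p in 𝓝 ((0 : ℝ), q), θ (0, p.2) = 0 :=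
      (continuous_snd.tendsto' ((0 : ℝ), q) q rfl).eventually hθ0
    obtain ⟨δ, hδ, h⟩ := eventually_prod_box ((hθd.and h1).and h2)
    refine eventually_of_prod_box hδ fun s x hs hx hs0 => ?_
    have hmem : ∀ r ∈ Set.Icc 0 s, |r| < δ := fun r hr => by
      rw [abs_of_nonneg hr.1]; exact hr.2.trans_lt ((le_abs_self s).trans_lt hs)
    have hmono : StrictMonoOn (fun r => θ (r, x)) (Set.Icc 0 s) := by
      refine strictMonoOn_of_deriv_pos (convex_Icc _ _) (fun r hr =>
        (h r x (hmem r hr) hx).1.1.continuousAt.continuousWithinAt) fun r hr => ?_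
      have hr' := h r x (hmem r (interior_subset hr)) hx
      rw [hr'.1.1.deriv]
      exact hr'.1.2
    have := hmono (Set.left_mem_Icc.2 hs0.le) (Set.right_mem_Icc.2 hs0.le) hs0
    simpa [(h s x hs hx).2] using this
  · filter_upwards [hg.eventually hΦ.smooth, hθs] with p h1 h2
    exact ContDiffAt.comp (f := fun p : ℝ × E => (θ p, p.2)) p h1 (h2.prodMk contDiffAt_snd)
  · filter_upwards [hΦ.init, hθ0] with x h1 h2
    rw [h2, h1]
  · filter_upwards [hg.eventually hΦ.deriv, hθd] with p h1 h2
    exact HasDerivAt.scomp p.1 h1 h2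

end

noncomputable section

open Asymptotics Filter Metric

/-! ### Vector fields as derivations and asymptotic expansions of products of flows. -/

section Operators

variable (E : Type) [NormedAddCommGroup E] [NormedSpace ℝ E]

/-- The space of smooth maps from `E` to itself. -/
def smoothMaps : Submodule ℝ (E → E) where
  carrier := {f | ContDiff ℝ ∞ f}
  add_mem' {f g} (hf : ContDiff ℝ ∞ f) (hg : ContDiff ℝ ∞ g) := hf.add hg
  zero_mem' := show ContDiff ℝ ∞ (0 : E → E) from contDiff_const
  smul_mem' _ f (hf : ContDiff ℝ ∞ f) := contDiff_const.smul hf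

variable {E}

theorem contDiff_smoothMaps (f : smoothMaps E) : ContDiff ℝ ∞ (f : E → E) := f.2

theorem differentiable_smoothMaps (f : smoothMaps E) : Differentiable ℝ (f : E → E) :=
  (contDiff_smoothMaps f).differentiable (by simp)

/-- The derivation of the space of smooth maps which is defined by a smooth vector field. -/
def lieDer : smoothMaps E →ₗ[ℝ] Module.End ℝ (smoothMaps E) :=
  LinearMap.mk₂ ℝ
    (fun Y f => ⟨fun x => fderiv ℝ (f : E → E) x ((Y : E → E) x),
      ((contDiff_smoothMaps f).fderiv_right (m := ∞) (by simp)).clm_apply (contDiff_smoothMaps Y)⟩)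
    (fun Y Y' f => Subtype.ext <| funext fun x => map_add _ _ _)
    (fun c Y f => Subtype.ext <| funext fun x => map_smul _ _ _)
    (fun Y f g => Subtype.ext <| funext fun x => by
      change fderiv ℝ ((f : E → E) + (g : E → E)) x _ = _
      rw [fderiv_add (differentiable_smoothMaps f x) (differentiable_smoothMaps g x)]
      rfl)
    (fun c Y f => Subtype.ext <| funext fun x => by
      change fderiv ℝ (c • (f : E → E)) x _ = _
      rw [fderiv_const_smul (differentiable_smoothMaps f x)]
      rfl)

theorem lieDer_apply (Y f : smoothMaps E) (x : E) :
    (lieDer Y f : E → E) x = fderiv ℝ (f : E → E) x ((Y : E → E) x) := rfl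

/-- The identity map, as a smooth map. -/
def smoothMaps.id : smoothMaps E := ⟨fun x => x, show ContDiff ℝ ∞ fun x : E => x from contDiff_fun_id⟩

end Operators

section Expansion

variable {E : Type} [NormedAddCommGroup E] [NormedSpace ℝ E]

/-- The time derivative of the error of order `r + 1` for `f` is the error of order `r` for the
derivative of `f` along `Y`, so one integration in time gains one order. The estimate is uniform in
the initial point, as is needed for compositions. -/
theorem IsLocalFlow.comp_sub_sum_isBigO {Y : smoothMaps E} {q : E} {Φ : ℝ × E → E}
    (hΦ : IsLocalFlow Y q Φ) (r : ℕ) (f : smoothMaps E) :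
    (fun p : ℝ × E => (f : E → E) (Φ p) -
      ∑ k ∈ Finset.range r, (p.1 ^ k / k !) • ((lieDer Y ^ k) f : E → E) p.2) =O[𝓝 (0, q)]
      fun p => p.1 ^ r := by
  induction r generalizing f with
  | zero =>
    simpa using (((contDiff_smoothMaps f).continuous.tendsto q).comp hΦ.tendsto).isBigO_one ℝ
  | succ r ih =>
    obtain ⟨C, hCpos, hC⟩ := (ih (lieDer Y f)).exists_pos
    have hinit : ∀ᶠ p in 𝓝 ((0 : ℝ), q), Φ (0, p.2) = p.2 :=
      (continuous_snd.tendsto' ((0 : ℝ), q) q rfl).eventually hΦ.init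
    obtain ⟨δ, hδ, h⟩ := eventually_prod_box ((hC.bound.and hΦ.deriv).and hinit)
    refine IsBigO.of_bound C (eventually_of_prod_box hδ fun s x hs hx => ?_)
    set H : ℝ → E := fun s => (f : E → E) (Φ (s, x)) -
      ∑ k ∈ Finset.range (r + 1), (s ^ k / k !) • ((lieDer Y ^ k) f : E → E) x with hH
    have hd : ∀ t ∈ Set.uIcc 0 s, HasDerivWithinAt H ((lieDer Y f : E → E) (Φ (t, x)) -
        ∑ k ∈ Finset.range r, (t ^ k / k !) • ((lieDer Y ^ k) (lieDer Y f) : E → E) x)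
        (Set.uIcc 0 s) t := fun t ht => by
      have ht' : |t| < δ := by
        have := Set.abs_sub_left_of_mem_uIcc ht
        simp only [sub_zero] at this
        exact this.trans_lt hs
      refine HasDerivAt.hasDerivWithinAt (HasDerivAt.sub ?_ ?_)
      · exact (differentiable_smoothMaps f _).hasFDerivAt.comp_hasDerivAt t (h t x ht' hx).1.2
      · have h1 : HasDerivAt (fun t : ℝ => ∑ k ∈ Finset.range r, (t ^ (k + 1) / (k + 1) !) •
            ((lieDer Y ^ (k + 1)) f : E → E) x)
            (∑ k ∈ Finset.range r, (t ^ k / k !) • ((lieDer Y ^ k) (lieDer Y f) : E → E) x) t := by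
          refine HasDerivAt.fun_sum fun k _ => ?_
          have h2 : HasDerivAt (fun t : ℝ => t ^ (k + 1) / (k + 1) !) (t ^ k / k !) t := by
            refine ((hasDerivAt_pow (k + 1) t).div_const _).congr_deriv ?_
            rw [Nat.factorial_succ]
            push_cast
            have : (k ! : ℝ) ≠ 0 := by positivity
            have : (k + 1 : ℝ) ≠ 0 := by positivity
            field_simp
          have h3 : (lieDer Y ^ k) (lieDer Y f) = (lieDer Y ^ (k + 1)) f := by
            rw [pow_succ]; rfl
          rw [h3]
          exact h2.smul_const _
        refine (h1.add_const ((f : E → E) x)).congr_of_eventuallyEq (.of_forall fun t => ?_)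
        simp [Finset.sum_range_succ']
    have hmv := (convex_uIcc 0 s).norm_image_sub_le_of_norm_hasDerivWithin_le (C := C * |s| ^ r)
      hd (fun t ht => by
        have ht2 : |t| ≤ |s| := by
          have := Set.abs_sub_left_of_mem_uIcc ht
          simpa using this
        have h4 := (h t x (ht2.trans_lt hs) hx).1.1
        refine h4.trans ?_
        rw [norm_pow]
        exact mul_le_mul_of_nonneg_left (pow_le_pow_left₀ (norm_nonneg _) ht2 _) hCpos.le)
      (Set.left_mem_uIcc) (Set.right_mem_uIcc)
    have hH0 : H 0 = 0 := by
      simp [hH, Finset.sum_range_succ', (h s x hs hx).2]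
    rw [hH0, sub_zero, sub_zero] at hmv
    rw [norm_pow, pow_succ, ← mul_assoc]
    exact hmv

variable {ι : Type*}

/-- The product of flows along a list of letters with times that depend on parameters. -/
def wordFlow {S : Type*} (φ' : ι → ℝ × E → E) : List (ι × (S → ℝ)) → S → E → E
  | [], _, x => x
  | p :: w, σ, x => wordFlow φ' w σ (φ' p.1 (p.2 σ, x))

theorem wordFlow_append {S : Type*} (φ' : ι → ℝ × E → E) (w w' : List (ι × (S → ℝ))) (σ : S) (x : E) :
    wordFlow φ' (w ++ w') σ x = wordFlow φ' w' σ (wordFlow φ' w σ x) := by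
  induction w generalizing x with
  | nil => rfl
  | cons p w ih => exact ih _

theorem wordFlow_comp {S S' : Type*} (φ' : ι → ℝ × E → E) (w : List (ι × (S → ℝ))) (τ : S' → S)
    (σ : S') (x : E) :
    wordFlow φ' (w.map fun p => (p.1, p.2 ∘ τ)) σ x = wordFlow φ' w (τ σ) x := by
  induction w generalizing x with
  | nil => rfl
  | cons p w ih => exact ih _

/-- The one-parameter word whose letters have times proportional to the parameter. -/
def linWord (w : List (ι × ℝ)) : List (ι × (ℝ → ℝ)) := w.map fun p => (p.1, fun s => p.2 * s)

open PowerSeries Finset.HasAntidiagonal in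
-- The flow of the first letter moves the point first, so its exponential stands leftmost in the
-- operator product. Substituting that flow into the expansion of the remaining word and expanding
-- each coefficient of degree `k` to order `r - k` multiplies the two series.
theorem wordFlow_sub_sum_isBigO {Y : ι → smoothMaps E} {q : E} {Φ : ι → ℝ × E → E}
    (hΦ : ∀ i, IsLocalFlow (Y i) q (Φ i)) (w : List (ι × ℝ)) (f : smoothMaps E) (r : ℕ) :
    (fun p : ℝ × E => (f : E → E) (wordFlow Φ (linWord w) p.1 p.2) - ∑ k ∈ Finset.range r,
      p.1 ^ k • (coeff k (wordSeries (fun i => lieDer (Y i)) w) f : E → E) p.2) =O[𝓝 (0, q)]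
      fun p => p.1 ^ r := by
  induction w with
  | nil =>
    cases r with
    | zero =>
      simpa [linWord, wordFlow] using
        (((contDiff_smoothMaps f).continuous.tendsto q).comp
          (continuous_snd.tendsto' ((0 : ℝ), q) q rfl)).isBigO_one ℝ
    | succ r =>
      refine (isBigO_zero _ _).congr_left fun p => ?_
      rw [Finset.sum_range_succ', Finset.sum_eq_zero]
      · simp [linWord, wordFlow, wordSeries]
      · intro k _
        simp [wordSeries, coeff_one]
  | cons a w ih =>
    obtain ⟨i, c⟩ := a
    set D : ι → Module.End ℝ (smoothMaps E) := fun i => lieDer (Y i) with hD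
    have hin : Tendsto (fun p : ℝ × E => (c * p.1, p.2)) (𝓝 (0, q)) (𝓝 (0, q)) :=
      (by fun_prop : Continuous fun p : ℝ × E => (c * p.1, p.2)).tendsto' _ _ (by simp)
    have hout : Tendsto (fun p : ℝ × E => (p.1, Φ i (c * p.1, p.2))) (𝓝 (0, q)) (𝓝 (0, q)) :=
      (continuous_fst.tendsto' (0, q) 0 rfl).prodMk_nhds ((hΦ i).tendsto.comp hin)
    have h1 := ih.comp_tendsto hout
    have h2 : (fun p : ℝ × E => ∑ k ∈ Finset.range r, p.1 ^ k •
        ((coeff k (wordSeries D w) f : E → E) (Φ i (c * p.1, p.2)) -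
          ∑ l ∈ Finset.range (r - k), ((c * p.1) ^ l / l !) •
            ((D i ^ l) (coeff k (wordSeries D w) f) : E → E) p.2)) =O[𝓝 (0, q)]
        fun p => p.1 ^ r := by
      refine IsBigO.fun_sum fun k hk => ?_
      have h3 := ((hΦ i).comp_sub_sum_isBigO (r - k) (coeff k (wordSeries D w) f)).comp_tendsto hin
      have h4 : (fun p : ℝ × E => (c * p.1) ^ (r - k)) =O[𝓝 (0, q)] fun p => p.1 ^ (r - k) := by
        simp only [mul_pow]
        exact isBigO_const_mul_self _ _ _
      refine ((isBigO_refl (fun p : ℝ × E => p.1 ^ k) _).smul (h3.trans h4)).congr_right fun p => ?_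
      rw [smul_eq_mul, ← pow_add, Nat.add_sub_cancel' (Finset.mem_range.1 hk).le]
    refine (h1.add h2).congr_left fun p => ?_
    change (f : E → E) (wordFlow Φ (linWord w) p.1 (Φ i (c * p.1, p.2))) - _ + _ =
      (f : E → E) (wordFlow Φ (linWord w) p.1 (Φ i (c * p.1, p.2))) - _
    have h5 : ∑ k ∈ Finset.range r, p.1 ^ k • (coeff k (wordSeries D ((i, c) :: w)) f : E → E) p.2 =
        ∑ k ∈ Finset.range r, p.1 ^ k • ∑ l ∈ Finset.range (r - k), ((c * p.1) ^ l / l !) •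
            ((D i ^ l) (coeff k (wordSeries D w) f) : E → E) p.2 := by
      simp only [Finset.smul_sum, smul_smul]
      -- The double sum is regrouped by total degree, which gives the Cauchy product.
      rw [← Finset.sum_range_diag_flip r (fun k l => (p.1 ^ k * ((c * p.1) ^ l / l !)) •
            ((D i ^ l) (coeff k (wordSeries D w) f) : E → E) p.2)]
      refine Finset.sum_congr rfl fun n _ => ?_
      rw [wordSeries_cons, coeff_mul, ← Finset.Nat.sum_antidiagonal_swap,
        Finset.Nat.sum_antidiagonal_eq_sum_range_succ_mk]
      simp only [LinearMap.sum_apply, Submodule.coe_sum, Finset.sum_apply, Finset.smul_sum]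
      refine Finset.sum_congr rfl fun k hk => ?_
      have hkn : k ≤ n := Nat.lt_succ_iff.1 (Finset.mem_range.1 hk)
      simp only [Prod.swap_prod_mk, expSeries, coeff_mk, Module.End.mul_apply,
        LinearMap.smul_apply, Submodule.coe_smul, Pi.smul_apply, smul_smul]
      congr 1
      rw [mul_pow, ← Nat.add_sub_cancel' hkn, pow_add, Nat.add_sub_cancel_left]
      ring
    rw [h5]
    simp only [smul_sub, Finset.sum_sub_distrib]
    simp
end Expansion

end

noncomputable section

open Asymptotics Filter Metric

/-! ### Products of flows with a prescribed leading displacement. -/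

section Products

variable {E : Type} [NormedAddCommGroup E] [NormedSpace ℝ E] {ι : Type*}

/-- The composition of the flows `Φ (c 0), Φ (c 1), ...`, as a function of the initial point and of
the times. -/
def flowProd (Φ : ι → ℝ × E → E) : {N : ℕ} → (Fin N → ι) → E → (Fin N → ℝ) → E
  | 0, _, x, _ => x
  | _ + 1, c, x, t => flowProd Φ (Fin.tail c) (Φ (c 0) (t 0, x)) (Fin.tail t)

theorem flowProd_zero {X : ι → E → E} {q : E} {Φ : ι → ℝ × E → E}
    (hΦ : ∀ i, IsLocalFlow (X i) q (Φ i)) : ∀ {N : ℕ} (c : Fin N → ι), flowProd Φ c q 0 = q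
  | 0, _ => rfl
  | _ + 1, c => by
    change flowProd Φ (Fin.tail c) (Φ (c 0) (0, q)) (0 : Fin _ → ℝ) = q
    rw [(hΦ _).apply_zero]
    exact flowProd_zero hΦ _

theorem contDiffAt_flowProd {X : ι → E → E} {q : E} {Φ : ι → ℝ × E → E}
    (hΦ : ∀ i, IsLocalFlow (X i) q (Φ i)) : ∀ {N : ℕ} (c : Fin N → ι),
      ContDiffAt ℝ ∞ (fun p : E × (Fin N → ℝ) => flowProd Φ c p.1 p.2) (q, 0)
  | 0, _ => contDiffAt_fst
  | N + 1, c => by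
    have h0 : ContDiffAt ℝ ∞ (fun p : E × (Fin (N + 1) → ℝ) => Φ (c 0) (p.2 0, p.1)) (q, 0) :=
      ContDiffAt.comp (f := fun p : E × (Fin (N + 1) → ℝ) => (p.2 0, p.1)) (q, 0)
        (hΦ (c 0)).smooth.self_of_nhds (by fun_prop)
    have h1 : ContDiffAt ℝ ∞ (fun p : E × (Fin (N + 1) → ℝ) =>
        (Φ (c 0) (p.2 0, p.1), Fin.tail p.2)) (q, 0) :=
      h0.prodMk (contDiffAt_pi.2 fun i => by unfold Fin.tail; fun_prop)
    refine ContDiffAt.comp (g := fun p : E × (Fin N → ℝ) => flowProd Φ (Fin.tail c) p.1 p.2)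
      (q, 0) ?_ h1
    convert contDiffAt_flowProd hΦ (Fin.tail c) using 2
    · exact (hΦ _).apply_zero
    · rfl

variable {S : Type*}

/-- The times of the flows `Φ` along the path described by a word of time changed flows. -/
def wordTimes (Φ : ι → ℝ × E → E) (θ : ι → ℝ × E → ℝ) :
    (W : List (ι × (S → ℝ))) → S → E → Fin W.length → ℝ
  | [], _, _ => Fin.elim0
  | p :: W, σ, x => Fin.cons (α := fun _ => ℝ) (θ p.1 (p.2 σ, x))
      (wordTimes Φ θ W σ (Φ p.1 (θ p.1 (p.2 σ, x), x)))

theorem flowProd_wordTimes (Φ : ι → ℝ × E → E) (θ : ι → ℝ × E → ℝ) :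
    ∀ (W : List (ι × (S → ℝ))) (σ : S) (x : E),
      flowProd Φ (fun k => (W.get k).1) x (wordTimes Φ θ W σ x) =
        wordFlow (fun i p => Φ i (θ i p, p.2)) W σ x
  | [], _, _ => rfl
  | _ :: W, σ, _ => flowProd_wordTimes Φ θ W σ _

variable [NormedAddCommGroup S] [NormedSpace ℝ S] {X Y : ι → E → E} {q : E} {Φ : ι → ℝ × E → E}
  {θ : ι → ℝ × E → ℝ}

theorem wordTimes_zero (hθ : ∀ i, IsLocalTime q (θ i)) (hΦ : ∀ i, IsLocalFlow (X i) q (Φ i)) :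
    ∀ (W : List (ι × (S → ℝ))), (∀ p ∈ W, p.2 0 = 0) → wordTimes Φ θ W 0 q = 0
  | [], _ => funext fun k => k.elim0
  | p :: W, h => by
    have h0 : θ p.1 (p.2 0, q) = 0 := by
      rw [h p List.mem_cons_self]; exact (hθ _).init.self_of_nhds
    change Fin.cons (α := fun _ => ℝ) (θ p.1 (p.2 0, q)) (wordTimes Φ θ W 0
      (Φ p.1 (θ p.1 (p.2 0, q), q))) = _
    rw [h0, (hΦ _).apply_zero, wordTimes_zero hθ hΦ W fun p hp => h p (List.mem_cons_of_mem _ hp)]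
    exact Fin.cons_self_tail (α := fun _ => ℝ) 0

theorem contDiffAt_wordTimes (hθ : ∀ i, IsLocalTime q (θ i))
    (hΦ : ∀ i, IsLocalFlow (X i) q (Φ i)) : ∀ (W : List (ι × (S → ℝ))),
      (∀ p ∈ W, p.2 0 = 0 ∧ ContDiff ℝ ∞ p.2) →
      ContDiffAt ℝ ∞ (fun z : S × E => wordTimes Φ θ W z.1 z.2) (0, q)
  | [], _ => contDiffAt_const
  | p :: W, h => by
    have hp := h p List.mem_cons_self
    have h0 : θ p.1 (p.2 0, q) = 0 := by
      rw [hp.1]; exact (hθ _).init.self_of_nhds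
    have h1 : ContDiffAt ℝ ∞ (fun z : S × E => (p.2 z.1, z.2)) (0, q) :=
      (hp.2.contDiffAt.comp _ contDiffAt_fst).prodMk contDiffAt_snd
    have h2 : ContDiffAt ℝ ∞ (fun z : S × E => θ p.1 (p.2 z.1, z.2)) (0, q) := by
      refine ContDiffAt.comp (g := θ p.1) _ ?_ h1
      simp only [hp.1]
      exact (hθ _).smooth.self_of_nhds
    have h3 : ContDiffAt ℝ ∞ (fun z : S × E => Φ p.1 (θ p.1 (p.2 z.1, z.2), z.2)) (0, q) := by
      refine ContDiffAt.comp (g := Φ p.1) _ ?_ (h2.prodMk contDiffAt_snd)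
      simp only [h0]
      exact (hΦ _).smooth.self_of_nhds
    have h4 : ContDiffAt ℝ ∞ (fun z : S × E => wordTimes Φ θ W z.1
        (Φ p.1 (θ p.1 (p.2 z.1, z.2), z.2))) (0, q) := by
      refine ContDiffAt.comp (g := fun z : S × E => wordTimes Φ θ W z.1 z.2) _ ?_
        (contDiffAt_fst.prodMk h3)
      simp only [h0, (hΦ _).apply_zero]
      exact contDiffAt_wordTimes hθ hΦ W fun p hp => h p (List.mem_cons_of_mem _ hp)
    refine contDiffAt_pi.2 fun k => ?_
    refine Fin.cases ?_ (fun k => ?_) k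
    · exact h2
    · exact (contDiffAt_pi.1 h4) k

theorem wordTimes_pos (hθ : ∀ i, IsLocalTime q (θ i)) (hΦ : ∀ i, IsLocalFlow (X i) q (Φ i))
    {P : S → Prop} : ∀ (W : List (ι × (S → ℝ))),
      (∀ p ∈ W, p.2 0 = 0 ∧ ContDiff ℝ ∞ p.2 ∧ ∀ σ, P σ → 0 < p.2 σ) →
      ∀ᶠ z in 𝓝 ((0 : S), q), P z.1 → ∀ k, 0 < wordTimes Φ θ W z.1 z.2 k
  | [], _ => .of_forall fun _ _ k => k.elim0
  | p :: W, h => by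
    have hp := h p List.mem_cons_self
    have h0 : θ p.1 (0, q) = 0 := (hθ _).init.self_of_nhds
    have h1 : Tendsto (fun z : S × E => (p.2 z.1, z.2)) (𝓝 (0, q)) (𝓝 (0, q)) :=
      ((hp.2.1.continuous.comp continuous_fst).prodMk continuous_snd).tendsto' _ _ (by simp [hp.1])
    have h2 : Tendsto (fun z : S × E => θ p.1 (p.2 z.1, z.2)) (𝓝 (0, q)) (𝓝 0) := by
      have := (hθ p.1).smooth.self_of_nhds.continuousAt.tendsto
      rw [h0] at this
      exact this.comp h1
    have h3 : Tendsto (fun z : S × E => (z.1, Φ p.1 (θ p.1 (p.2 z.1, z.2), z.2))) (𝓝 (0, q))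
        (𝓝 (0, q)) :=
      (continuous_fst.tendsto' _ _ rfl).prodMk_nhds
        ((hΦ _).tendsto.comp (h2.prodMk_nhds (continuous_snd.tendsto' _ _ rfl)))
    filter_upwards [h1.eventually (hθ p.1).pos,
      h3.eventually (wordTimes_pos hθ hΦ W fun p hp => h p (List.mem_cons_of_mem _ hp))]
      with z hz1 hz2 hP k
    refine Fin.cases ?_ (fun k => ?_) k
    · exact hz1 (hp.2.2 _ hP)
    · exact hz2 hP k

/-- The concatenation of words `w b`, with the parameter `σ b ^ e b` in the word `w b`. -/
def blockWord {β : Type*} (w : β → List (ι × ℝ)) (e : β → ℕ) (L : List β) :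
    List (ι × ((β → ℝ) → ℝ)) :=
  L.flatMap fun b => (linWord (w b)).map fun p => (p.1, p.2 ∘ fun σ => σ b ^ e b)

/-- When a block acts, the preceding ones have moved the point only by `O(‖σ‖)`. Replacing `V b`
there by its value at `q` costs `σ_b ^ J O(‖σ‖)`, so to leading order the displacements simply add.
-/
theorem wordFlow_blockWord_isBigO {β : Type*} [Fintype β] {w : β → List (ι × ℝ)} {e : β → ℕ}
    {J : ℕ} (hJ : 0 < J) {V : β → E → E} (hV : ∀ b, ContDiff ℝ ∞ (V b))
    (hw : ∀ b, (fun p : ℝ × E => wordFlow Φ (linWord (w b)) (p.1 ^ e b) p.2 - p.2 -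
      p.1 ^ J • V b p.2) =O[𝓝 (0, q)] fun p => p.1 ^ (J + 1)) (L : List β) :
    ∀ {x : (β → ℝ) → E}, (fun σ => x σ - q) =O[𝓝 0] (fun σ => ‖σ‖) →
      (fun σ => wordFlow Φ (blockWord w e L) σ (x σ) - x σ -
        (L.map fun b => σ b ^ J • V b q).sum) =O[𝓝 0] fun σ => ‖σ‖ ^ (J + 1) := by
  induction L with
  | nil =>
    intro x hx
    simpa [blockWord, wordFlow] using isBigO_zero (E' := E) (fun σ : β → ℝ => ‖σ‖ ^ (J + 1)) (𝓝 0)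
  | cons b L ih =>
    intro x hx
    have hnorm0 : Tendsto (fun σ : β → ℝ => ‖σ‖) (𝓝 0) (𝓝 0) := continuous_norm.tendsto' _ _ norm_zero
    have hxq : Tendsto x (𝓝 0) (𝓝 q) := by
      simpa using (hx.trans_tendsto hnorm0).add_const q
    have hin : Tendsto (fun σ : β → ℝ => (σ b, x σ)) (𝓝 0) (𝓝 (0, q)) :=
      ((continuous_apply b).tendsto' _ _ rfl).prodMk_nhds hxq
    have hσb : (fun σ : β → ℝ => σ b) =O[𝓝 0] fun σ => ‖σ‖ :=
      IsBigO.of_bound 1 (.of_forall fun σ => by simpa using norm_le_pi_norm σ b)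
    have h1 := ((hw b).comp_tendsto hin).trans (hσb.pow (J + 1))
    have hVx : (fun σ => V b (x σ) - V b q) =O[𝓝 0] fun σ => ‖σ‖ :=
      ((((hV b).differentiable (by simp) q).isBigO_sub).comp_tendsto hxq).trans hx
    have h2 : (fun σ => σ b ^ J • (V b (x σ) - V b q)) =O[𝓝 0] fun σ => ‖σ‖ ^ (J + 1) := by
      simpa [pow_succ] using (hσb.pow J).smul hVx
    set y : (β → ℝ) → E := fun σ => wordFlow Φ (linWord (w b)) (σ b ^ e b) (x σ) with hy
    have h3 : (fun σ => y σ - x σ - σ b ^ J • V b q) =O[𝓝 0] fun σ => ‖σ‖ ^ (J + 1) := by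
      refine (h1.add h2).congr_left fun σ => ?_
      simp only [hy, Function.comp_apply, smul_sub]
      abel
    have hpow : ∀ {k : ℕ}, 0 < k → (fun σ : β → ℝ => ‖σ‖ ^ k) =O[𝓝 0] fun σ => ‖σ‖ := fun {k} hk => by
      refine IsBigO.of_bound 1 ?_
      filter_upwards [Metric.ball_mem_nhds (0 : β → ℝ) one_pos] with σ hσ
      rw [one_mul, Real.norm_of_nonneg (by positivity), Real.norm_of_nonneg (by positivity)]
      simpa using pow_le_pow_of_le_one (norm_nonneg _) (mem_ball_zero_iff.1 hσ).le hk
    have h4 : (fun σ => y σ - q) =O[𝓝 0] fun σ => ‖σ‖ := by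
      have h5 : (fun σ : β → ℝ => σ b ^ J • V b q) =O[𝓝 0] fun σ => ‖σ‖ := by
        have := (hσb.pow J).smul (isBigO_const_const (V b q) (one_ne_zero (α := ℝ)) (𝓝 0))
        simp only [smul_eq_mul, mul_one] at this
        exact this.trans (hpow hJ)
      refine (((h3.trans (hpow (Nat.succ_pos J))).add h5).add hx).congr_left fun σ => ?_
      abel
    refine ((ih h4).add h3).congr_left fun σ => ?_
    have h6 : wordFlow Φ (blockWord w e (b :: L)) σ (x σ) =
        wordFlow Φ (blockWord w e L) σ (y σ) := by
      rw [blockWord, List.flatMap_cons, wordFlow_append]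
      congr 1
      exact wordFlow_comp Φ (linWord (w b)) (fun σ : β → ℝ => σ b ^ e b) σ (x σ)
    rw [h6, List.map_cons, List.sum_cons]
    abel

/-- The series of the word is applied to the identity map, with parameter `s ^ e`. The exponent `e`
brings brackets of different lengths `j` to the common order `J = e j`; the error `s ^ (e (j + 1))`
is `O(s ^ (J + 1))` since `e ≥ 1`. -/
theorem exists_block {Y : ι → smoothMaps E} [Fintype ι] (hsum : ∑ i, Y i = 0)
    (hΦ : ∀ i, IsLocalFlow (Y i) q (Φ i)) {j J e : ℕ} (hj : 0 < j) (he : 0 < e) (hJ : e * j = J)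
    {Z : Module.End ℝ (smoothMaps E)} (hZ : Z ∈ bracketSpan (fun i => lieDer (Y i)) j) :
    ∃ w : List (ι × ℝ), (∀ p ∈ w, 0 < p.2) ∧
      (fun p : ℝ × E => wordFlow Φ (linWord w) (p.1 ^ e) p.2 - p.2 -
        p.1 ^ J • (Z smoothMaps.id : E → E) p.2) =O[𝓝 (0, q)] fun p => p.1 ^ (J + 1) := by
  have hsum' : ∑ i, lieDer (Y i) = 0 := by rw [← map_sum, hsum, map_zero]
  obtain ⟨w, hw, hlead⟩ := bracketSpan_subset_posLeads (fun i => lieDer (Y i)) hsum' j hj hZ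
  refine ⟨w, hw, ?_⟩
  have h1 := wordFlow_sub_sum_isBigO hΦ w smoothMaps.id (j + 1)
  have hin : Tendsto (fun p : ℝ × E => (p.1 ^ e, p.2)) (𝓝 (0, q)) (𝓝 (0, q)) :=
    (by fun_prop : Continuous fun p : ℝ × E => (p.1 ^ e, p.2)).tendsto' _ _ (by simp [he.ne'])
  have h2 := h1.comp_tendsto hin
  have h3 : (fun p : ℝ × E => (p.1 ^ e) ^ (j + 1)) =O[𝓝 (0, q)] fun p => p.1 ^ (J + 1) := by
    refine IsBigO.of_bound 1 ?_
    have h4 : ∀ᶠ p : ℝ × E in 𝓝 (0, q), |p.1| < 1 :=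
      (continuous_fst.abs.tendsto' ((0 : ℝ), q) 0 (by simp)).eventually_lt_const one_pos
    filter_upwards [h4] with p hp
    rw [one_mul, ← pow_mul, norm_pow, norm_pow]
    refine pow_le_pow_of_le_one (norm_nonneg _) hp.le ?_
    rw [mul_add, hJ]
    omega
  refine (h2.trans h3).congr_left fun p => ?_
  have h5 : ∑ k ∈ Finset.range (j + 1), (p.1 ^ e) ^ k •
      (PowerSeries.coeff k (wordSeries (fun i => lieDer (Y i)) w) smoothMaps.id : E → E) p.2 =
      p.2 + p.1 ^ J • (Z smoothMaps.id : E → E) p.2 := by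
    rw [Finset.sum_range_succ, hlead.coeff_self hj, ← pow_mul, hJ]
    congr 1
    obtain ⟨j, rfl⟩ : ∃ i, j = i + 1 := ⟨j - 1, by omega⟩
    rw [Finset.sum_range_succ', Finset.sum_eq_zero fun k hk => ?_]
    · rw [hlead.coeff_zero hj, pow_zero, one_smul, zero_add]
      rfl
    · rw [hlead.coeff_of_lt (Nat.succ_pos k) (by simpa using hk)]
      exact smul_zero _
  change wordFlow Φ (linWord w) (p.1 ^ e) p.2 - _ = _
  rw [h5]
  abel

theorem exists_fin_family_span_eq_top [FiniteDimensional ℝ E] {s : Set E}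
    (hs : Submodule.span ℝ s = ⊤) :
    ∃ (d : ℕ) (b : Fin d → E), (∀ k, b k ∈ s) ∧ Submodule.span ℝ (Set.range b) = ⊤ := by
  let b := Module.Basis.ofSpan hs.ge
  have := Module.Finite.finite_basis b
  let eq := Finite.equivFin ((linearIndepOn_empty ℝ _root_.id).extend (Set.empty_subset s))
  refine ⟨_, b.reindex eq, fun k => ?_, (b.reindex eq).span_eq⟩
  rw [b.reindex_apply]
  exact Module.Basis.ofSpan_subset hs.ge ⟨_, rfl⟩

/-- The blocks realizing plus and minus each bracket of a spanning family give leading vectors that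
span and sum to zero, so `frequently_return` applies. The product is written in the flows of the `X
i`, with the time changes absorbed in `T`. The word `extra` is there to supply the bracket
monomials. -/
theorem exists_flowProd_frequently_return [FiniteDimensional ℝ E] [Fintype ι]
    {X Y : ι → smoothMaps E} (hΦ : ∀ i, IsLocalFlow (X i) q (Φ i)) {a : ι → E → ℝ}
    (ha : ∀ i, ContDiff ℝ ∞ (a i)) (haq : ∀ i, 0 < a i q)
    (hY : ∀ i x, (Y i : E → E) x = a i x • (X i : E → E) x) (hsum : ∑ i, Y i = 0)
    (hspan : Submodule.span ℝ {v : E | ∃ j > 0, ∃ Z ∈ bracketSpan (fun i => lieDer (Y i)) j,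
      v = (Z smoothMaps.id : E → E) q} = ⊤) (extra : List ι) :
    ∃ (N : ℕ) (c : Fin N → ι), extra.Sublist (List.ofFn c) ∧ ∃ J : ℕ, ∀ m ≥ J,
      ∀ (ψ : E → E) (L : E ≃L[ℝ] E), ContDiffAt ℝ ∞ ψ q → HasFDerivAt ψ (L : E →L[ℝ] E) q →
        ∃ᶠ t in 𝓝 (0 : Fin N → ℝ), (∀ i, 0 < t i) ∧ flowProd Φ c q t = q ∧
          Function.Surjective (fderiv ℝ (flowProd Φ c q) t) ∧
          Function.Surjective (fderiv ℝ (fun x => ∑ i ∈ Finset.range (m + 1),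
            taylorTerm (fun y => ψ (flowProd Φ c q y)) i x) t) := by
  choose θ hθ hΨ using fun i => exists_isLocalTime (hΦ i) (ha i) (haq i)
  set Ψ : ι → ℝ × E → E := fun i p => Φ i (θ i p, p.2) with hΨdef
  have hΨ' : ∀ i, IsLocalFlow (Y i) q (Ψ i) := fun i => by
    have : (Y i : E → E) = fun x => a i x • (X i : E → E) x := funext (hY i)
    rw [this]
    exact hΨ i
  obtain ⟨d, b, hbmem, hb⟩ := exists_fin_family_span_eq_top hspan
  choose j hj Z hZ hbZ using hbmem
  -- A common multiple of the bracket lengths.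
  set J : ℕ := ∏ k, j k with hJdef
  have hJ : 0 < J := Finset.prod_pos fun k _ => hj k
  have hdvd : ∀ k, j k ∣ J := fun k => Finset.dvd_prod_of_mem j (Finset.mem_univ k)
  set sg : Bool → ℝ := fun s => if s then 1 else -1 with hsg
  have hblock : ∀ k : Fin d × Bool, ∃ w : List (ι × ℝ), (∀ p ∈ w, 0 < p.2) ∧
      (fun p : ℝ × E => wordFlow Ψ (linWord w) (p.1 ^ (J / j k.1)) p.2 - p.2 -
        p.1 ^ J • ((sg k.2 • Z k.1) smoothMaps.id : E → E) p.2) =O[𝓝 (0, q)]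
        fun p => p.1 ^ (J + 1) := fun k =>
    exists_block hsum hΨ' (hj k.1) (Nat.div_pos (Nat.le_of_dvd hJ (hdvd _)) (hj _))
      (Nat.div_mul_cancel (hdvd _)) (Submodule.smul_mem _ _ (hZ k.1))
  choose w hwpos hw using hblock
  -- The index `none` carries the word `extra`, with parameter `σ ^ (J + 1)`: it contributes nothing
  -- at order `J`, hence the zero field in `V`.
  set w' : Option (Fin d × Bool) → List (ι × ℝ) := fun k => k.elim (extra.map fun i => (i, 1)) w
    with hw'
  set e : Option (Fin d × Bool) → ℕ := fun k => k.elim (J + 1) fun k => J / j k.1 with he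
  set V : Option (Fin d × Bool) → smoothMaps E :=
    fun k => k.elim 0 fun k => (sg k.2 • Z k.1) smoothMaps.id with hVdef
  have hepos : ∀ k, 0 < e k
    | none => Nat.succ_pos J
    | some k => Nat.div_pos (Nat.le_of_dvd hJ (hdvd _)) (hj _)
  have hw'pos : ∀ k, ∀ p ∈ w' k, 0 < p.2
    | none, p, hp => by
      obtain ⟨i, _, rfl⟩ := List.mem_map.1 hp
      exact one_pos
    | some k, p, hp => hwpos k p hp
  have hw'O : ∀ k, (fun p : ℝ × E => wordFlow Ψ (linWord (w' k)) (p.1 ^ e k) p.2 - p.2 -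
        p.1 ^ J • (V k : E → E) p.2) =O[𝓝 (0, q)] fun p => p.1 ^ (J + 1)
    | none => by
      have h1 := wordFlow_sub_sum_isBigO hΨ' (w' none) smoothMaps.id 1
      have hin : Tendsto (fun p : ℝ × E => (p.1 ^ (J + 1), p.2)) (𝓝 (0, q)) (𝓝 (0, q)) :=
        (by fun_prop : Continuous fun p : ℝ × E => (p.1 ^ (J + 1), p.2)).tendsto' _ _ (by simp)
      refine (h1.comp_tendsto hin).congr (fun p => ?_) fun p => pow_one _
      simp only [Finset.sum_range_one, Function.comp_apply, pow_zero, one_smul]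
      rw [coeff_zero_wordSeries (fun i => lieDer (Y i)) (w' none)]
      change _ - _ = _ - _ - p.1 ^ J • (0 : E)
      rw [smul_zero, sub_zero]
      rfl
    | some k => hw k
  set W := blockWord w' e (Finset.univ : Finset (Option (Fin d × Bool))).toList with hWdef
  set T : (Option (Fin d × Bool) → ℝ) → Fin W.length → ℝ := fun σ => wordTimes Φ θ W σ q with hTdef
  have hWmem : ∀ p ∈ W, p.2 0 = 0 ∧ ContDiff ℝ ∞ p.2 ∧ ∀ σ : Option (Fin d × Bool) → ℝ,
      (∀ k, 0 < σ k) → 0 < p.2 σ := by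
    intro p hp
    obtain ⟨k, _, hp⟩ := List.mem_flatMap.1 hp
    obtain ⟨p', hp', rfl⟩ := List.mem_map.1 hp
    obtain ⟨p'', hp'', rfl⟩ := List.mem_map.1 hp'
    refine ⟨?_, ?_, fun σ hσ => mul_pos (hw'pos k _ hp'') (pow_pos (hσ k) _)⟩
    · simp [(hepos k).ne']
    · exact contDiff_const.mul ((contDiff_apply ℝ ℝ k).pow _)
  have hcons : (∀ p ∈ W, p.2 0 = 0) ∧ ∀ p ∈ W, p.2 0 = 0 ∧ ContDiff ℝ ∞ p.2 :=
    ⟨fun p hp => (hWmem p hp).1, fun p hp => ⟨(hWmem p hp).1, (hWmem p hp).2.1⟩⟩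
  have hTsm : ContDiffAt ℝ ∞ T 0 :=
    (contDiffAt_wordTimes hθ hΦ W hcons.2).comp (0 : Option (Fin d × Bool) → ℝ)
      (contDiffAt_id.prodMk contDiffAt_const)
  have hT0 : T 0 = 0 := wordTimes_zero hθ hΦ W hcons.1
  have hpos : ∀ᶠ σ in 𝓝 0, (∀ k, 0 < σ k) → ∀ i, 0 < T σ i :=
    ((continuous_id.prodMk continuous_const).tendsto' (0 : Option (Fin d × Bool) → ℝ)
      ((0 : Option (Fin d × Bool) → ℝ), q) rfl).eventually
      (wordTimes_pos hθ hΦ (P := fun σ : Option (Fin d × Bool) → ℝ => ∀ k, 0 < σ k) W hWmem)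
  set c : Fin W.length → ι := fun k => (W.get k).1 with hc
  have hg0 : flowProd Φ c q 0 = q := flowProd_zero hΦ c
  have hg : ContDiffAt ℝ ∞ (flowProd Φ c q) 0 :=
    (contDiffAt_flowProd hΦ c).comp (0 : Fin W.length → ℝ) (contDiffAt_const.prodMk contDiffAt_id)
  have hVval : ∀ k s, (V (some (k, s)) : E → E) q = sg s • b k := fun k s => by
    rw [hbZ k]; rfl
  have hv0 : ∑ k, (V k : E → E) q = 0 := by
    rw [Fintype.sum_option, Fintype.sum_prod_type]
    simp only [hVval, Fintype.sum_bool]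
    simp [hVdef, hsg]
  have hv : Submodule.span ℝ (Set.range fun k => (V k : E → E) q) = ⊤ := by
    rw [← top_le_iff, ← hb]
    refine Submodule.span_mono ?_
    rintro _ ⟨k, rfl⟩
    exact ⟨some (k, true), (hVval k true).trans (by simp [hsg])⟩
  have hO : (fun σ => flowProd Φ c q (T σ) - flowProd Φ c q 0 -
      powSum J (fun k => (V k : E → E) q) σ) =O[𝓝 0] fun σ => ‖σ‖ ^ (J + 1) := by
    have h1 := wordFlow_blockWord_isBigO hJ (fun k => contDiff_smoothMaps (V k)) hw'O
      (Finset.univ : Finset (Option (Fin d × Bool))).toList (x := fun _ => q)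
      (by simpa using isBigO_zero (E' := E) (fun σ : Option (Fin d × Bool) → ℝ => ‖σ‖) (𝓝 0))
    refine h1.congr_left fun σ => ?_
    rw [hg0, hTdef, flowProd_wordTimes, powSum, Finset.sum_map_toList]
  refine ⟨W.length, c, ?_, J, fun m hm ψ L hψ hL => ?_⟩
  · have h1 : List.ofFn c = W.map Prod.fst := by
      rw [show W.map Prod.fst = (List.ofFn W.get).map Prod.fst by rw [List.ofFn_get],
        List.map_ofFn]
      rfl
    rw [h1, hWdef, blockWord, List.map_flatMap]
    have h2 : extra = (((linWord (w' none)).map fun p =>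
        (p.1, p.2 ∘ fun σ : Option (Fin d × Bool) → ℝ => σ none ^ e none)).map Prod.fst) := by
      simp [hw', linWord, Function.comp_def]
    nth_rewrite 1 [h2]
    rw [List.flatMap_def]
    refine List.sublist_flatten_of_mem (List.mem_map.2 ⟨none, ?_, rfl⟩)
    simp
  · have h1 := frequently_return hg hTsm hT0 hpos hJ hv0 hv hO (ψ := ψ) (L := L)
      (by rwa [hg0]) (by rwa [hg0]) hm
    simpa only [hg0] using h1

end Products

end

noncomputable section

open Filter

/-! ### Lie brackets of smooth fields and rescaling of the generators. -/

section Brackets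

variable {E : Type} [NormedAddCommGroup E] [NormedSpace ℝ E]

/-- The Lie bracket of smooth vector fields. -/
def fieldBracket (V W : smoothMaps E) : smoothMaps E := lieDer V W - lieDer W V

theorem coe_fieldBracket (V W : smoothMaps E) :
    (fieldBracket V W : E → E) = VectorField.lieBracket ℝ (V : E → E) (W : E → E) := rfl

theorem lieDer_id (V : smoothMaps E) : lieDer V smoothMaps.id = V :=
  Subtype.ext <| funext fun x => by
    rw [lieDer_apply]
    change fderiv ℝ (fun x : E => x) x _ = _
    simp

theorem lieDer_injective : Function.Injective (lieDer : smoothMaps E → _) := fun V W h => by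
  rw [← lieDer_id V, h, lieDer_id]

theorem lieDer_lieDer_apply (V W f : smoothMaps E) (x : E) :
    (lieDer V (lieDer W f) : E → E) x =
      fderiv ℝ (fderiv ℝ (f : E → E)) x ((V : E → E) x) ((W : E → E) x) +
        fderiv ℝ (f : E → E) x (fderiv ℝ (W : E → E) x ((V : E → E) x)) := by
  have h1 : HasFDerivAt (fun y => fderiv ℝ (f : E → E) y)
      (fderiv ℝ (fderiv ℝ (f : E → E)) x) x :=
    (((contDiff_smoothMaps f).fderiv_right (m := ∞) (by simp)).differentiable
      (by simp) x).hasFDerivAt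
  have h2 := h1.clm_apply (differentiable_smoothMaps W x).hasFDerivAt
  rw [lieDer_apply]
  change fderiv ℝ (fun y => fderiv ℝ (f : E → E) y ((W : E → E) y)) x _ = _
  rw [h2.fderiv]
  simp [add_comm]

/-- In the commutator of the two derivations the second-derivative terms cancel by symmetry. -/
theorem lieDer_fieldBracket (V W : smoothMaps E) :
    lieDer (fieldBracket V W) = ⁅lieDer V, lieDer W⁆ := by
  refine LinearMap.ext fun f => Subtype.ext <| funext fun x => ?_
  rw [Ring.lie_def]
  change fderiv ℝ (f : E → E) x (fderiv ℝ (W : E → E) x ((V : E → E) x) -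
    fderiv ℝ (V : E → E) x ((W : E → E) x)) =
    (lieDer V (lieDer W f) : E → E) x - (lieDer W (lieDer V f) : E → E) x
  have hsymm : IsSymmSndFDerivAt ℝ (f : E → E) x :=
    (contDiff_smoothMaps f).contDiffAt.isSymmSndFDerivAt (by
      simp only [minSmoothness_of_isRCLikeNormedField]; exact WithTop.coe_le_coe.2 le_top)
  rw [lieDer_lieDer_apply, lieDer_lieDer_apply, map_sub, hsymm.eq]
  abel

/-- A field is recovered from its derivation by applying it to the identity map, so the identity can
be checked on commutators of operators. -/
theorem fieldBracket_jacobi (U V W : smoothMaps E) :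
    fieldBracket (fieldBracket U V) W =
      fieldBracket U (fieldBracket V W) - fieldBracket V (fieldBracket U W) :=
  lieDer_injective <| by
    simp only [map_sub, lieDer_fieldBracket, Ring.lie_def, sub_mul, mul_sub, mul_assoc]
    abel

/-- Multiplication of vector fields by smooth functions. -/
def fieldMul {f : E → ℝ} (hf : ContDiff ℝ ∞ f) (V : smoothMaps E) : smoothMaps E :=
  ⟨fun x => f x • (V : E → E) x, show ContDiff ℝ ∞ fun x => f x • (V : E → E) x from
    hf.smul (contDiff_smoothMaps V)⟩

theorem contDiff_fderiv_apply_field {f : E → ℝ} (hf : ContDiff ℝ ∞ f) (V : smoothMaps E) :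
    ContDiff ℝ ∞ fun x => fderiv ℝ f x ((V : E → E) x) :=
  (hf.fderiv_right (m := ∞) (by simp)).clm_apply (contDiff_smoothMaps V)

theorem fieldBracket_fieldMul {f g : E → ℝ} (hf : ContDiff ℝ ∞ f) (hg : ContDiff ℝ ∞ g)
    (V W : smoothMaps E) : fieldBracket (fieldMul hf V) (fieldMul hg W) =
      fieldMul (hf.mul hg) (fieldBracket V W) +
        fieldMul (hf.mul (contDiff_fderiv_apply_field hg V)) W -
        fieldMul (hg.mul (contDiff_fderiv_apply_field hf W)) V := by
  have h : ∀ {f : E → ℝ}, ContDiff ℝ ∞ f → ∀ (V : smoothMaps E) (x w : E),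
      fderiv ℝ (fun x => f x • (V : E → E) x) x w =
        f x • fderiv ℝ (V : E → E) x w + fderiv ℝ f x w • (V : E → E) x := fun {f} hf V x w => by
    rw [fderiv_fun_smul (hf.differentiable (by simp) x) (differentiable_smoothMaps V x)]
    simp
  refine Subtype.ext <| funext fun x => ?_
  change fderiv ℝ (fun x => g x • (W : E → E) x) x (f x • (V : E → E) x) -
    fderiv ℝ (fun x => f x • (V : E → E) x) x (g x • (W : E → E) x) =
    (f x * g x) • (fderiv ℝ (W : E → E) x ((V : E → E) x) -
      fderiv ℝ (V : E → E) x ((W : E → E) x)) +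
    (f x * fderiv ℝ g x ((V : E → E) x)) • (W : E → E) x -
    (g x * fderiv ℝ f x ((W : E → E) x)) • (V : E → E) x
  rw [h hf, h hg]
  simp only [map_smul, smul_eq_mul]
  module

variable {ι : Type*}

/-- The right-nested brackets of a family of smooth vector fields. -/
def nestedFieldBracket (X : ι → smoothMaps E) : List ι → smoothMaps E
  | [] => 0
  | [i] => X i
  | i :: j :: β => fieldBracket (X i) (nestedFieldBracket X (j :: β))

/-- The span of the right-nested brackets of a family of smooth vector fields. -/
def nestedSpan (X : ι → smoothMaps E) : Submodule ℝ (smoothMaps E) :=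
  Submodule.span ℝ (Set.range (nestedFieldBracket X))

/-- The Lie bracket of smooth vector fields as a bilinear map. -/
def fieldBracketHom : smoothMaps E →ₗ[ℝ] smoothMaps E →ₗ[ℝ] smoothMaps E :=
  LinearMap.mk₂ ℝ fieldBracket
    (fun U V W => by simp only [fieldBracket, map_add, LinearMap.add_apply]; abel)
    (fun c V W => by simp only [fieldBracket, map_smul, LinearMap.smul_apply, smul_sub])
    (fun U V W => by simp only [fieldBracket, map_add, LinearMap.add_apply]; abel)
    (fun c V W => by simp only [fieldBracket, map_smul, LinearMap.smul_apply, smul_sub])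

theorem fieldBracket_mem_nestedSpan_left (X : ι → smoothMaps E) (i : ι) {W : smoothMaps E}
    (hW : W ∈ nestedSpan X) : fieldBracket (X i) W ∈ nestedSpan X := by
  have : nestedSpan X ≤ (nestedSpan X).comap (fieldBracketHom (X i)) := by
    refine Submodule.span_le.2 ?_
    rintro _ ⟨β, rfl⟩
    cases β with
    | nil => change fieldBracketHom (X i) 0 ∈ nestedSpan X; rw [map_zero]; exact zero_mem _
    | cons j β => exact Submodule.subset_span ⟨i :: j :: β, rfl⟩
  exact this hW

/-- By the Jacobi identity, bracketing with `[X i, B]` is a difference of two successive bracketings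
with `X i` and `B`, which shortens the left entry. Hence right-nested brackets span the whole Lie
algebra. -/
theorem fieldBracket_nested_mem_nestedSpan (X : ι → smoothMaps E) :
    ∀ (β : List ι) {W : smoothMaps E}, W ∈ nestedSpan X →
      fieldBracket (nestedFieldBracket X β) W ∈ nestedSpan X
  | [], W, _ => by
    change fieldBracketHom 0 W ∈ nestedSpan X
    rw [map_zero]; exact zero_mem _
  | [i], W, hW => fieldBracket_mem_nestedSpan_left X i hW
  | i :: j :: β, W, hW => by
    change fieldBracket (fieldBracket (X i) (nestedFieldBracket X (j :: β))) W ∈ _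
    rw [fieldBracket_jacobi]
    exact sub_mem (fieldBracket_mem_nestedSpan_left X i
      (fieldBracket_nested_mem_nestedSpan X (j :: β) hW))
      (fieldBracket_nested_mem_nestedSpan X (j :: β) (fieldBracket_mem_nestedSpan_left X i hW))

theorem fieldBracket_mem_nestedSpan {X : ι → smoothMaps E} {V W : smoothMaps E}
    (hV : V ∈ nestedSpan X) (hW : W ∈ nestedSpan X) : fieldBracket V W ∈ nestedSpan X := by
  have : nestedSpan X ≤ (nestedSpan X).comap (fieldBracketHom.flip W) := by
    refine Submodule.span_le.2 ?_
    rintro _ ⟨β, rfl⟩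
    exact fieldBracket_nested_mem_nestedSpan X β hW
  exact this hV

/-- The fields which arise from the iterated brackets of `Y`. -/
def bracketFields (Y : ι → smoothMaps E) : Set (smoothMaps E) :=
  {V | ∃ j > 0, lieDer V ∈ bracketSpan (fun i => lieDer (Y i)) j}

/-- The module over the smooth functions which is generated by the iterated brackets of `Y`. -/
def bracketModule (Y : ι → smoothMaps E) : Submodule ℝ (smoothMaps E) :=
  Submodule.span ℝ {W | ∃ f : E → ℝ, ∃ hf : ContDiff ℝ ∞ f, ∃ V ∈ bracketFields Y, W = fieldMul hf V}

theorem mem_bracketFields (Y : ι → smoothMaps E) (i : ι) : Y i ∈ bracketFields Y :=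
  ⟨1, one_pos, Submodule.subset_span ⟨i, rfl⟩⟩

theorem fieldBracket_mem_bracketFields {Y : ι → smoothMaps E} (i : ι) {V : smoothMaps E}
    (hV : V ∈ bracketFields Y) : fieldBracket (Y i) V ∈ bracketFields Y := by
  obtain ⟨j, hj, h⟩ := hV
  refine ⟨j + 1, Nat.succ_pos j, ?_⟩
  rw [lieDer_fieldBracket]
  exact lie_mem_bracketSpan (fun i => lieDer (Y i)) i h

/-- Bracketing `b i • Y i` with `f • V` gives, by the Leibniz rule, function multiples of `[Y i,
V]`, `V` and `Y i`, so the module over the smooth functions is preserved. -/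
theorem nestedFieldBracket_mem_bracketModule {X Y : ι → smoothMaps E} {b : ι → E → ℝ}
    (hb : ∀ i, ContDiff ℝ ∞ (b i)) (hX : ∀ i, X i = fieldMul (hb i) (Y i)) (β : List ι) :
    nestedFieldBracket X β ∈ bracketModule Y := by
  have hstep : ∀ i, ∀ W ∈ bracketModule Y, fieldBracket (X i) W ∈ bracketModule Y := by
    intro i
    suffices h : bracketModule Y ≤ (bracketModule Y).comap (fieldBracketHom (X i)) from
      fun W hW => h hW
    refine Submodule.span_le.2 ?_
    rintro _ ⟨f, hf, V, hV, rfl⟩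
    change fieldBracket (X i) (fieldMul hf V) ∈ bracketModule Y
    rw [hX, fieldBracket_fieldMul]
    refine sub_mem (add_mem ?_ ?_) ?_
    · exact Submodule.subset_span ⟨_, _, _, fieldBracket_mem_bracketFields i hV, rfl⟩
    · exact Submodule.subset_span ⟨_, _, _, hV, rfl⟩
    · exact Submodule.subset_span ⟨_, _, _, mem_bracketFields Y i, rfl⟩
  induction β with
  | nil => exact zero_mem _
  | cons i β ih =>
    cases β with
    | nil => exact Submodule.subset_span ⟨_, hb i, _, mem_bracketFields Y i, hX i⟩
    | cons j β => exact hstep i _ ih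

/-- If the brackets of the fields `X i` span at `q`, so do those of the rescaled fields `Y i`. -/
theorem span_bracketSpan_eq_top {X Y : ι → smoothMaps E} {b : ι → E → ℝ}
    (hb : ∀ i, ContDiff ℝ ∞ (b i)) (hX : ∀ i, X i = fieldMul (hb i) (Y i)) {q : E}
    (hspan : Submodule.span ℝ (Set.range fun β => (nestedFieldBracket X β : E → E) q) = ⊤) :
    Submodule.span ℝ {v : E | ∃ j > 0, ∃ Z ∈ bracketSpan (fun i => lieDer (Y i)) j,
      v = (Z smoothMaps.id : E → E) q} = ⊤ := by
  rw [← top_le_iff, ← hspan]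
  refine Submodule.span_le.2 ?_
  rintro _ ⟨β, rfl⟩
  let ev : smoothMaps E →ₗ[ℝ] E :=
    { toFun := fun V => (V : E → E) q, map_add' := fun _ _ => rfl, map_smul' := fun _ _ => rfl }
  set T := Submodule.span ℝ {v : E | ∃ j > 0, ∃ Z ∈ bracketSpan (fun i => lieDer (Y i)) j,
      v = (Z smoothMaps.id : E → E) q}
  -- Evaluation at `q` turns the function coefficients into scalars.
  suffices h : bracketModule Y ≤ T.comap ev from
    h (nestedFieldBracket_mem_bracketModule hb hX β)
  refine Submodule.span_le.2 ?_
  rintro _ ⟨f, hf, V, ⟨j, hj, hV⟩, rfl⟩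
  change f q • (V : E → E) q ∈ T
  exact T.smul_mem _ (Submodule.subset_span ⟨j, hj, _, hV, by rw [lieDer_id]⟩)

end Brackets

end

noncomputable section

open Filter

/-! ### Positive relations between the control fields. -/

section Frames

variable {E : Type} [NormedAddCommGroup E] [NormedSpace ℝ E] [FiniteDimensional ℝ E]

/-- A smooth field with values in the span of linearly independent smooth fields is a combination of
them with smooth coefficients. -/
theorem exists_smooth_coefficients {b : Type*} [Fintype b] {P : b → E → E} {q : E}
    (hP : ∀ i, ∀ᶠ y in 𝓝 q, ContDiffAt ℝ ∞ (P i) y) (hli : LinearIndependent ℝ fun i => P i q)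
    {W : E → E} (hW : ∀ᶠ y in 𝓝 q, ContDiffAt ℝ ∞ W y)
    (hmem : ∀ᶠ y in 𝓝 q, W y ∈ Submodule.span ℝ (Set.range fun i => P i y)) :
    ∃ e : b → E → ℝ, (∀ i, ∀ᶠ y in 𝓝 q, ContDiffAt ℝ ∞ (e i) y) ∧
      ∀ᶠ y in 𝓝 q, W y = ∑ i, e i y • P i y := by
  have hinj : LinearMap.ker (Fintype.linearCombination ℝ fun i => P i q) = ⊥ :=
    LinearMap.ker_eq_bot.2 (linearIndependent_iff_injective_fintypeLinearCombination.1 hli)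
  -- A fixed left inverse of the frame at `q`, composed with the frame at `y`, is the identity at
  -- `q` and hence invertible nearby. Inverting it solves for the coefficients smoothly.
  obtain ⟨ℓ, hℓ⟩ := LinearMap.exists_leftInverse_of_injective _ hinj
  set ℓ' : E →L[ℝ] (b → ℝ) := LinearMap.toContinuousLinearMap ℓ with hℓ'
  set B : E → (b → ℝ) →L[ℝ] (b → ℝ) := fun y =>
    ∑ i, (ContinuousLinearMap.proj i : (b → ℝ) →L[ℝ] ℝ).smulRight (ℓ' (P i y)) with hB
  have hBapply : ∀ y c, B y c = ℓ' (∑ i, c i • P i y) := fun y c => by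
    simp [hB]
  have hBq : B q = 1 := by
    ext1 c
    rw [hBapply]
    exact congrArg (fun l => l c) hℓ
  have hBs : ∀ᶠ y in 𝓝 q, ContDiffAt ℝ ∞ B y := by
    filter_upwards [eventually_all.2 hP] with y hy
    exact ContDiffAt.sum fun i _ => contDiffAt_const.smulRight (ℓ'.contDiff.contDiffAt.comp y (hy i))
  have hBu : ∀ᶠ y in 𝓝 q, IsUnit (B y) :=
    hBs.self_of_nhds.continuousAt.eventually
      (Units.isOpen.mem_nhds (by rw [hBq]; exact isUnit_one))
  refine ⟨fun i y => Ring.inverse (B y) (ℓ' (W y)) i, fun i => ?_, ?_⟩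
  · filter_upwards [hBs, hBu, hW] with y h1 h2 h3
    obtain ⟨u, hu⟩ := h2
    have h4 : ContDiffAt ℝ ∞ (fun y => Ring.inverse (B y)) y :=
      ContDiffAt.comp (g := Ring.inverse) y (by rw [← hu]; exact contDiffAt_ringInverse ℝ u) h1
    exact contDiffAt_pi.1 (h4.clm_apply (ℓ'.contDiff.contDiffAt.comp y h3)) i
  · filter_upwards [hBu, hmem] with y h1 h2
    obtain ⟨c, hc⟩ := (Submodule.mem_span_range_iff_exists_fun ℝ).1 h2
    have h3 : Ring.inverse (B y) (ℓ' (W y)) = c := by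
      rw [← hc, ← hBapply]
      exact congrArg (fun l : (b → ℝ) →L[ℝ] (b → ℝ) => l c) (Ring.inverse_mul_cancel _ h1)
    rw [h3, hc]

/-- Take a basis of the span at `q` from the fields themselves; by constant rank it stays a basis of
the span nearby. The sum of the prescribed fields, plus a large multiple of a convex combination
equal at `q` to minus the sum of the basis, has smooth coordinates in this frame which are negative
at `q`. Moving them to the other side gives a relation with positive coefficients on a whole
neighbourhood. -/
theorem exists_positive_relation {U : Type*} {X : U → E → E} {q : E}
    (hX : ∀ u, ∀ᶠ y in 𝓝 q, ContDiffAt ℝ ∞ (X u) y)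
    (hrank : ∀ᶠ y in 𝓝 q, Module.finrank ℝ (Submodule.span ℝ (Set.range fun u => X u y)) =
      Module.finrank ℝ (Submodule.span ℝ (Set.range fun u => X u q)))
    (hconv : convexHull ℝ (Set.range fun u => X u q) =
      (Submodule.span ℝ (Set.range fun u => X u q) : Set E)) (s : Finset U) :
    ∃ (l : ℕ) (v : Fin l → U), (∀ u ∈ s, ∃ i, v i = u) ∧ ∃ a : Fin l → E → ℝ,
      (∀ i, ∀ᶠ y in 𝓝 q, ContDiffAt ℝ ∞ (a i) y) ∧ (∀ i, 0 < a i q) ∧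
        ∀ᶠ y in 𝓝 q, ∑ i, a i y • X (v i) y = 0 := by
  obtain ⟨b, hbs, hbspan, hbli⟩ := exists_linearIndependent ℝ (Set.range fun u => X u q)
  have hbfin : Finite b := hbli.finite
  have hbft : Fintype b := Fintype.ofFinite b
  choose u hu using fun x : b => hbs x.2
  have hu' : (fun x : b => X (u x) q) = ((↑) : b → E) := funext hu
  have hli : LinearIndependent ℝ fun x : b => X (u x) q := by rwa [hu']
  have hspan : ∀ᶠ y in 𝓝 q, Submodule.span ℝ (Set.range fun x => X (u x) y) =
      Submodule.span ℝ (Set.range fun u => X u y) := by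
    have h1 : ContinuousAt (fun y => fun x : b => X (u x) y) q :=
      continuousAt_pi.2 fun x => (hX (u x)).self_of_nhds.continuousAt
    filter_upwards [h1.eventually hli.eventually, hrank] with y h2 h3
    refine Submodule.eq_of_le_of_finrank_eq (Submodule.span_mono ?_) ?_
    · rintro _ ⟨x, rfl⟩
      exact ⟨u x, rfl⟩
    · rw [h3, ← hbspan, finrank_span_eq_card h2, ← finrank_span_eq_card hli, hu', Subtype.range_coe]
  -- the convex combination
  have hmem : -∑ x, X (u x) q ∈ convexHull ℝ (Set.range fun u => X u q) := by
    rw [hconv]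
    exact neg_mem (sum_mem fun x _ => Submodule.subset_span ⟨u x, rfl⟩)
  obtain ⟨K, hK, z, lam, hz, -, hlam, -, hsum⟩ := eq_pos_convex_span_of_mem_convexHull hmem
  choose w hw using fun j => hz ⟨j, rfl⟩
  -- the coefficients
  have hSmem : ∑ i : s, X i q ∈ Submodule.span ℝ (Set.range fun x => X (u x) q) := by
    rw [hspan.self_of_nhds]
    exact sum_mem fun i _ => Submodule.subset_span ⟨i, rfl⟩
  obtain ⟨d, hd⟩ := (Submodule.mem_span_range_iff_exists_fun ℝ).1 hSmem
  -- The basis coefficients at `q` will be `d x - Λ`, and must be negative.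
  obtain ⟨Λ, hΛ⟩ : ∃ Λ : ℝ, 0 < Λ ∧ ∀ x, d x < Λ := by
    refine ⟨∑ x, |d x| + 1, by positivity, fun x => ?_⟩
    have := Finset.single_le_sum (f := fun x => |d x|) (fun x _ => abs_nonneg _) (Finset.mem_univ x)
    have h2 := le_abs_self (d x)
    linarith
  set W : E → E := fun y => ∑ i : s, X i y + Λ • ∑ j, lam j • X (w j) y with hW
  have hWs : ∀ᶠ y in 𝓝 q, ContDiffAt ℝ ∞ W y := by
    filter_upwards [eventually_all.2 fun i : s => hX i, eventually_all.2 fun j => hX (w j)]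
      with y h1 h2
    exact (ContDiffAt.sum fun i _ => h1 i).add
      (contDiffAt_const.smul (ContDiffAt.sum fun j _ => contDiffAt_const.smul (h2 j)))
  have hWmem : ∀ᶠ y in 𝓝 q, W y ∈ Submodule.span ℝ (Set.range fun x => X (u x) y) := by
    filter_upwards [hspan] with y hy
    rw [hy]
    exact add_mem (sum_mem fun i _ => Submodule.subset_span ⟨i, rfl⟩) (Submodule.smul_mem _ _
      (sum_mem fun j _ => Submodule.smul_mem _ _ (Submodule.subset_span ⟨w j, rfl⟩)))
  obtain ⟨e, he, heW⟩ := exists_smooth_coefficients (fun x => hX (u x)) hli hWs hWmem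
  have heq : ∀ x, e x q = d x - Λ := by
    have h1 : ∑ x, e x q • X (u x) q = ∑ x, (d x - Λ) • X (u x) q := by
      rw [← heW.self_of_nhds]
      simp only [hW, hw, hsum, sub_smul, Finset.sum_sub_distrib, hd]
      rw [← Finset.smul_sum, smul_neg, sub_eq_add_neg]
    exact fun x => congrFun (linearIndependent_iff_injective_fintypeLinearCombination.1 hli h1) x
  -- The generators: the prescribed fields, the fields of the convex combination, and the frame. A
  -- field may occur more than once.
  let T := s ⊕ (K ⊕ b)
  let eT : T ≃ Fin (Fintype.card T) := Fintype.equivFin T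
  let v : T → U := Sum.elim (fun i => (i : U)) (Sum.elim w u)
  let a : T → E → ℝ := Sum.elim (fun _ _ => 1) (Sum.elim (fun j _ => Λ * lam j) fun x y => -e x y)
  have ha : ∀ t, ∀ᶠ y in 𝓝 q, ContDiffAt ℝ ∞ (a t) y := by
    rintro (i | j | x)
    · exact .of_forall fun y => contDiffAt_const
    · exact .of_forall fun y => contDiffAt_const
    · exact (he x).mono fun y hy => hy.neg
  have hapos : ∀ t, 0 < a t q := by
    rintro (i | j | x)
    · exact one_pos
    · exact mul_pos hΛ.1 (hlam j)
    · change 0 < -e x q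
      rw [heq]
      linarith [hΛ.2 x]
  refine ⟨Fintype.card T, fun i => v (eT.symm i), fun i hi => ⟨eT (.inl ⟨i, hi⟩), ?_⟩,
    fun i => a (eT.symm i), fun i => ha _, fun i => hapos _, ?_⟩
  · simp [v]
  · filter_upwards [heW] with y hy
    rw [eT.symm.sum_comp fun i => a i y • X (v i) y, Fintype.sum_sum_type, Fintype.sum_sum_type]
    simp only [a, v, Sum.elim_inl, Sum.elim_inr, one_smul, neg_smul, Finset.sum_neg_distrib, ← hy]
    simp only [hW, Finset.smul_sum, mul_smul]
    abel

/-- One bump function multiplies all fields, so the relation persists inside its support and is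
trivial outside. The coefficients must remain positive everywhere to be invertible, so their
logarithms are cut off and then exponentiated. -/
theorem exists_global_positive_relation {l : ℕ} {X : Fin l → E → E} {q : E}
    (hX : ∀ i, ∀ᶠ y in 𝓝 q, ContDiffAt ℝ ∞ (X i) y) {a : Fin l → E → ℝ}
    (ha : ∀ i, ∀ᶠ y in 𝓝 q, ContDiffAt ℝ ∞ (a i) y) (haq : ∀ i, 0 < a i q)
    (hsum : ∀ᶠ y in 𝓝 q, ∑ i, a i y • X i y = 0) :
    ∃ (X' Y : Fin l → smoothMaps E) (a' : Fin l → E → ℝ), (∀ i, ContDiff ℝ ∞ (a' i)) ∧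
      (∀ i x, 0 < a' i x) ∧ (∀ i, (X' i : E → E) =ᶠ[𝓝 q] X i) ∧
      (∀ i x, (Y i : E → E) x = a' i x • (X' i : E → E) x) ∧ ∑ i, Y i = 0 := by
  have hlog : ∀ i, ∃ g : E → ℝ, ContDiff ℝ ∞ g ∧ g =ᶠ[𝓝 q] fun y => Real.log (a i y) := fun i => by
    refine exists_contDiff_eventuallyEq ?_
    filter_upwards [ha i, (ha i).self_of_nhds.continuousAt.eventually_const_lt (haq i)] with y h1 h2
    exact h1.log h2.ne'
  choose g hg hgeq using hlog
  have hexp : ∀ i, ∀ᶠ y in 𝓝 q, Real.exp (g i y) = a i y := fun i => by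
    filter_upwards [hgeq i, (ha i).self_of_nhds.continuousAt.eventually_const_lt (haq i)] with y h1 h2
    rw [h1, Real.exp_log h2]
  obtain ⟨δ, hδ, hball⟩ := Metric.eventually_nhds_iff_ball.1
    (((eventually_all.2 hX).and (eventually_all.2 hexp)).and hsum)
  let χ : ContDiffBump q := ⟨δ / 3, δ / 2, by positivity, by linarith⟩
  have hout : ∀ y, y ∉ Metric.ball q δ → ∀ᶠ z in 𝓝 y, χ z = 0 := fun y hy => by
    have hy' : y ∈ (Metric.closedBall q (δ / 2))ᶜ := fun h' => hy <| Metric.mem_ball.2 <|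
      (Metric.mem_closedBall.1 h').trans_lt (by linarith)
    filter_upwards [Metric.isClosed_closedBall.isOpen_compl.mem_nhds hy'] with z hz
    exact χ.zero_of_le_dist (le_of_lt (by simpa using hz))
  have hX's : ∀ i, ContDiff ℝ ∞ fun y => χ y • X i y := fun i => by
    refine contDiff_iff_contDiffAt.2 fun y => ?_
    by_cases hy : y ∈ Metric.ball q δ
    · exact χ.contDiffAt.smul ((hball y hy).1.1 i)
    · refine (contDiffAt_const (c := (0 : E))).congr_of_eventuallyEq ?_
      filter_upwards [hout y hy] with z hz
      rw [hz, zero_smul]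
  have ha' : ∀ i, ContDiff ℝ ∞ fun y => Real.exp (g i y) := fun i => (hg i).exp
  set X' : Fin l → smoothMaps E := fun i => ⟨fun y => χ y • X i y, hX's i⟩ with hX'
  refine ⟨X', fun i => fieldMul (ha' i) (X' i), fun i y => Real.exp (g i y), ha',
    fun i x => Real.exp_pos _, fun i => ?_, fun i x => rfl, ?_⟩
  · filter_upwards [χ.eventuallyEq_one] with y hy
    change χ y • X i y = X i y
    rw [hy, Pi.one_apply, one_smul]
  · refine Subtype.ext <| funext fun y => ?_
    rw [Submodule.coe_sum, Finset.sum_apply]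
    change ∑ i, Real.exp (g i y) • χ y • X i y = 0
    by_cases hy : y ∈ Metric.ball q δ
    · have h1 := hball y hy
      rw [← smul_zero (χ y), ← h1.2, Finset.smul_sum]
      refine Finset.sum_congr rfl fun i _ => ?_
      rw [h1.1.2 i, smul_comm]
    · refine Finset.sum_eq_zero fun i _ => ?_
      rw [(hout y hy).self_of_nhds, zero_smul, smul_zero]

end Frames

end

noncomputable section

open Filter VectorField

/-! ### Vector fields and brackets in a chart. -/

section Charts

variable {n : ℕ} {M : Type*} [TopologicalSpace M] [ChartedSpace (EuclideanSpace ℝ (Fin n)) M]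
  [IsManifold (𝓡 n) ∞ M] {e : OpenPartialHomeomorph M (EuclideanSpace ℝ (Fin n))}

theorem mdifferentiable_of_mem_maximalAtlas (he : e ∈ IsManifold.maximalAtlas (𝓡 n) ∞ M) :
    e.MDifferentiable (𝓡 n) (𝓡 n) :=
  ⟨(contMDiffOn_of_mem_maximalAtlas he).mdifferentiableOn (by simp),
    (contMDiffOn_symm_of_mem_maximalAtlas he).mdifferentiableOn (by simp)⟩

theorem isInvertible_mfderiv_symm (he : e ∈ IsManifold.maximalAtlas (𝓡 n) ∞ M)
    {y : EuclideanSpace ℝ (Fin n)} (hy : y ∈ e.target) :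
    (mfderiv (𝓡 n) (𝓡 n) e.symm y).IsInvertible :=
  ⟨(mdifferentiable_of_mem_maximalAtlas he).symm.mfderiv hy, rfl⟩

/-- The representation of a vector field on `M` in the chart `e`. -/
def chartField (e : OpenPartialHomeomorph M (EuclideanSpace ℝ (Fin n)))
    (V : (x : M) → TangentSpace (𝓡 n) x) : EuclideanSpace ℝ (Fin n) → EuclideanSpace ℝ (Fin n) :=
  mpullback (𝓡 n) (𝓡 n) e.symm V

theorem contDiffAt_chartField (he : e ∈ IsManifold.maximalAtlas (𝓡 n) ∞ M)
    {V : (x : M) → TangentSpace (𝓡 n) x}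
    (hV : ContMDiff (𝓡 n) (𝓡 n).tangent ∞ (fun x => (⟨x, V x⟩ : TangentBundle (𝓡 n) M)))
    {y : EuclideanSpace ℝ (Fin n)} (hy : y ∈ e.target) : ContDiffAt ℝ ∞ (chartField e V) y :=
  contMDiffAt_vectorSpace_iff_contDiffAt.1 <|
    ContMDiffAt.mpullback_vectorField_preimage (hV _)
      (contMDiffAt_symm_of_mem_maximalAtlas he hy) (isInvertible_mfderiv_symm he hy) (by simp)

theorem mfderiv_chartField (he : e ∈ IsManifold.maximalAtlas (𝓡 n) ∞ M)
    (V : (x : M) → TangentSpace (𝓡 n) x) {y : EuclideanSpace ℝ (Fin n)} (hy : y ∈ e.target) :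
    mfderiv (𝓡 n) (𝓡 n) e.symm y (chartField e V y) = V (e.symm y) := by
  rw [chartField, mpullback_apply]
  exact (isInvertible_mfderiv_symm he hy).self_apply_inverse _

theorem chartField_zero : chartField e (0 : (x : M) → TangentSpace (𝓡 n) x) = 0 := mpullback_zero

theorem chartField_add (V W : (x : M) → TangentSpace (𝓡 n) x) :
    chartField e (V + W) = chartField e V + chartField e W := mpullback_add

theorem chartField_smul (c : ℝ) (V : (x : M) → TangentSpace (𝓡 n) x) :
    chartField e (c • V) = c • chartField e V := mpullback_const_smul

theorem chartField_mlieBracket (he : e ∈ IsManifold.maximalAtlas (𝓡 n) ∞ M)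
    {V W : (x : M) → TangentSpace (𝓡 n) x}
    (hV : ContMDiff (𝓡 n) (𝓡 n).tangent ∞ (fun x => (⟨x, V x⟩ : TangentBundle (𝓡 n) M)))
    (hW : ContMDiff (𝓡 n) (𝓡 n).tangent ∞ (fun x => (⟨x, W x⟩ : TangentBundle (𝓡 n) M)))
    {y : EuclideanSpace ℝ (Fin n)} (hy : y ∈ e.target) :
    chartField e (mlieBracket (𝓡 n) V W) y = lieBracket ℝ (chartField e V) (chartField e W) y := by
  have : IsManifold (𝓡 n) (minSmoothness ℝ 3) M := by
    rw [minSmoothness_of_isRCLikeNormedField]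
    exact IsManifold.of_le (n := ∞) (WithTop.coe_le_coe.2 le_top)
  rw [chartField, mpullback_mlieBracket (hV.mdifferentiable (by simp) _)
    (hW.mdifferentiable (by simp) _) (contMDiffAt_symm_of_mem_maximalAtlas he hy)
    (by rw [minSmoothness_of_isRCLikeNormedField]; exact WithTop.coe_le_coe.2 le_top),
    ← mlieBracketWithin_univ, mlieBracketWithin_eq_lieBracketWithin]
  exact congrFun lieBracketWithin_univ y

theorem contMDiff_mlieBracket {V W : (x : M) → TangentSpace (𝓡 n) x}
    (hV : ContMDiff (𝓡 n) (𝓡 n).tangent ∞ (fun x => (⟨x, V x⟩ : TangentBundle (𝓡 n) M)))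
    (hW : ContMDiff (𝓡 n) (𝓡 n).tangent ∞ (fun x => (⟨x, W x⟩ : TangentBundle (𝓡 n) M))) :
    ContMDiff (𝓡 n) (𝓡 n).tangent ∞
      (fun x => (⟨x, mlieBracket (𝓡 n) V W x⟩ : TangentBundle (𝓡 n) M)) := fun x => by
  have : IsManifold (𝓡 n) (minSmoothness ℝ 2) M := by
    rw [minSmoothness_of_isRCLikeNormedField]
    exact IsManifold.of_le (n := ∞) (WithTop.coe_le_coe.2 le_top)
  have : IsManifold (𝓡 n) (((⊤ : ℕ∞) : ℕ∞ω) + 1) M := ‹IsManifold (𝓡 n) ∞ M›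
  exact ContMDiffAt.mlieBracket_vectorField (m := ⊤) (n := ⊤) (hV x) (hW x) (by simp)

theorem contMDiff_of_inLieAlgebra {F : Set ((x : M) → TangentSpace (𝓡 n) x)}
    (hF : ∀ V ∈ F, ContMDiff (𝓡 n) (𝓡 n).tangent ∞ (fun x => (⟨x, V x⟩ : TangentBundle (𝓡 n) M)))
    {V : (x : M) → TangentSpace (𝓡 n) x} (hV : ControlSystem.InLieAlgebra F V) :
    ContMDiff (𝓡 n) (𝓡 n).tangent ∞ (fun x => (⟨x, V x⟩ : TangentBundle (𝓡 n) M)) := by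
  induction hV with
  | of h => exact hF _ h
  | zero => exact Bundle.contMDiff_zeroSection ℝ (TangentSpace (𝓡 n) : M → Type _)
  | add _ _ h1 h2 => exact h1.add_section h2
  | smul c _ h => exact h.const_smul_section
  | bracket _ _ h1 h2 => exact contMDiff_mlieBracket h1 h2

variable {ι : Type*} {W : ι → (x : M) → TangentSpace (𝓡 n) x}

theorem contMDiff_nestedBracket
    (hW : ∀ i, ContMDiff (𝓡 n) (𝓡 n).tangent ∞ (fun x => (⟨x, W i x⟩ : TangentBundle (𝓡 n) M))) :
    ∀ β : List ι, ContMDiff (𝓡 n) (𝓡 n).tangent ∞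
      (fun x => (⟨x, ControlSystem.nestedBracket W β x⟩ : TangentBundle (𝓡 n) M))
  | [] => Bundle.contMDiff_zeroSection ℝ (TangentSpace (𝓡 n) : M → Type _)
  | [i] => hW i
  | i :: j :: β => contMDiff_mlieBracket (hW i) (contMDiff_nestedBracket hW (j :: β))

variable {X : ι → smoothMaps (EuclideanSpace ℝ (Fin n))} {y₀ : EuclideanSpace ℝ (Fin n)}

theorem fieldBracket_eventuallyEq (he : e ∈ IsManifold.maximalAtlas (𝓡 n) ∞ M) (hy₀ : y₀ ∈ e.target)
    {A B : smoothMaps (EuclideanSpace ℝ (Fin n))} {V W : (x : M) → TangentSpace (𝓡 n) x}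
    (hV : ContMDiff (𝓡 n) (𝓡 n).tangent ∞ (fun x => (⟨x, V x⟩ : TangentBundle (𝓡 n) M)))
    (hW : ContMDiff (𝓡 n) (𝓡 n).tangent ∞ (fun x => (⟨x, W x⟩ : TangentBundle (𝓡 n) M)))
    (hA : (A : EuclideanSpace ℝ (Fin n) → EuclideanSpace ℝ (Fin n)) =ᶠ[𝓝 y₀] chartField e V)
    (hB : (B : EuclideanSpace ℝ (Fin n) → EuclideanSpace ℝ (Fin n)) =ᶠ[𝓝 y₀] chartField e W) :
    (fieldBracket A B : EuclideanSpace ℝ (Fin n) → EuclideanSpace ℝ (Fin n)) =ᶠ[𝓝 y₀]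
      chartField e (mlieBracket (𝓡 n) V W) := by
  filter_upwards [hA.eventuallyEq_nhds, hB.eventuallyEq_nhds, e.open_target.mem_nhds hy₀]
    with y h1 h2 h3
  rw [chartField_mlieBracket he hV hW h3, coe_fieldBracket]
  exact h1.lieBracket_vectorField_eq h2

theorem nestedFieldBracket_eventuallyEq (he : e ∈ IsManifold.maximalAtlas (𝓡 n) ∞ M)
    (hy₀ : y₀ ∈ e.target)
    (hW : ∀ i, ContMDiff (𝓡 n) (𝓡 n).tangent ∞ (fun x => (⟨x, W i x⟩ : TangentBundle (𝓡 n) M)))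
    (hX : ∀ i, (X i : EuclideanSpace ℝ (Fin n) → EuclideanSpace ℝ (Fin n)) =ᶠ[𝓝 y₀]
      chartField e (W i)) :
    ∀ β : List ι, (nestedFieldBracket X β : EuclideanSpace ℝ (Fin n) → EuclideanSpace ℝ (Fin n))
      =ᶠ[𝓝 y₀] chartField e (ControlSystem.nestedBracket W β)
  | [] => by
    change _ =ᶠ[𝓝 y₀] chartField e (0 : (x : M) → TangentSpace (𝓡 n) x)
    rw [chartField_zero]; rfl
  | [i] => hX i
  | i :: j :: β => fieldBracket_eventuallyEq he hy₀ (hW i) (contMDiff_nestedBracket hW (j :: β))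
      (hX i) (nestedFieldBracket_eventuallyEq he hy₀ hW hX (j :: β))

/-- Pullback to the chart respects the Lie algebra operations, and the span of right-nested brackets
is closed under them. -/
theorem exists_mem_nestedSpan_eventuallyEq (he : e ∈ IsManifold.maximalAtlas (𝓡 n) ∞ M)
    (hy₀ : y₀ ∈ e.target)
    (hW : ∀ i, ContMDiff (𝓡 n) (𝓡 n).tangent ∞ (fun x => (⟨x, W i x⟩ : TangentBundle (𝓡 n) M)))
    (hX : ∀ i, (X i : EuclideanSpace ℝ (Fin n) → EuclideanSpace ℝ (Fin n)) =ᶠ[𝓝 y₀]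
      chartField e (W i)) {F : Set ((x : M) → TangentSpace (𝓡 n) x)} (hF : F ⊆ Set.range W)
    {V : (x : M) → TangentSpace (𝓡 n) x} (hV : ControlSystem.InLieAlgebra F V) :
    ∃ A ∈ nestedSpan X, (A : EuclideanSpace ℝ (Fin n) → EuclideanSpace ℝ (Fin n)) =ᶠ[𝓝 y₀]
      chartField e V := by
  have hFs : ∀ V ∈ F, ContMDiff (𝓡 n) (𝓡 n).tangent ∞
      (fun x => (⟨x, V x⟩ : TangentBundle (𝓡 n) M)) := by
    intro V hV
    obtain ⟨i, rfl⟩ := hF hV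
    exact hW i
  induction hV with
  | of h =>
    obtain ⟨i, rfl⟩ := hF h
    exact ⟨X i, Submodule.subset_span ⟨[i], rfl⟩, hX i⟩
  | zero => exact ⟨0, zero_mem _, by rw [chartField_zero]; rfl⟩
  | add _ _ h1 h2 =>
    obtain ⟨A, hA, hA'⟩ := h1
    obtain ⟨B, hB, hB'⟩ := h2
    exact ⟨A + B, add_mem hA hB, by rw [chartField_add]; exact hA'.add hB'⟩
  | smul c _ h =>
    obtain ⟨A, hA, hA'⟩ := h
    exact ⟨c • A, Submodule.smul_mem _ _ hA, by rw [chartField_smul]; exact hA'.const_smul c⟩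
  | bracket h3 h4 h1 h2 =>
    obtain ⟨A, hA, hA'⟩ := h1
    obtain ⟨B, hB, hB'⟩ := h2
    exact ⟨fieldBracket A B, fieldBracket_mem_nestedSpan hA hB,
      fieldBracket_eventuallyEq he hy₀ (contMDiff_of_inLieAlgebra hFs h3)
        (contMDiff_of_inLieAlgebra hFs h4) hA' hB'⟩

end Charts

end

noncomputable section

open Filter VectorField

theorem exists_isLocalFlow {E : Type} [NormedAddCommGroup E] [NormedSpace ℝ E] [CompleteSpace E]
    (X : smoothMaps E) (q : E) : ∃ Φ : ℝ × E → E, IsLocalFlow X q Φ := by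
  obtain ⟨Φ, h1, h2⟩ := exists_contDiffAt_flow (contDiff_smoothMaps X) q
  refine ⟨Φ, h1, ?_, h2.mono fun p hp => hp.2⟩
  have h3 : Tendsto (fun x : E => ((0 : ℝ), x)) (𝓝 q) (𝓝 (0, q)) :=
    (by fun_prop : Continuous fun x : E => ((0 : ℝ), x)).tendsto' _ _ rfl
  exact (h3.eventually h2).mono fun x hx => hx.1

/-! ### Flows and control vectors in a chart. -/

section Flows

variable {n : ℕ} {M : Type*} [TopologicalSpace M] [ChartedSpace (EuclideanSpace ℝ (Fin n)) M]
  [IsManifold (𝓡 n) ∞ M] {U : Type*} (S : ControlSystem n M U)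
  {e : OpenPartialHomeomorph M (EuclideanSpace ℝ (Fin n))} {y₀ : EuclideanSpace ℝ (Fin n)}

/-- Both sides are integral curves of the same field with the same initial point; in a Hausdorff
manifold they agree. -/
theorem flow_eq_of_isLocalFlow [T2Space M] (he : e ∈ IsManifold.maximalAtlas (𝓡 n) ∞ M)
    (hy₀ : y₀ ∈ e.target) {u : U} {X : smoothMaps (EuclideanSpace ℝ (Fin n))}
    (hX : (X : EuclideanSpace ℝ (Fin n) → EuclideanSpace ℝ (Fin n)) =ᶠ[𝓝 y₀]
      chartField e (S.field u))
    {Φ : ℝ × EuclideanSpace ℝ (Fin n) → EuclideanSpace ℝ (Fin n)} (hΦ : IsLocalFlow X y₀ Φ) :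
    ∀ᶠ p in 𝓝 (0, y₀), S.flow u p.1 (e.symm p.2) = e.symm (Φ p) := by
  have hinit : ∀ᶠ p in 𝓝 ((0 : ℝ), y₀), Φ (0, p.2) = p.2 :=
    (continuous_snd.tendsto' ((0 : ℝ), y₀) y₀ rfl).eventually hΦ.init
  have htarget : ∀ᶠ p in 𝓝 (0, y₀), Φ p ∈ e.target ∧
      (X : EuclideanSpace ℝ (Fin n) → EuclideanSpace ℝ (Fin n)) (Φ p) = chartField e (S.field u) (Φ p) :=
    hΦ.tendsto.eventually ((e.open_target.eventually_mem hy₀).and hX)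
  obtain ⟨δ, hδ, h⟩ := eventually_prod_box ((hΦ.deriv.and hinit).and htarget)
  refine eventually_of_prod_box hδ fun s y hs hy => ?_
  have h1 : IsMIntegralCurve (fun t => S.flow u t (e.symm y)) (S.field u) :=
    (Classical.choose_spec (S.complete u (e.symm y))).2
  have h2 : S.flow u 0 (e.symm y) = e.symm y :=
    (Classical.choose_spec (S.complete u (e.symm y))).1
  have h3 : IsMIntegralCurveOn (fun t => e.symm (Φ (t, y))) (S.field u) (Set.Ioo (-δ) δ) := by
    intro t ht
    obtain ⟨⟨hd, -⟩, hmem, hXe⟩ := h t y (abs_lt.2 ht) hy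
    have h4 : HasMFDerivAt 𝓘(ℝ, ℝ) (𝓡 n) (fun t => Φ (t, y)) t
        (ContinuousLinearMap.toSpanSingleton ℝ
          ((X : EuclideanSpace ℝ (Fin n) → EuclideanSpace ℝ (Fin n)) (Φ (t, y)))) :=
      hd.hasFDerivAt.hasMFDerivAt
    have h5 := ((mdifferentiable_of_mem_maximalAtlas he).mdifferentiableAt_symm hmem).hasMFDerivAt
    refine ((h5.comp t h4).congr_mfderiv ?_).hasMFDerivWithinAt
    ext
    rw [hXe]
    exact (congrArg (mfderiv (𝓡 n) (𝓡 n) e.symm (Φ (t, y))) (one_smul ℝ _)).trans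
      ((mfderiv_chartField he (S.field u) hmem).trans (one_smul ℝ _).symm)
  have hS1 : ContMDiff (𝓡 n) (𝓡 n).tangent 1
    (fun x => (⟨x, S.field u x⟩ : TangentBundle (𝓡 n) M)) :=
    (S.smooth u).of_le (WithTop.coe_le_coe.2 le_top)
  have : IsManifold (𝓡 n) 1 M := IsManifold.of_le (n := ∞) (WithTop.coe_le_coe.2 le_top)
  refine isMIntegralCurveOn_Ioo_eqOn_of_contMDiff_boundaryless (t₀ := 0) ⟨by linarith, hδ⟩
    hS1 (h1.isMIntegralCurveOn _) h3 ?_ (abs_lt.1 hs)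
  simp only [h2, (h 0 y (by simpa using hδ) hy).1.2]

theorem chronological_eq_flowProd [T2Space M] (he : e ∈ IsManifold.maximalAtlas (𝓡 n) ∞ M)
    (hy₀ : y₀ ∈ e.target) {l : ℕ} {v : Fin l → U}
    {X : Fin l → smoothMaps (EuclideanSpace ℝ (Fin n))}
    (hX : ∀ i, (X i : EuclideanSpace ℝ (Fin n) → EuclideanSpace ℝ (Fin n)) =ᶠ[𝓝 y₀]
      chartField e (S.field (v i)))
    {Φ : Fin l → ℝ × EuclideanSpace ℝ (Fin n) → EuclideanSpace ℝ (Fin n)}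
    (hΦ : ∀ i, IsLocalFlow (X i) y₀ (Φ i)) : ∀ {N : ℕ} (c : Fin N → Fin l),
    ∀ᶠ p : EuclideanSpace ℝ (Fin n) × (Fin N → ℝ) in 𝓝 (y₀, 0),
      S.chronological (v ∘ c) (e.symm p.1) p.2 = e.symm (flowProd Φ c p.1 p.2)
  | 0, _ => .of_forall fun _ => rfl
  | N + 1, c => by
    have h1 : Tendsto (fun p : EuclideanSpace ℝ (Fin n) × (Fin (N + 1) → ℝ) => (p.2 0, p.1))
        (𝓝 (y₀, 0)) (𝓝 (0, y₀)) :=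
      (by fun_prop : Continuous fun p : EuclideanSpace ℝ (Fin n) × (Fin (N + 1) → ℝ) =>
        (p.2 0, p.1)).tendsto' _ _ rfl
    have h2 : Tendsto (fun p : EuclideanSpace ℝ (Fin n) × (Fin (N + 1) → ℝ) => Fin.tail p.2)
        (𝓝 (y₀, 0)) (𝓝 0) :=
      (by unfold Fin.tail; fun_prop : Continuous fun p : EuclideanSpace ℝ (Fin n) ×
        (Fin (N + 1) → ℝ) => Fin.tail p.2).tendsto' _ _ rfl
    have h3 := ((hΦ (c 0)).tendsto.comp h1).prodMk_nhds h2
    filter_upwards [h1.eventually (flow_eq_of_isLocalFlow S he hy₀ (hX (c 0)) (hΦ (c 0))),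
      h3.eventually (chronological_eq_flowProd he hy₀ hX hΦ (Fin.tail c))] with p hp1 hp2
    change S.chronological (v ∘ Fin.tail c) (S.flow (v (c 0)) (p.2 0) (e.symm p.1)) (Fin.tail p.2) = _
    rw [hp1]
    exact hp2

theorem exists_chart_linearEquiv (he : e ∈ IsManifold.maximalAtlas (𝓡 n) ∞ M)
    {y : EuclideanSpace ℝ (Fin n)} (hy : y ∈ e.target) :
    ∃ D : EuclideanSpace ℝ (Fin n) ≃ₗ[ℝ] TangentSpace (𝓡 n) (e.symm y),
      ∀ V : (x : M) → TangentSpace (𝓡 n) x, D (chartField e V y) = V (e.symm y) := by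
  obtain ⟨D, hD⟩ := isInvertible_mfderiv_symm he hy
  refine ⟨D.toLinearEquiv, fun V => ?_⟩
  rw [← mfderiv_chartField he V hy, ← hD]
  rfl

theorem map_span_chartField {y : EuclideanSpace ℝ (Fin n)}
    (D : EuclideanSpace ℝ (Fin n) ≃ₗ[ℝ] TangentSpace (𝓡 n) (e.symm y))
    (hD : ∀ V : (x : M) → TangentSpace (𝓡 n) x, D (chartField e V y) = V (e.symm y)) :
    (Submodule.span ℝ (Set.range fun u => chartField e (S.field u) y)).map (D : _ →ₗ[ℝ] _) =
      S.controlSpan (e.symm y) := by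
  rw [Submodule.map_span, ← Set.range_comp, ControlSystem.controlSpan,
    ControlSystem.controlVectors]
  congr 2
  funext u
  exact hD (S.field u)

theorem finrank_span_chartField (he : e ∈ IsManifold.maximalAtlas (𝓡 n) ∞ M)
    {y : EuclideanSpace ℝ (Fin n)} (hy : y ∈ e.target) :
    Module.finrank ℝ (Submodule.span ℝ (Set.range fun u => chartField e (S.field u) y)) =
      Module.finrank ℝ (S.controlSpan (e.symm y)) := by
  obtain ⟨D, hD⟩ := exists_chart_linearEquiv he hy
  rw [← map_span_chartField S D hD]
  exact (LinearEquiv.finrank_map_eq D _).symm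

theorem convexHull_chartField (he : e ∈ IsManifold.maximalAtlas (𝓡 n) ∞ M)
    {y : EuclideanSpace ℝ (Fin n)} (hy : y ∈ e.target)
    (h : convexHull ℝ (S.controlVectors (e.symm y)) =
      (S.controlSpan (e.symm y) : Set (TangentSpace (𝓡 n) (e.symm y)))) :
    convexHull ℝ (Set.range fun u => chartField e (S.field u) y) =
      (Submodule.span ℝ (Set.range fun u => chartField e (S.field u) y) :
        Set (EuclideanSpace ℝ (Fin n))) := by
  obtain ⟨D, hD⟩ := exists_chart_linearEquiv he hy
  refine D.injective.image_injective ?_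
  have h1 : D '' (Set.range fun u => chartField e (S.field u) y) = S.controlVectors (e.symm y) := by
    rw [← Set.range_comp, ControlSystem.controlVectors]
    congr 1
    funext u
    exact hD (S.field u)
  have h2 := (D : EuclideanSpace ℝ (Fin n) →ₗ[ℝ] TangentSpace (𝓡 n) (e.symm y)).image_convexHull
    (Set.range fun u => chartField e (S.field u) y)
  have h3 : D '' (convexHull ℝ (Set.range fun u => chartField e (S.field u) y)) =
      convexHull ℝ (D '' (Set.range fun u => chartField e (S.field u) y)) := h2
  rw [h3, h1, h, ← map_span_chartField S D hD]
  rfl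

end Flows

end

noncomputable section

open Filter VectorField

/-! ### Spanning brackets and the point reached by the trajectory. -/

section Involved

variable {n : ℕ} {M : Type*} [TopologicalSpace M] [ChartedSpace (EuclideanSpace ℝ (Fin n)) M]
  [IsManifold (𝓡 n) ∞ M] {U : Type*} (S : ControlSystem n M U)
  {e : OpenPartialHomeomorph M (EuclideanSpace ℝ (Fin n))} {y₀ : EuclideanSpace ℝ (Fin n)}

theorem span_nestedFieldBracket_eq_top (he : e ∈ IsManifold.maximalAtlas (𝓡 n) ∞ M)
    (hy₀ : y₀ ∈ e.target) {l : ℕ} {v : Fin l → U}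
    {X : Fin l → smoothMaps (EuclideanSpace ℝ (Fin n))}
    (hX : ∀ i, (X i : EuclideanSpace ℝ (Fin n) → EuclideanSpace ℝ (Fin n)) =ᶠ[𝓝 y₀]
      chartField e (S.field (v i))) {s : Set U} (hs : s ⊆ Set.range v)
    (hLARC : ∀ w : TangentSpace (𝓡 n) (e.symm y₀),
      ∃ V, ControlSystem.InLieAlgebra (S.field '' s) V ∧ V (e.symm y₀) = w) :
    Submodule.span ℝ (Set.range fun β =>
      (nestedFieldBracket X β : EuclideanSpace ℝ (Fin n) → EuclideanSpace ℝ (Fin n)) y₀) = ⊤ := by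
  rw [← top_le_iff]
  intro z _
  obtain ⟨D, hD⟩ := exists_chart_linearEquiv he hy₀
  obtain ⟨V, hV, hVz⟩ := hLARC (D z)
  have hF : S.field '' s ⊆ Set.range fun i => S.field (v i) := by
    rintro _ ⟨u, hu, rfl⟩
    obtain ⟨i, rfl⟩ := hs hu
    exact ⟨i, rfl⟩
  obtain ⟨A, hA, hAV⟩ := exists_mem_nestedSpan_eventuallyEq he hy₀ (fun i => S.smooth (v i)) hX hF hV
  have hz : z = (A : EuclideanSpace ℝ (Fin n) → EuclideanSpace ℝ (Fin n)) y₀ := by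
    rw [hAV.self_of_nhds]
    exact D.injective (by rw [hD, hVz])
  let ev : smoothMaps (EuclideanSpace ℝ (Fin n)) →ₗ[ℝ] EuclideanSpace ℝ (Fin n) :=
    { toFun := fun V => (V : EuclideanSpace ℝ (Fin n) → EuclideanSpace ℝ (Fin n)) y₀
      map_add' := fun _ _ => rfl
      map_smul' := fun _ _ => rfl }
  have h1 : nestedSpan X ≤ (Submodule.span ℝ (Set.range fun β =>
      (nestedFieldBracket X β : EuclideanSpace ℝ (Fin n) → EuclideanSpace ℝ (Fin n)) y₀)).comap ev := by
    refine Submodule.span_le.2 ?_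
    rintro _ ⟨β, rfl⟩
    exact Submodule.subset_span ⟨β, rfl⟩
  rw [hz]
  exact h1 hA

theorem exists_finset_span_nestedBracket (he : e ∈ IsManifold.maximalAtlas (𝓡 n) ∞ M)
    (hy₀ : y₀ ∈ e.target) {l : ℕ} {v : Fin l → U}
    {X : Fin l → smoothMaps (EuclideanSpace ℝ (Fin n))}
    (hX : ∀ i, (X i : EuclideanSpace ℝ (Fin n) → EuclideanSpace ℝ (Fin n)) =ᶠ[𝓝 y₀]
      chartField e (S.field (v i)))
    (hspan : Submodule.span ℝ (Set.range fun β =>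
      (nestedFieldBracket X β : EuclideanSpace ℝ (Fin n) → EuclideanSpace ℝ (Fin n)) y₀) = ⊤) :
    ∃ B : Finset (List (Fin l)), Submodule.span ℝ {w : TangentSpace (𝓡 n) (e.symm y₀) |
      ∃ β ∈ B, w = ControlSystem.nestedBracket (fun i => S.field (v i)) β (e.symm y₀)} = ⊤ := by
  obtain ⟨d, b, hb, hbspan⟩ := exists_fin_family_span_eq_top hspan
  choose β hβ using hb
  obtain ⟨D, hD⟩ := exists_chart_linearEquiv he hy₀
  refine ⟨Finset.univ.image β, ?_⟩
  have h1 : (Submodule.span ℝ (Set.range b)).map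
      (D : EuclideanSpace ℝ (Fin n) →ₗ[ℝ] TangentSpace (𝓡 n) (e.symm y₀)) = ⊤ := by
    rw [hbspan, Submodule.map_top]
    exact LinearEquiv.range D
  rw [← top_le_iff, ← h1, Submodule.map_span]
  refine Submodule.span_mono ?_
  rintro _ ⟨_, ⟨k, rfl⟩, rfl⟩
  refine ⟨β k, Finset.mem_image_of_mem _ (Finset.mem_univ k), ?_⟩
  rw [← hβ k, ← hD (ControlSystem.nestedBracket (fun i => S.field (v i)) (β k))]
  exact congrArg D (nestedFieldBracket_eventuallyEq he hy₀ (fun i => S.smooth (v i)) hX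
    (β k)).self_of_nhds

/-- A curve starting at the base point contains a point which is reached at nearby times, if the
product returns to the base point at times where it is a submersion. -/
theorem exists_reached_point {N : ℕ} {g : (Fin N → ℝ) → EuclideanSpace ℝ (Fin n)}
    {G : (Fin N → ℝ) → M} (hg : ContDiffAt ℝ ∞ g 0)
    (he : e ∈ IsManifold.maximalAtlas (𝓡 n) ∞ M) (hy₀ : y₀ ∈ e.target)
    (hG : ∀ᶠ t in 𝓝 0, G t = e.symm (g t))
    {P : (Fin N → ℝ) → EuclideanSpace ℝ (Fin n)} (hP : ContDiff ℝ ∞ P)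
    (hret : ∃ᶠ t in 𝓝 (0 : Fin N → ℝ), (∀ i, 0 < t i) ∧ g t = y₀ ∧
      Function.Surjective (fderiv ℝ g t) ∧ Function.Surjective (fderiv ℝ P t))
    {γ : ℝ → M} {t₀ b : ℝ} (htb : t₀ < b) (hγ : ContinuousWithinAt γ (Set.Icc t₀ b) t₀)
    (hγ0 : γ t₀ = e.symm y₀) :
    ∃ ε > 0, t₀ + ε ≤ b ∧ ∃ t : Fin N → ℝ, (∀ i, 0 < t i) ∧ Function.Surjective (fderiv ℝ P t) ∧
      Function.Surjective (mfderiv 𝓘(ℝ, Fin N → ℝ) (𝓡 n) G t) ∧ γ (t₀ + ε) = G t := by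
  have hgC : ∀ᶠ t in 𝓝 0, ContDiffAt ℝ 1 g t :=
    (hg.of_le (m := 1) (by exact_mod_cast le_top)).eventually (by simp)
  obtain ⟨t, ⟨hpos, hgt, hs1, hs2⟩, hGt, hgCt⟩ :=
    (hret.and_eventually (hG.eventually_nhds.and hgC)).exists
  have hstrict := hgCt.hasStrictFDerivAt (by simp)
  -- A submersion is open, so the times near `t` cover a neighbourhood of the base point.
  have hopen : Filter.map g (𝓝 t) = 𝓝 y₀ := by
    rw [hstrict.map_nhds_eq_of_surj (LinearMap.range_eq_top.2 hs1), hgt]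
  have hcont : ContinuousAt (fderiv ℝ g) t :=
    (hgCt.fderiv_right (m := 0) (by norm_num)).continuousAt
  -- All requirements on `t` are open conditions, so they pass to the nearby times that reach points
  -- of the trajectory.
  have hev : ∀ᶠ t' in 𝓝 t, ((∀ i, 0 < t' i) ∧ Function.Surjective (fderiv ℝ P t')) ∧
      (Function.Surjective (fderiv ℝ g t') ∧ G =ᶠ[𝓝 t'] fun t => e.symm (g t)) ∧
      g t' ∈ e.target ∧ DifferentiableAt ℝ g t' := by
    refine ((eventually_all.2 fun i => ?_).and ?_).and ((Eventually.and ?_ ?_).and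
      (Eventually.and ?_ ?_))
    · exact (continuous_apply i).continuousAt.eventually_const_lt (hpos i)
    · exact (hP.continuous_fderiv (by simp)).continuousAt.eventually (eventually_surjective hs2)
    · exact hcont.eventually (eventually_surjective hs1)
    · exact hGt.eventually_nhds
    · exact hgCt.continuousAt.eventually (e.open_target.eventually_mem (by rwa [hgt]))
    · exact (hgCt.eventually (by simp)).mono fun t' ht' => ht'.differentiableAt (by simp)
  have himage : ∀ᶠ y in 𝓝 y₀, ∃ t', g t' = y ∧ ((∀ i, 0 < t' i) ∧
      Function.Surjective (fderiv ℝ P t')) ∧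
      (Function.Surjective (fderiv ℝ g t') ∧ G =ᶠ[𝓝 t'] fun t => e.symm (g t)) ∧
      g t' ∈ e.target ∧ DifferentiableAt ℝ g t' := by
    rw [← hopen]
    exact Filter.eventually_map.2 (hev.mono fun t' ht' => ⟨t', rfl, ht'⟩)
  have hshift : Tendsto (fun ε : ℝ => t₀ + ε) (𝓝[>] 0) (𝓝[Set.Icc t₀ b] t₀) := by
    refine tendsto_nhdsWithin_iff.2 ⟨?_, ?_⟩
    · exact ((by fun_prop : Continuous fun ε : ℝ => t₀ + ε).tendsto' 0 t₀ (by simp)).mono_left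
        nhdsWithin_le_nhds
    · filter_upwards [Ioo_mem_nhdsGT (sub_pos.2 htb)] with ε hε
      exact ⟨by linarith [hε.1], by linarith [hε.2]⟩
  have hγt : Tendsto (fun ε : ℝ => γ (t₀ + ε)) (𝓝[>] 0) (𝓝 (e.symm y₀)) := by
    rw [← hγ0]
    exact hγ.tendsto.comp hshift
  have hsrc : e.symm y₀ ∈ e.source := e.map_target hy₀
  have heγ : Tendsto (fun ε : ℝ => e (γ (t₀ + ε))) (𝓝[>] 0) (𝓝 y₀) := by
    have h1 := (e.continuousAt hsrc).tendsto
    rw [e.right_inv hy₀] at h1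
    exact h1.comp hγt
  obtain ⟨ε, ⟨⟨⟨t', ht', ⟨h1, h2⟩, ⟨h3, h4⟩, h5, h6⟩, h7⟩, h8⟩, hε⟩ :=
    (((heγ.eventually himage).and (hγt.eventually (e.open_source.eventually_mem hsrc))).and
      ((tendsto_nhdsWithin_iff.1 hshift).2)).and self_mem_nhdsWithin |>.exists
  refine ⟨ε, hε, h8.2, t', h1, h2, ?_, ?_⟩
  · have h9 := (mdifferentiable_of_mem_maximalAtlas he).mdifferentiableAt_symm h5
    have h10 : HasMFDerivAt 𝓘(ℝ, Fin N → ℝ) (𝓡 n) (fun t => e.symm (g t)) t'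
        ((mfderiv (𝓡 n) (𝓡 n) e.symm (g t')).comp (fderiv ℝ g t')) :=
      HasMFDerivAt.comp t' h9.hasMFDerivAt h6.hasFDerivAt.hasMFDerivAt
    have h11 := h10.congr_of_eventuallyEq h4
    rw [h11.mfderiv]
    exact ((mdifferentiable_of_mem_maximalAtlas he).symm.mfderiv_surjective h5).comp h3
  · rw [h4.self_of_nhds]
    change _ = e.symm (g t')
    rw [ht', e.left_inv h7]

end Involved

end

noncomputable section

open Filter

theorem taylorPoly_congr {N n : ℕ} {f g : (Fin N → ℝ) → EuclideanSpace ℝ (Fin n)}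
    (h : f =ᶠ[𝓝 0] g) (m : ℕ) :
    ControlSystem.taylorPoly f m = fun x => ∑ i ∈ Finset.range (m + 1), taylorTerm g i x := by
  funext x
  refine Finset.sum_congr rfl fun i _ => ?_
  rw [taylorTerm, (h.iteratedFDeriv (𝕜 := ℝ) i).self_of_nhds]

/-! ### Independence of the chart and conclusion. -/

section Involved

variable {n : ℕ} {M : Type*} [TopologicalSpace M] [ChartedSpace (EuclideanSpace ℝ (Fin n)) M]
  {e₀ e : OpenPartialHomeomorph M (EuclideanSpace ℝ (Fin n))} {y₀ : EuclideanSpace ℝ (Fin n)}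

theorem contDiffAt_chart_transition (he₀ : e₀ ∈ IsManifold.maximalAtlas (𝓡 n) ∞ M)
    (he : e ∈ IsManifold.maximalAtlas (𝓡 n) ∞ M) (hy₀ : y₀ ∈ e₀.target)
    (hsrc : e₀.symm y₀ ∈ e.source) : ContDiffAt ℝ ∞ (fun y => e (e₀.symm y)) y₀ :=
  contMDiffAt_iff_contDiffAt.1 <|
    (contMDiffAt_of_mem_maximalAtlas he hsrc).comp y₀ (contMDiffAt_symm_of_mem_maximalAtlas he₀ hy₀)

variable [IsManifold (𝓡 n) ∞ M]

theorem exists_hasFDerivAt_chart_transition (he₀ : e₀ ∈ IsManifold.maximalAtlas (𝓡 n) ∞ M)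
    (he : e ∈ IsManifold.maximalAtlas (𝓡 n) ∞ M) (hy₀ : y₀ ∈ e₀.target)
    (hsrc : e₀.symm y₀ ∈ e.source) :
    ∃ L : EuclideanSpace ℝ (Fin n) ≃L[ℝ] EuclideanSpace ℝ (Fin n),
      HasFDerivAt (fun y => e (e₀.symm y))
        (L : EuclideanSpace ℝ (Fin n) →L[ℝ] EuclideanSpace ℝ (Fin n)) y₀ := by
  have h := (mdifferentiable_of_mem_maximalAtlas he₀).symm.trans
    (mdifferentiable_of_mem_maximalAtlas he)
  refine ⟨h.mfderiv (x := y₀) ?_, ?_⟩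
  · exact ⟨hy₀, hsrc⟩
  · have h1 := (contDiffAt_chart_transition he₀ he hy₀ hsrc).differentiableAt (by simp)
    have h2 := h1.hasFDerivAt
    rw [← mfderiv_eq_fderiv] at h2
    exact h2

/-- The generators, the product and the order `J` are fixed in one chart `e₀`. An arbitrary chart
`e` enters only through the transition map, a local diffeomorphism, which plays the role of `ψ` in
the return lemma; so the order `m₀ = J` does not depend on `e`. -/
theorem isInvolved_chart_symm [T2Space M] {U : Type*} (S : ControlSystem n M U)
    (he₀ : e₀ ∈ IsManifold.maximalAtlas (𝓡 n) ∞ M) (hy₀ : y₀ ∈ e₀.target)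
    (hrank : ∀ᶠ x in 𝓝 (e₀.symm y₀),
      Module.finrank ℝ (S.controlSpan x) = Module.finrank ℝ (S.controlSpan (e₀.symm y₀)))
    (hample : S.IsAmple (e₀.symm y₀)) (hLARC : S.LARC (e₀.symm y₀)) :
    S.IsInvolved (e₀.symm y₀) := by
  obtain ⟨s, hs, hsLARC⟩ := hLARC
  have htarget := e₀.open_target.eventually_mem hy₀
  have hX : ∀ u, ∀ᶠ y in 𝓝 y₀, ContDiffAt ℝ ∞ (chartField e₀ (S.field u)) y := fun u =>
    htarget.mono fun y hy => contDiffAt_chartField he₀ (S.smooth u) hy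
  obtain ⟨l, v, hsv, a, ha, haq, hsum⟩ := exists_positive_relation hX
    (by
      filter_upwards [htarget, (e₀.continuousAt_symm hy₀).eventually hrank] with y h1 h2
      rw [finrank_span_chartField S he₀ h1, finrank_span_chartField S he₀ hy₀, h2])
    (convexHull_chartField S he₀ hy₀ hample.2) hs.toFinset
  obtain ⟨X, Y, b, hb, hbpos, hXe, hY, hYsum⟩ :=
    exists_global_positive_relation (fun i => hX (v i)) ha haq hsum
  have hspan := span_nestedFieldBracket_eq_top S he₀ hy₀ hXe
    (fun u hu => hsv u (hs.mem_toFinset.2 hu)) hsLARC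
  obtain ⟨B, hB⟩ := exists_finset_span_nestedBracket S he₀ hy₀ hXe hspan
  choose Φ hΦ using fun i => exists_isLocalFlow (X i) y₀
  have hXY : ∀ i, X i = fieldMul ((hb i).inv fun x => (hbpos i x).ne') (Y i) := fun i =>
    Subtype.ext <| funext fun x => by
      change _ = (b i x)⁻¹ • (Y i : EuclideanSpace ℝ (Fin n) → EuclideanSpace ℝ (Fin n)) x
      rw [hY, smul_smul, inv_mul_cancel₀ (hbpos i x).ne', one_smul]
  obtain ⟨N, c, hc, J, hJ⟩ := exists_flowProd_frequently_return hΦ hb (fun i => hbpos i y₀) hY hYsum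
    (span_bracketSpan_eq_top _ hXY hspan)
    -- The word containing all monomials of the chosen brackets one after the other, so that each of
    -- them is a subsequence of the product.
    (B.toList.flatMap fun β => (ControlSystem.bracketMonomials β).flatten)
  intro γ t₁ b t₀ hγ ht₁ ht₀ hγ0
  refine ⟨l, v, N, c, ?_⟩
  rw [hγ0]
  refine ⟨⟨B, hB, fun β hβ w hw => ?_⟩, J, fun m hm e he hsrc => ?_⟩
  · refine List.Sublist.trans ?_ hc
    rw [List.flatMap]
    exact (List.sublist_flatten_of_mem hw).trans
      (List.sublist_flatten_of_mem (List.mem_map_of_mem (Finset.mem_toList.2 hβ)))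
  · obtain ⟨L, hL⟩ := exists_hasFDerivAt_chart_transition he₀ he hy₀ hsrc
    have hg : ContDiffAt ℝ ∞ (flowProd Φ c y₀) 0 :=
      (contDiffAt_flowProd hΦ c).comp (0 : Fin N → ℝ)
        (contDiffAt_const.prodMk contDiffAt_id :
          ContDiffAt ℝ ∞ (fun t : Fin N → ℝ => (y₀, t)) 0)
    have hG : ∀ᶠ t in 𝓝 0, S.chronological (v ∘ c) (e₀.symm y₀) t = e₀.symm (flowProd Φ c y₀ t) :=
      ((by fun_prop : Continuous fun t : Fin N → ℝ => (y₀, t)).tendsto' 0 (y₀, 0) rfl).eventually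
        (chronological_eq_flowProd S he₀ hy₀ hXe hΦ c)
    obtain ⟨ε, hε, hεb, t, htpos, ht1, ht2, ht3⟩ := exists_reached_point hg he₀ hy₀ hG
      (ContDiff.sum fun i _ => contDiff_taylorTerm _ i)
      (hJ m hm _ L (contDiffAt_chart_transition he₀ he hy₀ hsrc) hL) ht₀
      ((hγ.1 t₀ ⟨ht₁, ht₀.le⟩).mono (Set.Icc_subset_Icc_left ht₁)) hγ0
    refine ⟨ε, hε, hεb, t, htpos, fun h => h ?_, ht2, ht3⟩
    rwa [taylorPoly_congr (g := fun t => e (e₀.symm (flowProd Φ c y₀ t)))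
      (hG.mono fun t ht => congrArg e ht)]

end Involved

end

theorem lemma5 {n : ℕ} {M : Type*} [TopologicalSpace M] [T2Space M]
    [ChartedSpace (EuclideanSpace ℝ (Fin n)) M] [IsManifold (𝓡 n) ∞ M] {U : Type*}
    (S : ControlSystem n M U) (q : M)
    (hrank : ∀ᶠ x in 𝓝 q,
      Module.finrank ℝ (S.controlSpan x) = Module.finrank ℝ (S.controlSpan q))
    (hample : S.IsAmple q) (hLARC : S.LARC q) :
    S.IsInvolved q := by
  -- Writing the base point as a value of the inverse chart avoids transport between tangent spaces.
  have h := (chartAt (EuclideanSpace ℝ (Fin n)) q).left_inv (mem_chart_source _ q)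
  rw [← h] at hrank hample hLARC ⊢
  exact isInvolved_chart_symm S (IsManifold.chart_mem_maximalAtlas q) (mem_chart_target _ q)
    hrank hample hLARC
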